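/- **Setting.** Let $E$ be a Polish space, $\dagger\notin E$ a cemetery state, and let $B(E)$ be the space of bounded measurable functions $f:E\to\mathbb C$; write $B_1(E)$ for those with $|f|\le 1$. Let $X_t=\sum_{i=1}^{N_t}\delta_{x_i(t)}$ be a branching Markov process: particles move independently in $E\cup\{\dagger\}$ according to a Markov process $\xi$ absorbed at $\dagger$ (jointly measurable in time and trajectory), a particle at $y\in E$ branches at rate $\gamma(y)$, where $\gamma\ge 0$ is bounded and measurable, and it is then replaced by a random finite number $N$ of offspring at positions $x_1,\dots,x_N\in E$, with law $\mathcal P_y$ and expectation $\mathcal E_y$. Put $X_t[f]=\int f\,dX_t$ (particles at $\dagger$ do not count), $\psi_t[f](x)=\mathbb E_{\delta_x}[X_t[f]]$ and, for $\boldsymbol f=(f_1,\dots,f_\ell)\in B(E)^\ell$ and $A\subseteq[\ell]=\{1,\dots,\ell\}$, $$\psi_t^{(A)}[\boldsymbol f](x)=\mathbb E_{\delta_x}\Big[\prod_{i\in A}X_t[f_i]\Big],\qquad \psi^{(\ell)}_t=\psi_t^{([\ell])}.$$ For a family of functions $g(B,\cdot):E\to\mathbb C$, $B\subseteq A$, let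 $$\zeta_A[g](x)=\mathcal E_x\Big[\sum_{\sigma}\ \sum_{\boldsymbol i}\ \prod_{j=1}^{|\sigma|}g(\sigma_j,x_{i_j})\Big],$$ where $\sigma=\{\sigma_1,\dots,\sigma_{|\sigma|}\}$ runs over the partitions of $A$ other than $\{A\}$ and $\boldsymbol i$ over the $|\sigma|$-tuples of pairwise distinct elements of $\{1,\dots,N\}$. **(H1).** There are an integer $m\ge1$, a real $\lambda_1>0$ and $\lambda_2,\dots,\lambda_m\in\mathbb C$ with $\lambda_1>\mathrm{Re}\,\lambda_2\ge\dots\ge\mathrm{Re}\,\lambda_m$, integers $p_i\ge1$ ($1\le i\le m$) and $k_{i,j}\ge1$ ($1\le j\le p_i$), functions $\varphi_{i,j}^{(k)}\in B(E)$ and bounded linear functionals $\tilde\varphi_{i,j}^{(k)}:B(E)\to\mathbb C$ ($1\le k\le k_{i,j}$) with $\tilde\varphi_{i,j}^{(k)}[\varphi_{i,j}^{(k)}]=1$ and $\tilde\varphi_{i,j}^{(k)}[\varphi_{\ell,n}^{(q)}]=0$ for $(i,j,k)\ne(\ell,n,q)$, and a linear operator $\mathcal N:B(E)\to B(E)$ such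 that: $\mathcal N\varphi_{i,1}^{(k)}=0$; for $2\le j\le p_i$ one has $\mathcal N\varphi_{i,j}^{(k)}=\varphi_{i,j-1}^{(k^*)}$ for some $k^*\in\{1,\dots,k_{i,j-1}\}$, where for fixed $i,j$ the map $k\mapsto k^*$ is injective; $\mathcal Nf=0$ for $f\in\ker(\lambda_m)$, where $$\ker(\lambda_n)=\{f\in B(E):\tilde\varphi_{i,j}^{(k)}[f]=0\text{ for all }1\le i\le n,\ 1\le j\le p_i,\ 1\le k\le k_{i,j}\};$$ for all $t\ge0$ and $f\in B(E)$, $\psi_t[\varphi_{i,j}^{(k)}]=e^{(\lambda_i+\mathcal N)t}\varphi_{i,j}^{(k)}$ and $\tilde\varphi_{i,j}^{(k)}[\psi_t[f]]=e^{\lambda_it}\tilde\varphi_{i,j}^{(k)}[e^{\mathcal Nt}f]$; and, with $\Phi_{i,j}[f]=\sum_{k=1}^{k_{i,j}}\tilde\varphi_{i,j}^{(k)}[f]\,\varphi_{i,j}^{(k)}$ and $\Phi_i=\sum_{j=1}^{p_i}\Phi_{i,j}$, $$\sup_{x\in E,\,f\in B_1(E)}e^{-\mathrm{Re}\lambda_m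 t}\Big|\psi_t[f](x)-\sum_{i=1}^m e^{(\lambda_i+\mathcal N)t}\Phi_i[f](x)\Big|\longrightarrow0\qquad(t\to\infty).$$ (These conditions force $\mathcal N$ to be nilpotent, so $e^{\mathcal Nt}$ is a finite sum.) If there is an index $\tau\in\{2,\dots,m\}$ with $2\mathrm{Re}\,\lambda_{\tau-1}\ge\lambda_1$ and $2\mathrm{Re}\,\lambda_\tau<\lambda_1$ (it is then unique), set $\mathrm{Ei}(\Lambda_S)=\ker(\lambda_{\tau-1})$; otherwise set $\mathrm{Ei}(\Lambda_S)=\emptyset$. Put $\mathrm{Ei}_1(\Lambda_S)=\mathrm{Ei}(\Lambda_S)\cap B_1(E)$. **Theorem (small regime).** Assume (H1) and that $\sup_{x\in E}\mathcal E_x[N^k]<\infty$ for some integer $k\ge2$. Then, for $1\le\ell\le k$, the products $\prod_{i=1}^{\ell}X_t[f_i]$ with $f_1,\dots,f_\ell\in B(E)$ are integrable under $\mathbb P_{\delta_x}$ for all $t\ge 0$, $x\in E$. For $\boldsymbol f\in\mathrm{Ei}(\Lambda_S)^\ell$ and $A\subseteq[\ell]$ define $L_A[\boldsymbol f]$ as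 follows. If $|A|=2$, $$L_A[\boldsymbol f](x)=\frac1{(p_1-1)!}\Phi_{1,1}\Big[\mathcal N^{p_1-1}\Big(\prod_{i\in A}f_i\Big)\Big](x)+\frac1{(p_1-1)!}\int_0^\infty e^{-\lambda_1s}\,\Phi_{1,1}\Big[\mathcal N^{p_1-1}\big(\gamma\,\zeta_A[\psi_s^{(\cdot)}[\boldsymbol f]]\big)\Big](x)\,ds;$$ if $|A|\ge4$ is even, recursively, $$L_A[\boldsymbol f](x)=\int_0^\infty e^{-\lambda_1|A|s/2}\,\psi_s\big[\gamma\,\zeta_A[L_\cdot[\boldsymbol f]]\big](x)\,ds;$$ and $L_A[\boldsymbol f]=0$ otherwise. These are well defined: the arguments of $\Phi_{1,1}\mathcal N^{p_1-1}$ and $\psi_s$ lie in $B(E)$ and the integrals converge absolutely. Moreover, with $$\Delta_{\ell,t}=\sup_{x\in E,\ \boldsymbol f\in\mathrm{Ei}_1(\Lambda_S)^\ell}\Big|e^{-\ell\lambda_1t/2}(1+t)^{-\ell(p_1-1)/2}\,\psi_t^{(\ell)}[\boldsymbol f](x)-L_{[\ell]}[\boldsymbol f](x)\Big|,$$ we have,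 for every $1\le\ell\le k$, $$\sup_{t\ge0}\Delta_{\ell,t}<\infty\qquad\text{and}\qquad\lim_{t\to\infty}\Delta_{\ell,t}=0.$$ -/

import Mathlib

open MeasureTheory ProbabilityTheory Filter Topology
open scoped NNReal ENNReal

namespace BranchingMoments

/-- The state space with a cemetery state `†` added; `Sum.inl x` is the point `x` of `E` and
`Sum.inr ()` is `†`. -/
abbrev WithCemetery (E : Type*) := E ⊕ Unit

/-- A finite family `(N, (x_1, …, x_N))` of points of `E`. -/
abbrev Config (E : Type*) := Σ n : ℕ, (Fin n → E)

/-- A (time-homogeneous, measurable) Markov process with values in `E ∪ {†}`, absorbed at `†`.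
`path t w` is the position at time `t` of the trajectory `w : Ξ`, and `law z` is the law of the
trajectory when the process is issued from `z`. -/
structure MarkovMotion (E Ξ : Type*) [MeasurableSpace E] [MeasurableSpace Ξ] where
  path : ℝ≥0 → Ξ → WithCemetery E
  law : Kernel (WithCemetery E) Ξ
  isMarkovKernel : IsMarkovKernel law
  measurable_path : Measurable (fun q : ℝ≥0 × Ξ => path q.1 q.2)
  start : ∀ z, ∀ᵐ w ∂(law z), path 0 w = z
  absorbed : ∀ t, ∀ᵐ w ∂(law (Sum.inr ())), path t w = Sum.inr ()
  /-- The simple Markov property with respect to the natural filtration. -/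
  markov : ∀ (z : WithCemetery E) (s t : ℝ≥0) (A : Set Ξ) (C : Set (WithCemetery E)),
    MeasurableSet[⨆ r : Set.Iic s,
      MeasurableSpace.comap (path r) (inferInstance : MeasurableSpace (WithCemetery E))] A →
    MeasurableSet C →
    law z (A ∩ {w | path (s + t) w ∈ C})
      = ∫⁻ w in A, law (path s w) {w' | path t w' ∈ C} ∂(law z)

/-- The data of a branching Markov process: the motion of a single particle, the bounded branching
rate `γ`, and the law of the number and positions of the offspring of a particle that branches
at `y`. -/
structure BranchingModel (E Ξ : Type*) [MeasurableSpace E] [MeasurableSpace Ξ] where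
  motion : MarkovMotion E Ξ
  rate : E → ℝ≥0
  measurable_rate : Measurable rate
  bounded_rate : ∃ C : ℝ≥0, ∀ y, rate y ≤ C
  offspring : Kernel E (Config E)
  isMarkovKernel : IsMarkovKernel offspring

/-- The marks carried by one particle: its trajectory, counted from its birth, its exponential
clock, and its family of offspring. -/
abbrev Mark (E Ξ : Type*) := Ξ × ℝ × Config E

/-- A marked Ulam-Harris tree. The root is `[]`, and `i :: u` is the particle `u` of the subtree
rooted at the `i`-th child of the root. Marks at labels which do not belong to the genealogy are
never read. -/
abbrev Tree (E Ξ : Type*) := List ℕ → Mark E Ξ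

/-- The subtree rooted at the `i`-th child of the root. -/
def subtree {E Ξ : Type*} (i : ℕ) (τ : Tree E Ξ) : Tree E Ξ := fun u => τ (i :: u)

namespace BranchingModel

variable {E Ξ : Type*} [MeasurableSpace E] [MeasurableSpace Ξ] (M : BranchingModel E Ξ)

/-- The total branching rate `∫₀ˢ γ(ξ_r) dr` accumulated along a trajectory, with `γ(†) = 0`. -/
noncomputable def clock (w : Ξ) (s : ℝ≥0) : ℝ≥0∞ :=
  ∫⁻ r in Set.Icc (0 : ℝ) s, (Sum.elim M.rate (fun _ => 0) (M.motion.path r.toNNReal w) : ℝ≥0)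

/-- The age at which a particle with trajectory `w` and exponential clock `e` branches (`∞` if it
never does): the first time at which `∫₀ˢ γ(ξ_r) dr` reaches `e`. -/
noncomputable def branchAge (w : Ξ) (e : ℝ) : ℝ≥0∞ :=
  sInf {T : ℝ≥0∞ | ∃ s : ℝ≥0, T = s ∧ ENNReal.ofReal e ≤ M.clock w s}

/-- The law of the offspring of a particle with trajectory `w` and clock `e`: it is the offspring
law at the position at which the particle branches. If the particle does not branch, the
offspring is never read, and it is empty by convention. -/
noncomputable def offspringAt (w : Ξ) (e : ℝ) : Measure (Config E) :=
  if M.branchAge w e = ∞ then Measure.dirac ⟨0, Fin.elim0⟩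
  else match M.motion.path (M.branchAge w e).toNNReal w with
    | Sum.inl y => M.offspring y
    | Sum.inr _ => Measure.dirac ⟨0, Fin.elim0⟩

/-- `Q x` is the law of the genealogical tree of the branching Markov process issued from one
particle at `x`: the root moves according to the motion issued from `x`, it branches at rate `γ`
along its trajectory (the first time the accumulated rate reaches an independent standard exponential
variable), its offspring have the offspring law at the place of branching, and, given the mark of
the root with offspring positions `x_1, …, x_N`, the subtrees of the children are independent with
laws `Q x_1, …, Q x_N`. -/
structure IsTreeLaw (Q : Kernel E (Tree E Ξ)) : Prop where
  isMarkovKernel : IsMarkovKernel Q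
  branching : ∀ (x : E) (g : Mark E Ξ → ℝ≥0∞) (h : ℕ → Tree E Ξ → ℝ≥0∞),
    Measurable g → (∀ i, Measurable (h i)) →
    ∫⁻ τ, g (τ []) * ∏ i ∈ Finset.range (τ []).2.2.1, h i (subtree i τ) ∂(Q x)
      = ∫⁻ w, ∫⁻ e, ∫⁻ o, g (w, e, o) * ∏ i : Fin o.1, ∫⁻ τ, h i τ ∂(Q (o.2 i))
          ∂(M.offspringAt w e) ∂(expMeasure 1) ∂(M.motion.law (Sum.inl x))

/-- The position at time `t` of the particle with the given label, counted as `†` if this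
particle is not alive (not yet born, already branched, not in the genealogy, or absorbed). -/
noncomputable def position : List ℕ → Tree E Ξ → ℝ≥0 → WithCemetery E
  | [], τ, t =>
    if (t : ℝ≥0∞) < M.branchAge (τ []).1 (τ []).2.1 then M.motion.path t (τ []).1
    else Sum.inr ()
  | i :: u, τ, t =>
    if M.branchAge (τ []).1 (τ []).2.1 ≤ t ∧ i < (τ []).2.2.1 then
      position u (subtree i τ) (t - (M.branchAge (τ []).1 (τ []).2.1).toNNReal)
    else Sum.inr ()

/-- The branching Markov process `X_t = ∑ δ_{x_i(t)}`, the sum being over the particles that are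
alive in `E` at time `t`. -/
noncomputable def X (t : ℝ≥0) (τ : Tree E Ξ) : Measure E :=
  Measure.sum fun u : List ℕ =>
    Sum.elim (fun y => Measure.dirac y) (fun _ => 0) (M.position u τ t)

end BranchingModel

section FunctionSpace

variable (E : Type*) [MeasurableSpace E]

/-- `B(E)`: the algebra of bounded measurable functions `E → ℂ`. -/
def B : Subalgebra ℂ (E → ℂ) where
  carrier := {f | Measurable f ∧ ∃ C : ℝ, ∀ x, ‖f x‖ ≤ C}
  mul_mem' := by
    rintro f g ⟨hf, C, hC⟩ ⟨hg, D, hD⟩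
    refine ⟨hf.mul hg, C * D, fun x => ?_⟩
    rw [Pi.mul_apply, norm_mul]
    exact mul_le_mul (hC x) (hD x) (norm_nonneg _) ((norm_nonneg _).trans (hC x))
  add_mem' := by
    rintro f g ⟨hf, C, hC⟩ ⟨hg, D, hD⟩
    exact ⟨hf.add hg, C + D, fun x => (norm_add_le _ _).trans (add_le_add (hC x) (hD x))⟩
  algebraMap_mem' := fun r => ⟨measurable_const, ‖r‖, fun _ => le_rfl⟩

variable {E}

/-- The functions in `B(E)` that are bounded by unity. -/
def B₁ : Set (B E) := {f | ∀ x, ‖(f : E → ℂ) x‖ ≤ 1}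

open Classical in
/-- A function that lies in `B(E)`, as an element of `B(E)`; the value is `0` by convention for
other functions. -/
noncomputable def toB (g : E → ℂ) : B E := if h : g ∈ B E then ⟨g, h⟩ else 0

end FunctionSpace

section Moments

variable {E Ξ : Type*} [MeasurableSpace E] [MeasurableSpace Ξ] (M : BranchingModel E Ξ)
  (Q : Kernel E (Tree E Ξ))

/-- The linear semigroup `ψ_t[f](x) = 𝔼_{δ_x}[X_t[f]]`. -/
noncomputable def psi (t : ℝ≥0) (f : E → ℂ) (x : E) : ℂ :=
  ∫ τ, (∫ y, f y ∂(M.X t τ)) ∂(Q x)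

/-- The moments `ψ_t^{(A)}[f](x) = 𝔼_{δ_x}[∏_{i ∈ A} X_t[f_i]]`. -/
noncomputable def psiMoment {l : ℕ} (t : ℝ≥0) (f : Fin l → B E) (A : Finset (Fin l)) (x : E) : ℂ :=
  ∫ τ, ∏ i ∈ A, (∫ y, (f i : E → ℂ) y ∂(M.X t τ)) ∂(Q x)

/-- `γ(x) ζ_A[g](x)`, where `ζ_A[g](x) = 𝓔_x[∑_σ ∑_i ∏_j g(σ_j, x_{i_j})]`. The first sum is over
the partitions `σ` of `A` other than `{A}`; the second one is over all ways to choose pairwise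
distinct offspring for the blocks of `σ`. -/
noncomputable def rateZeta {l : ℕ} (A : Finset (Fin l)) (g : Finset (Fin l) → E → ℂ) (x : E) : ℂ :=
  (M.rate x : ℝ) * ∫ o, ∑ σ : Finpartition A with σ.parts ≠ {A},
    ∑ i : σ.parts ↪ Fin o.1, ∏ b : σ.parts, g b (o.2 (i b)) ∂(M.offspring x)

end Moments

/-- The objects in the spectral assumption: the number `m` of eigenvalues, the eigenvalues
`eig i = λ_i`, the maximal ranks `p i`, the numbers `mult i j = k_{i,j}`, the generalised
eigenfunctions `phi i j k`, the functionals `phiDual i j k`, and the operator `N`. All indices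
start at `1`, and only `1 ≤ i ≤ m`, `1 ≤ j ≤ p i`, `1 ≤ k ≤ mult i j` are used. -/
structure SpectralData (E : Type*) [MeasurableSpace E] where
  m : ℕ
  eig : ℕ → ℂ
  p : ℕ → ℕ
  mult : ℕ → ℕ → ℕ
  phi : ℕ → ℕ → ℕ → B E
  phiDual : ℕ → ℕ → ℕ → (B E →ₗ[ℂ] ℂ)
  N : Module.End ℂ (B E)

namespace SpectralData

variable {E : Type*} [MeasurableSpace E] (S : SpectralData E)

/-- `(i, j, k)` is one of the indices of the generalised eigenfunctions. -/
def IsIndex (i j k : ℕ) : Prop :=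
  (1 ≤ i ∧ i ≤ S.m) ∧ (1 ≤ j ∧ j ≤ S.p i) ∧ (1 ≤ k ∧ k ≤ S.mult i j)

/-- `ker(λ_n)`: the functions on which all functionals with first index at most `n` vanish. -/
def ker (n : ℕ) : Set (B E) :=
  {f | ∀ i j k, S.IsIndex i j k → i ≤ n → S.phiDual i j k f = 0}

/-- The projection `Φ_{i,j}`. -/
noncomputable def projRank (i j : ℕ) (f : B E) : B E :=
  ∑ k ∈ Finset.Icc 1 (S.mult i j), S.phiDual i j k f • S.phi i j k

/-- The projection `Φ_i = ∑_j Φ_{i,j}`. -/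
noncomputable def proj (i : ℕ) (f : B E) : B E :=
  ∑ j ∈ Finset.Icc 1 (S.p i), S.projRank i j f

/-- `e^{𝓝 t}`; the operator `𝓝` is nilpotent under the spectral assumption. -/
noncomputable def expN (t : ℝ≥0) : Module.End ℂ (B E) := IsNilpotent.exp (((t : ℝ) : ℂ) • S.N)

/-- The spectral assumption (H1) on a semigroup `ψ`. -/
structure H1 (ψ : ℝ≥0 → (E → ℂ) → E → ℂ) : Prop where
  one_le_m : 1 ≤ S.m
  one_le_p : ∀ i, 1 ≤ i → i ≤ S.m → 1 ≤ S.p i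
  one_le_mult : ∀ i j, 1 ≤ i → i ≤ S.m → 1 ≤ j → j ≤ S.p i → 1 ≤ S.mult i j
  eig_one_im : (S.eig 1).im = 0
  eig_one_pos : 0 < (S.eig 1).re
  eig_lt : ∀ i, 2 ≤ i → i ≤ S.m → (S.eig i).re < (S.eig 1).re
  eig_anti : ∀ i i', 2 ≤ i → i ≤ i' → i' ≤ S.m → (S.eig i').re ≤ (S.eig i).re
  phiDual_bounded : ∀ i j k, S.IsIndex i j k → ∃ C : ℝ, ∀ f ∈ B₁, ‖S.phiDual i j k f‖ ≤ C
  phiDual_self : ∀ i j k, S.IsIndex i j k → S.phiDual i j k (S.phi i j k) = 1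
  phiDual_other : ∀ i j k i' j' k', S.IsIndex i j k → S.IsIndex i' j' k' →
    (i, j, k) ≠ (i', j', k') → S.phiDual i j k (S.phi i' j' k') = 0
  N_rank_one : ∀ i k, S.IsIndex i 1 k → S.N (S.phi i 1 k) = 0
  /-- `𝓝 φ_{i,j}^{(k)} = φ_{i,j-1}^{(k*)}` for `j ≥ 2`, where `k ↦ k*` is injective. -/
  N_chain : ∀ i j, 1 ≤ i → i ≤ S.m → 2 ≤ j → j ≤ S.p i →
    ∃ ks : ℕ → ℕ, Set.InjOn ks (Set.Icc 1 (S.mult i j)) ∧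
      ∀ k ∈ Set.Icc 1 (S.mult i j), ks k ∈ Set.Icc 1 (S.mult i (j - 1)) ∧
        S.N (S.phi i j k) = S.phi i (j - 1) (ks k)
  N_ker : ∀ f ∈ S.ker S.m, S.N f = 0
  psi_phi : ∀ i j k, S.IsIndex i j k → ∀ (t : ℝ≥0) (x : E),
    ψ t (S.phi i j k : E → ℂ) x
      = Complex.exp (S.eig i * (t : ℝ)) * (S.expN t (S.phi i j k) : E → ℂ) x
  phiDual_psi : ∀ i j k, S.IsIndex i j k → ∀ (t : ℝ≥0) (f : B E),
    S.phiDual i j k (toB (ψ t (f : E → ℂ)))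
      = Complex.exp (S.eig i * (t : ℝ)) * S.phiDual i j k (S.expN t f)
  asymptotics : Tendsto (fun t : ℝ≥0 => ⨆ (x : E) (f : B E) (_ : f ∈ B₁),
      ‖(Real.exp (-(S.eig S.m).re * t) : ℂ) * (ψ t (f : E → ℂ) x
        - ∑ i ∈ Finset.Icc 1 S.m,
            Complex.exp (S.eig i * (t : ℝ)) * (S.expN t (S.proj i f) : E → ℂ) x)‖ₑ)
    atTop (𝓝 0)

/-- `n` is the index `τ` of the first small eigenvalue: `2 Re λ_{n-1} ≥ λ_1` and
`2 Re λ_n < λ_1`. -/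
def IsFirstSmall (n : ℕ) : Prop :=
  2 ≤ n ∧ n ≤ S.m ∧ (S.eig 1).re ≤ 2 * (S.eig (n - 1)).re ∧ 2 * (S.eig n).re < (S.eig 1).re

/-- `Ei(Λ_S) = ker(λ_{τ-1})`, which is empty if there are no small eigenvalues. -/
def smallSpace : Set (B E) := {f | ∃ n, S.IsFirstSmall n ∧ f ∈ S.ker (n - 1)}

/-- `Ei₁(Λ_S)`: the functions in `Ei(Λ_S)` that are bounded by unity. -/
def smallSpaceOne : Set (B E) := S.smallSpace ∩ B₁

end SpectralData

section Limit

variable {E Ξ : Type*} [MeasurableSpace E] [MeasurableSpace Ξ] (M : BranchingModel E Ξ)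
  (Q : Kernel E (Tree E Ξ)) (S : SpectralData E)

/-- `e^{-λ_1 s} Φ_{1,1}[𝓝^{p_1-1}(γ ζ_A[ψ_s^{(·)}[f]])](x)`. -/
noncomputable def pairIntegrand {l : ℕ} (f : Fin l → B E) (A : Finset (Fin l)) (x : E) (s : ℝ) :
    ℂ :=
  (Real.exp (-((S.eig 1).re * s)) : ℂ) *
    (S.projRank 1 1 ((S.N ^ (S.p 1 - 1))
      (toB (rateZeta M A (psiMoment M Q s.toNNReal f)))) : E → ℂ) x

/-- `e^{-λ_1 |A| s / 2} ψ_s[γ ζ_A[L]](x)`. -/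
noncomputable def recIntegrand {l : ℕ} (L : Finset (Fin l) → E → ℂ) (A : Finset (Fin l)) (x : E)
    (s : ℝ) : ℂ :=
  (Real.exp (-((S.eig 1).re * A.card * s / 2)) : ℂ) * psi M Q s.toNNReal (rateZeta M A L) x

/-- The limits `L_A[f]`. In the recursion only the values of `L` at proper subsets of `A` enter
(see `limitL_eq` for the equation without the case distinction). -/
noncomputable def limitL {l : ℕ} (f : Fin l → B E) (A : Finset (Fin l)) : E → ℂ :=
  if A.card = 2 then
    fun x => ((S.p 1 - 1).factorial : ℂ)⁻¹ *
        (S.projRank 1 1 ((S.N ^ (S.p 1 - 1)) (∏ i ∈ A, f i)) : E → ℂ) x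
      + ((S.p 1 - 1).factorial : ℂ)⁻¹ * ∫ s in Set.Ioi (0 : ℝ), pairIntegrand M Q S f A x s
  else if Even A.card ∧ 4 ≤ A.card then
    fun x => ∫ s in Set.Ioi (0 : ℝ),
      recIntegrand M Q S (fun b => if _h : b ⊂ A then limitL f b else 0) A x s
  else 0
termination_by A.card
decreasing_by exact Finset.card_lt_card _h

theorem rateZeta_congr {l : ℕ} (A : Finset (Fin l)) {g h : Finset (Fin l) → E → ℂ}
    (H : ∀ b, b ⊂ A → g b = h b) : rateZeta M A g = rateZeta M A h := by
  funext x
  unfold rateZeta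
  congr 2
  funext o
  refine Finset.sum_congr rfl fun σ hσ => Finset.sum_congr rfl fun i _ =>
    Finset.prod_congr rfl fun b _ => ?_
  have hσ' : σ.parts ≠ {A} := (Finset.mem_filter.1 hσ).2
  rw [H b.1 ?_]
  refine lt_of_le_of_ne (σ.le b.2) fun hb => hσ' ?_
  have hA : A ∈ σ.parts := by have := b.2; rwa [hb] at this
  refine Finset.eq_singleton_iff_unique_mem.2 ⟨hA, fun c hc => ?_⟩
  by_contra hne
  have hd := σ.disjoint hc hA hne
  exact σ.ne_bot hc (disjoint_self.1 (hd.mono_right (σ.le hc)))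

/-- The recursion for `L_A[f]` when `|A| ≥ 4` is even. -/
theorem limitL_eq {l : ℕ} (f : Fin l → B E) (A : Finset (Fin l)) (he : Even A.card)
    (h4 : 4 ≤ A.card) (x : E) :
    limitL M Q S f A x = ∫ s in Set.Ioi (0 : ℝ), recIntegrand M Q S (limitL M Q S f) A x s := by
  rw [limitL, if_neg (by omega), if_pos ⟨he, h4⟩]
  have h := rateZeta_congr M A (g := fun b => if _h : b ⊂ A then limitL M Q S f b else 0)
    (h := limitL M Q S f) (fun b hb => by simp [hb])
  simp only [recIntegrand]
  rw [h]

/-- All functions and integrals that occur in the definition of the `L_A[f]` make sense. -/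
def LimitWellDefined {l : ℕ} (f : Fin l → B E) : Prop :=
  ∀ A : Finset (Fin l),
    (A.card = 2 →
      (∀ s : ℝ≥0, rateZeta M A (psiMoment M Q s f) ∈ B E) ∧
      ∀ x, IntegrableOn (pairIntegrand M Q S f A x) (Set.Ioi 0)) ∧
    (Even A.card → 4 ≤ A.card →
      rateZeta M A (limitL M Q S f) ∈ B E ∧
      ∀ x, IntegrableOn (recIntegrand M Q S (limitL M Q S f) A x) (Set.Ioi 0))

/-- `Δ_{l,t}`, the uniform distance between the rescaled moment and its limit. -/
noncomputable def Delta (l : ℕ) (t : ℝ≥0) : ℝ≥0∞ :=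
  ⨆ (x : E) (f : Fin l → B E) (_ : ∀ i, f i ∈ S.smallSpaceOne),
    ‖((Real.exp (-(l * (S.eig 1).re * t / 2)) *
        (1 + (t : ℝ)) ^ (-(l * ((S.p 1 : ℝ) - 1) / 2)) : ℝ) : ℂ) *
        psiMoment M Q t f Finset.univ x - limitL M Q S f Finset.univ x‖ₑ

end Limit

end BranchingMoments

namespace BranchingMoments

/-! The moments form a closed hierarchy. Splitting the tree at the first branching event and
resumming gives the evolution equation (`psiMoment_evolution`) ψ_t^{(A)}[f] = ψ_t[∏_{i∈A} f_i] +
∫_0^t ψ_s[γ ζ_A[ψ_{t-s}^{(·)}[f]]] ds, whose source involves only proper nonempty subsets of A. So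
one argues by strong induction on |A|. With the weight w(t) = e^{-λ_1 t/2} (1+t)^{-(p_1-1)/2}, the
claim is that w(t)^{|A|} ψ_t^{(A)}[f] is bounded and converges to L_A[f], uniformly over the
starting point and over functions of the small space bounded by R. There are three cases.

|A| = 1 (`moment_singleton`): on the small space ψ_t grows at most like e^{βt} with 2β < λ_1, so the
limit is zero.

|A| = 2 (`moment_pair`): with u = t - s, the source at time u is quadratic in first moments, hence
of order e^{2βu}, while w(t)² ψ_{t-u}[h] tends to e^{-λ_1 u} Φ_{1,1}[𝓝^{p_1-1} h] / (p_1-1)!. The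
integrand is dominated by a multiple of e^{-(λ_1-2β)u}, so the relevant branchings occur at bounded
distance from t. The product term has the same order and survives.

|A| ≥ 3 (`moment_of_ssubset`): by homogeneity of ζ_A, the weighted integrand is (w(t)/w(t-s))^{|A|}
times ψ_s[γ ζ_A[·]] applied to the normalised lower moments at time t - s. These converge by
induction and the ratio tends to e^{-λ_1|A|s/2}. The integrand is dominated by a multiple of
e^{(1-|A|/2)λ_1 s} (1+s)^{p_1-1}, which is integrable because |A| ≥ 3; now early branchings dominate
and the product term vanishes. If |A| is odd, every partition has an odd block, so the limit is
zero.

The evolution equation is first proved for nonnegative functions, with values in [0,∞]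
(`momentE_evolution`). Both sides solve the same equation for the semigroup killed at rate γ;
comparing generation-truncated iterates of each side with the other side replaces a uniqueness
theorem and needs no finiteness. The growth bound `lintegral_X_univ_pow_le` makes everything finite,
and multilinearity extends the identity to complex functions.

On the spectral side, 𝓝 lowers the rank and kills ker(λ_m), so it is nilpotent, and Φ_{1,1}
𝓝^{p_1-1} = 𝓝^{p_1-1} Φ_1 (`projRank_N_pow`); this identifies the leading term of ψ_t
(`exists_leading_error`). Uniformity is handled by dominated convergence along the filter `atTop ×ˢ
𝓟 P`, where `P` is the parameter set (`tendsto_setIntegral_Ioc_sub`). -/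

theorem one_sub_exp_neg_integral_eq {g : ℝ → ℝ} {K : ℝ} (hg : Measurable g) (h0 : ∀ s, 0 ≤ g s)
    (hK : ∀ s, g s ≤ K) {t : ℝ} (ht : 0 ≤ t) :
    ∫ s in (0 : ℝ)..t, g s * Real.exp (-∫ r in (0 : ℝ)..s, g r)
      = 1 - Real.exp (-∫ r in (0 : ℝ)..t, g r) := by
  have hint : ∀ a b, IntervalIntegrable g volume a b := fun a b =>
    (intervalIntegrable_const (c := K)).mono_fun hg.aestronglyMeasurable
      (Eventually.of_forall fun s => by
        simp only [Real.norm_eq_abs]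
        rw [abs_of_nonneg (h0 s)]
        exact (hK s).trans (le_abs_self K))
  set c : ℝ → ℝ := fun s => ∫ r in (0 : ℝ)..s, g r with hc
  have hcc : Continuous c := intervalIntegral.continuous_primitive hint 0
  have hint2 : ∀ a b, IntervalIntegrable (fun s => g s * Real.exp (-c s)) volume a b := fun a b =>
    (hint a b).mul_continuousOn (by fun_prop)
  have hdiff : ∀ a b, c b - c a = ∫ r in a..b, g r := fun a b =>
    intervalIntegral.integral_interval_sub_left (hint 0 b) (hint 0 a)
  have hK0 : 0 ≤ K := (h0 0).trans (hK 0)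
  have hcd : ∀ a b, a ≤ b → 0 ≤ c b - c a ∧ c b - c a ≤ K * (b - a) := by
    intro a b hab
    rw [hdiff]
    refine ⟨intervalIntegral.integral_nonneg hab fun s _ => h0 s, ?_⟩
    calc ∫ r in a..b, g r ≤ ∫ _ in a..b, K :=
          intervalIntegral.integral_mono_on hab (hint a b) (by simp) fun s _ => hK s
      _ = K * (b - a) := by simp [mul_comm]
  -- The rate is only measurable, so its primitive need not be differentiable everywhere. Instead
  -- `H` is shown to have increments of second order, which forces it to be constant.
  set H : ℝ → ℝ := fun s => Real.exp (-c s) + ∫ r in (0 : ℝ)..s, g r * Real.exp (-c r) with hH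
  have hle : ∀ a b, 0 ≤ a → a ≤ b → |H b - H a| ≤ K ^ 2 * (b - a) ^ 2 := by
    intro a b ha hab
    have hca : 0 ≤ c a := by simpa [hc] using (hcd 0 a ha).1
    obtain ⟨hd0, hd1⟩ := hcd a b hab
    have e1 : H b - H a = Real.exp (-c b) - Real.exp (-c a)
        + ∫ r in a..b, g r * Real.exp (-c r) := by
      rw [← intervalIntegral.integral_interval_sub_left (hint2 0 b) (hint2 0 a)]; simp [hH]; ring
    have up : ∫ r in a..b, g r * Real.exp (-c r) ≤ (c b - c a) * Real.exp (-c a) := by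
      rw [hdiff, ← intervalIntegral.integral_mul_const]
      refine intervalIntegral.integral_mono_on hab (hint2 a b) ((hint a b).mul_const _)
        fun s hs => mul_le_mul_of_nonneg_left ?_ (h0 s)
      exact Real.exp_le_exp.2 (by linarith [(hcd a s hs.1).1])
    have lo : (c b - c a) * Real.exp (-c b) ≤ ∫ r in a..b, g r * Real.exp (-c r) := by
      rw [hdiff, ← intervalIntegral.integral_mul_const]
      refine intervalIntegral.integral_mono_on hab ((hint a b).mul_const _) (hint2 a b)
        fun s hs => mul_le_mul_of_nonneg_left ?_ (h0 s)
      exact Real.exp_le_exp.2 (by linarith [(hcd s b hs.2).1])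
    set δ := c b - c a with hδ
    have eb : Real.exp (-c b) = Real.exp (-c a) * Real.exp (-δ) := by
      rw [← Real.exp_add]; congr 1; rw [hδ]; ring
    have ea : Real.exp (-c a) ≤ 1 := Real.exp_le_one_iff.2 (by linarith)
    have ea0 := Real.exp_pos (-c a)
    have x1 : 1 - δ ≤ Real.exp (-δ) := by linarith [Real.add_one_le_exp (-δ)]
    have x2 : Real.exp (-δ) * (1 + δ) ≤ 1 := by
      have := Real.add_one_le_exp δ
      calc Real.exp (-δ) * (1 + δ) ≤ Real.exp (-δ) * Real.exp δ := by gcongr; linarith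
        _ = 1 := by rw [← Real.exp_add]; simp
    have x3 : Real.exp (-δ) ≤ 1 := Real.exp_le_one_iff.2 (by linarith)
    have hsq : δ ^ 2 ≤ K ^ 2 * (b - a) ^ 2 := by
      rw [← mul_pow]; exact pow_le_pow_left₀ hd0 hd1 2
    -- By `x2` the left side is at most `δ (1 - e^{-δ})`, and `x1` bounds the bracket by `δ`.
    have x4 : Real.exp (-δ) - 1 + δ ≤ δ ^ 2 := by nlinarith
    refine le_trans ?_ hsq
    rw [e1, abs_le]
    constructor
    · rw [eb] at lo ⊢
      nlinarith [mul_nonneg ea0.le (sq_nonneg δ)]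
    · rw [eb]
      nlinarith [mul_nonneg ea0.le (sq_nonneg δ), sq_nonneg δ]
  -- Telescoping over `n + 1` equal pieces leaves a total error of order `1 / (n + 1)`.
  have hconst : H t = H 0 := by
    have hn : ∀ n : ℕ, |H t - H 0| ≤ K ^ 2 * t ^ 2 / (n + 1 : ℝ) := by
      intro n
      have htel : H t - H 0
          = ∑ i ∈ Finset.range (n + 1), (H ((i + 1 : ℕ) * (t / (n + 1))) - H (i * (t / (n + 1)))) := by
        rw [Finset.sum_range_sub (fun i : ℕ => H (i * (t / (n + 1))))]
        have : ((n + 1 : ℕ) : ℝ) * (t / (n + 1)) = t := by push_cast; field_simp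
        rw [this]; simp
      rw [htel]
      refine (Finset.abs_sum_le_sum_abs _ _).trans ?_
      calc _ ≤ ∑ i ∈ Finset.range (n + 1), K ^ 2 * (t / (n + 1)) ^ 2 := by
            refine Finset.sum_le_sum fun i _ => ?_
            refine (hle _ _ (by positivity) (by push_cast; gcongr; linarith)).trans (le_of_eq ?_)
            push_cast; ring
        _ = K ^ 2 * t ^ 2 / (n + 1 : ℝ) := by
            simp; field_simp
    have hlim : Tendsto (fun n : ℕ => K ^ 2 * t ^ 2 / (n + 1 : ℝ)) atTop (𝓝 0) := by
      have := (tendsto_one_div_add_atTop_nhds_zero_nat (𝕜 := ℝ)).const_mul (K ^ 2 * t ^ 2)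
      simpa [div_eq_mul_inv] using this
    have := ge_of_tendsto' hlim hn
    have := abs_nonpos_iff.1 this
    linarith
  have h00 : H 0 = 1 := by simp [hH, hc]
  have : H t = Real.exp (-c t) + ∫ s in (0 : ℝ)..t, g s * Real.exp (-c s) := rfl
  linarith

/-! ### The age at which a particle branches. -/

namespace BranchingModel

variable {E Ξ : Type*} [MeasurableSpace E] [MeasurableSpace Ξ] (M : BranchingModel E Ξ)

/-- The branching rate at the current position of a trajectory. -/
noncomputable def pathRate (t : ℝ≥0) (w : Ξ) : ℝ≥0 :=
  Sum.elim M.rate (fun _ => 0) (M.motion.path t w)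

@[fun_prop]
theorem measurable_pathRate : Measurable fun q : ℝ≥0 × Ξ => M.pathRate q.1 q.2 :=
  (M.measurable_rate.sumElim measurable_const).comp M.motion.measurable_path

/-- A bound for the branching rate. -/
noncomputable def rateBound : ℝ≥0 := M.bounded_rate.choose

theorem rate_le (y : E) : M.rate y ≤ M.rateBound := M.bounded_rate.choose_spec y

theorem pathRate_le (t : ℝ≥0) (w : Ξ) : M.pathRate t w ≤ M.rateBound := by
  unfold pathRate
  cases M.motion.path t w with
  | inl y => exact M.rate_le y
  | inr _ => exact zero_le

theorem clock_eq (w : Ξ) (s : ℝ≥0) :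
    M.clock w s = ∫⁻ r in Set.Icc (0 : ℝ) s, (M.pathRate r.toNNReal w : ℝ≥0∞) := rfl

@[fun_prop]
theorem measurable_clock : Measurable fun q : Ξ × ℝ≥0 => M.clock q.1 q.2 := by
  have h : ∀ q : Ξ × ℝ≥0, M.clock q.1 q.2
      = ∫⁻ r : ℝ, Set.indicator {p : (Ξ × ℝ≥0) × ℝ | 0 ≤ p.2 ∧ p.2 ≤ p.1.2}
          (fun p => (M.pathRate p.2.toNNReal p.1.1 : ℝ≥0∞)) (q, r) := by
    intro q
    rw [clock_eq, ← lintegral_indicator measurableSet_Icc]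
    rfl
  simp_rw [h]
  refine Measurable.lintegral_prod_right' (Measurable.indicator ?_ ?_)
  · exact (M.measurable_pathRate.comp
      (measurable_snd.real_toNNReal.prodMk measurable_fst.fst)).coe_nnreal_ennreal
  · exact (measurableSet_le measurable_const measurable_snd).inter
      (measurableSet_le measurable_snd (by fun_prop))

theorem clock_mono (w : Ξ) {s t : ℝ≥0} (h : s ≤ t) : M.clock w s ≤ M.clock w t :=
  lintegral_mono_set (Set.Icc_subset_Icc le_rfl (by exact_mod_cast h))

theorem clock_le_add (w : Ξ) {s t : ℝ≥0} (h : s ≤ t) :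
    M.clock w t ≤ M.clock w s + M.rateBound * (t - s : ℝ≥0) := by
  rw [clock_eq, clock_eq]
  have hu : Set.Icc (0 : ℝ) t = Set.Icc (0 : ℝ) s ∪ Set.Ioc (s : ℝ) t :=
    (Set.Icc_union_Ioc_eq_Icc s.2 (by exact_mod_cast h)).symm
  rw [hu]
  refine (lintegral_union_le _ _ _).trans ?_
  gcongr
  calc ∫⁻ r in Set.Ioc (s : ℝ) t, (M.pathRate r.toNNReal w : ℝ≥0∞)
      ≤ ∫⁻ _ in Set.Ioc (s : ℝ) t, (M.rateBound : ℝ≥0∞) := by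
        refine lintegral_mono fun r => ?_
        exact ENNReal.coe_le_coe.2 (M.pathRate_le _ w)
    _ = M.rateBound * (t - s : ℝ≥0) := by
        rw [setLIntegral_const, Real.volume_Ioc, ← NNReal.coe_sub h, ENNReal.ofReal_coe_nnreal]

theorem clock_lt_top (w : Ξ) (s : ℝ≥0) : M.clock w s < ∞ := by
  have h := M.clock_le_add w (zero_le (a := s))
  have h0 : M.clock w 0 = 0 := by simp [clock_eq]
  rw [h0, zero_add] at h
  exact h.trans_lt (ENNReal.mul_lt_top ENNReal.coe_lt_top ENNReal.coe_lt_top)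

/-- The accumulated rate is nondecreasing and Lipschitz in time, so the level `e` is already reached
at the infimum. This turns events about the age into events about the clock. -/
theorem branchAge_le_iff (w : Ξ) (e : ℝ) (t : ℝ≥0) :
    M.branchAge w e ≤ t ↔ ENNReal.ofReal e ≤ M.clock w t := by
  constructor
  · intro h
    refine ENNReal.le_of_forall_pos_le_add fun ε hε _ => ?_
    obtain ⟨δ, hδ, hδε⟩ : ∃ δ : ℝ≥0, 0 < δ ∧ M.rateBound * δ ≤ ε := by
      -- The `+ 1` keeps the denominator positive if the rate bound is zero.
      refine ⟨ε / (M.rateBound + 1), by positivity, ?_⟩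
      rw [mul_div_assoc', div_le_iff₀ (by positivity)]
      rw [mul_comm]; gcongr; simp
    have hlt : M.branchAge w e < ((t + δ : ℝ≥0) : ℝ≥0∞) :=
      h.trans_lt (by exact_mod_cast lt_add_of_pos_right t hδ)
    obtain ⟨T, ⟨s, rfl, hs⟩, hsT⟩ := sInf_lt_iff.1 hlt
    have hsT' : s ≤ t + δ := by exact_mod_cast hsT.le
    refine (hs.trans (M.clock_mono w hsT')).trans
      ((M.clock_le_add w (le_add_of_nonneg_right hδ.le)).trans ?_)
    gcongr
    rw [add_tsub_cancel_left]
    exact_mod_cast hδε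
  · intro h
    exact sInf_le ⟨t, rfl, h⟩

@[fun_prop]
theorem measurable_branchAge : Measurable fun q : Ξ × ℝ => M.branchAge q.1 q.2 := by
  refine measurable_of_Iic fun a => ?_
  induction a with
  | top => simp
  | coe t =>
    have : (fun q : Ξ × ℝ => M.branchAge q.1 q.2) ⁻¹' Set.Iic (t : ℝ≥0∞)
        = {q | ENNReal.ofReal q.2 ≤ M.clock q.1 t} := by
      ext q; exact M.branchAge_le_iff q.1 q.2 t
    rw [this]
    exact measurableSet_le (by fun_prop)
      (M.measurable_clock.comp (measurable_fst.prodMk measurable_const))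

/-- The probability that a particle with trajectory `w` has not branched by time `t`. -/
noncomputable def survival (w : Ξ) (t : ℝ≥0) : ℝ≥0∞ :=
  ENNReal.ofReal (Real.exp (-(M.clock w t).toReal))

@[fun_prop]
theorem measurable_survival : Measurable fun q : Ξ × ℝ≥0 => M.survival q.1 q.2 :=
  ((M.measurable_clock.ennreal_toReal.neg).exp).ennreal_ofReal

theorem survival_le_one (w : Ξ) (t : ℝ≥0) : M.survival w t ≤ 1 := by
  unfold survival
  rw [ENNReal.ofReal_le_one]
  exact Real.exp_le_one_iff.2 (by simp)

instance : IsProbabilityMeasure (expMeasure 1) := isProbabilityMeasure_expMeasure one_pos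

/-- The clock is finite, so branching by time `t` means that the exponential variable is at most the
clock; its distribution function does the rest. -/
theorem expMeasure_le_clock (w : Ξ) (t : ℝ≥0) :
    expMeasure 1 {e | M.branchAge w e ≤ t} = ENNReal.ofReal (1 - Real.exp (-(M.clock w t).toReal)) := by
  have h : {e | M.branchAge w e ≤ t} = Set.Iic (M.clock w t).toReal := by
    ext e
    rw [Set.mem_ofPred_eq, M.branchAge_le_iff, Set.mem_Iic,
      ENNReal.ofReal_le_iff_le_toReal (M.clock_lt_top w t).ne]
  rw [h, ← ofReal_cdf, cdf_expMeasure_eq one_pos, if_pos ENNReal.toReal_nonneg, one_mul]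

theorem lintegral_survive (w : Ξ) (t : ℝ≥0) :
    expMeasure 1 {e | (t : ℝ≥0∞) < M.branchAge w e} = M.survival w t := by
  have h : {e | (t : ℝ≥0∞) < M.branchAge w e} = {e | M.branchAge w e ≤ t}ᶜ := by
    ext e; simp
  have hm : Measurable fun e => M.branchAge w e := M.measurable_branchAge.comp measurable_prodMk_left
  have hs : MeasurableSet {e | M.branchAge w e ≤ t} := hm measurableSet_Iic
  rw [h, prob_compl_eq_one_sub hs, expMeasure_le_clock, survival]
  rw [← ENNReal.ofReal_one, ← ENNReal.ofReal_sub _ (by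
    rw [sub_nonneg]; exact Real.exp_le_one_iff.2 (by simp))]
  congr 1; ring

theorem toReal_clock (w : Ξ) (t : ℝ≥0) :
    (M.clock w t).toReal = ∫ s in (0 : ℝ)..t, (M.pathRate s.toNNReal w : ℝ) := by
  have hm : Measurable fun s : ℝ => (M.pathRate s.toNNReal w : ℝ) :=
    (M.measurable_pathRate.comp (measurable_real_toNNReal.prodMk measurable_const)).coe_nnreal_real
  rw [intervalIntegral.integral_of_le t.coe_nonneg, ← integral_Icc_eq_integral_Ioc,
    integral_eq_lintegral_of_nonneg_ae (Eventually.of_forall fun s => NNReal.coe_nonneg _)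
      hm.aestronglyMeasurable, clock_eq]
  simp

/-- The distribution function of the candidate density of the branching age, to be matched with
`expMeasure_le_clock`. -/
theorem lintegral_branchDensity (w : Ξ) (t : ℝ≥0) :
    ∫⁻ s in Set.Ioc (0 : ℝ) t, (M.pathRate s.toNNReal w : ℝ≥0∞) * M.survival w s.toNNReal
      = ENNReal.ofReal (1 - Real.exp (-(M.clock w t).toReal)) := by
  have hm : Measurable fun s : ℝ => (M.pathRate s.toNNReal w : ℝ) :=
    (M.measurable_pathRate.comp (measurable_real_toNNReal.prodMk measurable_const)).coe_nnreal_real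
  have key := one_sub_exp_neg_integral_eq (K := M.rateBound) hm (fun s => NNReal.coe_nonneg _)
    (fun s => by exact_mod_cast M.pathRate_le _ w) t.coe_nonneg
  have hsm : Measurable fun s : ℝ => Real.exp (-(M.clock w s.toNNReal).toReal) :=
    ((M.measurable_clock.comp
      (measurable_const.prodMk measurable_real_toNNReal)).ennreal_toReal.neg).exp
  rw [toReal_clock, ← key,
    intervalIntegral.integral_of_le t.coe_nonneg]
  have e : ∀ s ∈ Set.Ioc (0 : ℝ) t, (M.pathRate s.toNNReal w : ℝ) *
      Real.exp (-∫ r in (0 : ℝ)..s, (M.pathRate r.toNNReal w : ℝ))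
      = (M.pathRate s.toNNReal w : ℝ) * Real.exp (-(M.clock w s.toNNReal).toReal) := by
    intro s hs
    rw [toReal_clock, Real.coe_toNNReal _ hs.1.le]
  rw [setIntegral_congr_fun measurableSet_Ioc e, ofReal_integral_eq_lintegral_ofReal]
  · refine setLIntegral_congr_fun measurableSet_Ioc fun s _ => ?_
    rw [ENNReal.ofReal_mul (NNReal.coe_nonneg _), ENNReal.ofReal_coe_nnreal, survival]
  · refine Measure.integrableOn_of_bounded (M := M.rateBound) (by simp)
      (hm.mul hsm).aestronglyMeasurable (Eventually.of_forall fun s => ?_)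
    rw [norm_mul, Real.norm_of_nonneg (NNReal.coe_nonneg _), Real.norm_of_nonneg (Real.exp_pos _).le]
    calc (M.pathRate s.toNNReal w : ℝ) * Real.exp (-(M.clock w s.toNNReal).toReal)
        ≤ M.rateBound * 1 := by
          gcongr
          · exact_mod_cast M.pathRate_le _ w
          · exact Real.exp_le_one_iff.2 (by simp)
      _ = M.rateBound := mul_one _
  · exact Eventually.of_forall fun s => by positivity

/-- The age at which a particle branches has density `γ(ξ_s) e^{-∫₀ˢ γ(ξ_r) dr}`. -/
theorem lintegral_branchAge (w : Ξ) (t : ℝ≥0) {H : ℝ≥0 → ℝ≥0∞} (hH : Measurable H) :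
    ∫⁻ e in {e | M.branchAge w e ≤ t}, H (M.branchAge w e).toNNReal ∂(expMeasure 1)
      = ∫⁻ s in Set.Ioc (0 : ℝ) t,
          (M.pathRate s.toNNReal w : ℝ≥0∞) * M.survival w s.toNNReal * H s.toNNReal := by
  have hm : Measurable fun e => M.branchAge w e := M.measurable_branchAge.comp measurable_prodMk_left
  have hd : Measurable fun s : ℝ =>
      (M.pathRate s.toNNReal w : ℝ≥0∞) * M.survival w s.toNNReal :=
    ((M.measurable_pathRate.comp
      (measurable_real_toNNReal.prodMk measurable_const)).coe_nnreal_ennreal).mul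
      (M.measurable_survival.comp (f := fun s : ℝ => (w, s.toNNReal))
        (measurable_const.prodMk measurable_real_toNNReal))
  have hset : MeasurableSet {e | M.branchAge w e ≤ t} := hm measurableSet_Iic
  -- The two measures agree on all half-lines, by `expMeasure_le_clock` and
  -- `lintegral_branchDensity`. The age is finite on the event considered, so nothing is lost in
  -- passing to real values.
  have hmeas : ((expMeasure 1).restrict {e | M.branchAge w e ≤ t}).map
        (fun e => (M.branchAge w e).toReal)
      = (volume.restrict (Set.Ioc (0 : ℝ) t)).withDensity
        (fun s => (M.pathRate s.toNNReal w : ℝ≥0∞) * M.survival w s.toNNReal) := by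
    refine Measure.ext_of_Iic _ _ fun a => ?_
    rw [Measure.map_apply hm.ennreal_toReal measurableSet_Iic,
      Measure.restrict_apply (hm.ennreal_toReal measurableSet_Iic),
      withDensity_apply _ measurableSet_Iic, Measure.restrict_restrict measurableSet_Iic]
    rcases lt_or_ge a 0 with ha | ha
    · have h1 : (fun e => (M.branchAge w e).toReal) ⁻¹' Set.Iic a ∩ {e | M.branchAge w e ≤ t} = ∅ := by
        ext e
        simp only [Set.mem_inter_iff, Set.mem_preimage, Set.mem_Iic, Set.mem_empty_iff_false,
          iff_false, not_and]
        intro h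
        linarith [ENNReal.toReal_nonneg (a := M.branchAge w e)]
      have h2 : Set.Iic a ∩ Set.Ioc (0 : ℝ) t = ∅ := by
        ext s
        simp only [Set.mem_inter_iff, Set.mem_Iic, Set.mem_Ioc, Set.mem_empty_iff_false, iff_false]
        intro h; linarith [h.1, h.2.1]
      simp [h1, h2]
    · lift a to ℝ≥0 using ha
      have h1 : (fun e => (M.branchAge w e).toReal) ⁻¹' Set.Iic (a : ℝ) ∩ {e | M.branchAge w e ≤ t}
          = {e | M.branchAge w e ≤ (min a t : ℝ≥0)} := by
        ext e
        simp only [Set.mem_inter_iff, Set.mem_preimage, Set.mem_Iic, Set.mem_ofPred_eq]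
        constructor
        · rintro ⟨h, h'⟩
          obtain ⟨T, hT⟩ : ∃ T : ℝ≥0, (T : ℝ≥0∞) = M.branchAge w e :=
            ⟨_, ENNReal.coe_toNNReal (h'.trans_lt ENNReal.coe_lt_top).ne⟩
          rw [← hT] at h h' ⊢
          rw [ENNReal.coe_toReal, NNReal.coe_le_coe] at h
          exact ENNReal.coe_le_coe.2 (le_min h (ENNReal.coe_le_coe.1 h'))
        · intro h
          obtain ⟨T, hT⟩ : ∃ T : ℝ≥0, (T : ℝ≥0∞) = M.branchAge w e :=
            ⟨_, ENNReal.coe_toNNReal (h.trans_lt ENNReal.coe_lt_top).ne⟩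
          rw [← hT] at h ⊢
          rw [ENNReal.coe_toReal, NNReal.coe_le_coe, ENNReal.coe_le_coe]
          exact le_min_iff.1 (ENNReal.coe_le_coe.1 h)
      have h2 : Set.Iic (a : ℝ) ∩ Set.Ioc (0 : ℝ) t = Set.Ioc (0 : ℝ) (min a t : ℝ≥0) := by
        ext s
        simp only [Set.mem_inter_iff, Set.mem_Iic, Set.mem_Ioc, NNReal.coe_min, le_min_iff]
        tauto
      rw [h1, h2, expMeasure_le_clock, lintegral_branchDensity]
  have hH' : Measurable fun s : ℝ => H s.toNNReal := hH.comp measurable_real_toNNReal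
  calc _ = ∫⁻ s, H s.toNNReal ∂(((expMeasure 1).restrict {e | M.branchAge w e ≤ t}).map
        (fun e => (M.branchAge w e).toReal)) := by
        rw [lintegral_map hH' hm.ennreal_toReal]
        simp only [ENNReal.toReal, Real.toNNReal_coe]
    _ = _ := by
        rw [hmeas, lintegral_withDensity_eq_lintegral_mul _ hd hH']
        simp only [Pi.mul_apply]

end BranchingModel

/-! ### Finite configurations and independent families. -/

section Config

variable {α β γ : Type*} [MeasurableSpace α] [MeasurableSpace β] [MeasurableSpace γ]

/-- A family of `n` points as a configuration. -/
abbrev configMk {β : Type*} (n : ℕ) (v : Fin n → β) : Config β := ⟨n, v⟩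

theorem configMk_injective {β : Type*} (n : ℕ) : Function.Injective (configMk (β := β) n) :=
  fun _ _ h => eq_of_heq (Sigma.mk.inj h).2

theorem measurableSet_config_iff {s : Set (Config β)} :
    MeasurableSet s ↔ ∀ n, MeasurableSet ((configMk (β := β) n) ⁻¹' s) := by
  rw [Sigma.instMeasurableSpace, MeasurableSpace.measurableSet_iInf]
  rfl

theorem measurable_configMk (n : ℕ) : Measurable (configMk (β := β) n) :=
  fun _ hs => measurableSet_config_iff.1 hs n

theorem measurableSet_config_image {n : ℕ} {u : Set (Fin n → β)} (hu : MeasurableSet u) :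
    MeasurableSet ((configMk (β := β) n) '' u) := by
  rw [measurableSet_config_iff]
  intro m
  by_cases h : n = m
  · subst h
    rwa [Set.preimage_image_eq _ (configMk_injective _)]
  · convert MeasurableSet.empty
    ext v
    simp only [Set.mem_preimage, Set.mem_image, Set.mem_empty_iff_false, iff_false, not_exists,
      not_and]
    intro v' _ h'
    exact h (congrArg Sigma.fst h')

theorem measurableEmbedding_configMk (n : ℕ) :
    MeasurableEmbedding (configMk (β := β) n) :=
  ⟨(configMk_injective _), measurable_configMk n, fun {_} hu => measurableSet_config_image hu⟩

theorem measurable_config_iff {f : Config β → γ} :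
    Measurable f ↔ ∀ n, Measurable fun v : Fin n → β => f ⟨n, v⟩ :=
  ⟨fun h n => h.comp (measurable_configMk n),
    fun h _ hs => measurableSet_config_iff.2 fun n => h n hs⟩

@[fun_prop]
theorem measurable_config_fst : Measurable fun o : Config β => o.1 :=
  measurable_config_iff.2 fun _ => measurable_const

/-- The product with a disjoint union is the countable union of its slices, each of them measurably
embedded, so measurability may be checked for a fixed number of points. -/
theorem measurable_prod_config {f : α × Config β → γ}
    (h : ∀ n, Measurable fun q : α × (Fin n → β) => f (q.1, ⟨n, q.2⟩)) : Measurable f := by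
  intro s hs
  have e : f ⁻¹' s = ⋃ n, Prod.map id (configMk (β := β) n) ''
      ((fun q : α × (Fin n → β) => f (q.1, ⟨n, q.2⟩)) ⁻¹' s) := by
    ext ⟨a, n, v⟩
    simp only [Set.mem_preimage, Set.mem_iUnion, Set.mem_image, Prod.exists, Prod.map_apply, id]
    constructor
    · intro h'
      exact ⟨n, a, v, h', rfl⟩
    · rintro ⟨m, a', v', h', e'⟩
      rwa [e'] at h'
  rw [e]
  exact MeasurableSet.iUnion fun n =>
    (MeasurableEmbedding.id.prodMap (measurableEmbedding_configMk n)).measurableSet_image.2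
      (h n hs)

/-- The boxes that generate the measurable sets of configurations. -/
def configBoxes (β : Type*) [MeasurableSpace β] : Set (Set (Config β)) :=
  {s | ∃ (n : ℕ) (t : Fin n → Set β), (∀ i, MeasurableSet (t i)) ∧ s = configMk n '' Set.univ.pi t}

theorem isPiSystem_configBoxes : IsPiSystem (configBoxes β) := by
  rintro _ ⟨n, t, ht, rfl⟩ _ ⟨m, t', ht', rfl⟩ ⟨_, ⟨v, -, rfl⟩, ⟨v', -, h⟩⟩
  obtain rfl : m = n := congrArg Sigma.fst h
  refine ⟨m, fun i => t i ∩ t' i, fun i => (ht i).inter (ht' i), ?_⟩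
  rw [← Set.image_inter (configMk_injective _), Set.pi_inter_distrib]

/-- Within one slice the boxes generate the product σ-algebra, and a measurable set is the countable
union of its slices. -/
theorem generateFrom_configBoxes :
    MeasurableSpace.generateFrom (configBoxes β) = Sigma.instMeasurableSpace := by
  apply le_antisymm
  · refine MeasurableSpace.generateFrom_le ?_
    rintro _ ⟨n, t, ht, rfl⟩
    exact measurableSet_config_image (MeasurableSet.univ_pi ht)
  · intro s hs
    have key : ∀ n (u : Set (Fin n → β)), MeasurableSet u →
        MeasurableSet[MeasurableSpace.generateFrom (configBoxes β)]
          ((configMk (β := β) n) '' u) := by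
      intro n u hu
      rw [← generateFrom_pi] at hu
      induction u, hu using MeasurableSpace.generateFrom_induction with
      | hC u hu =>
        obtain ⟨t, ht, rfl⟩ := hu
        exact MeasurableSpace.measurableSet_generateFrom ⟨n, t, fun i => ht i trivial, rfl⟩
      | empty => simp
      | compl u _ ih =>
        -- The complement is relative to the slice, and the full slice is itself a box.
        rw [Set.image_compl_eq_range_sdiff_image (configMk_injective _)]
        refine MeasurableSet.diff ?_ ih
        rw [← Set.image_univ, ← Set.pi_univ Set.univ]
        exact MeasurableSpace.measurableSet_generateFrom
          ⟨n, fun _ => Set.univ, fun _ => MeasurableSet.univ, by simp⟩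
      | iUnion f _ ih =>
        rw [Set.image_iUnion]
        exact MeasurableSet.iUnion ih
    have e : s = ⋃ n, configMk n '' ((configMk (β := β) n) ⁻¹' s) := by
      ext ⟨n, v⟩
      simp only [Set.mem_iUnion, Set.mem_image, Set.mem_preimage]
      exact ⟨fun h => ⟨n, v, h, rfl⟩, by rintro ⟨m, v', h, e⟩; rwa [e] at h⟩
    rw [e]
    exact MeasurableSet.iUnion fun n => key n _ (measurableSet_config_iff.1 hs n)

/-- A π-system argument reducing equality of laws to functionals of product form, the only ones that
the branching property in `IsTreeLaw` provides. -/
theorem ext_of_configBoxes {μ ν : Measure (α × Config β)} [IsFiniteMeasure μ]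
    (huniv : μ Set.univ = ν Set.univ)
    (h : ∀ S, MeasurableSet S → ∀ (n : ℕ) (t : Fin n → Set β), (∀ i, MeasurableSet (t i)) →
      μ (S ×ˢ (configMk n '' Set.univ.pi t)) = ν (S ×ˢ (configMk n '' Set.univ.pi t))) :
    μ = ν := by
  refine ext_of_generate_finite
    (Set.image2 (fun (s : Set α) (t : Set (Config β)) => s ×ˢ t) {s | MeasurableSet s} (configBoxes β)) ?_
    (MeasurableSpace.isPiSystem_measurableSet.prod isPiSystem_configBoxes) ?_ huniv
  · symm
    have hsp : IsCountablySpanning (configBoxes β) := by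
      refine ⟨fun n => configMk n '' Set.univ.pi fun _ => Set.univ,
        fun n => ⟨n, _, fun _ => MeasurableSet.univ, rfl⟩, ?_⟩
      ext ⟨n, v⟩
      simp
    have := generateFrom_eq_prod (MeasurableSpace.generateFrom_measurableSet (α := α))
      (generateFrom_configBoxes (β := β)) isCountablySpanning_measurableSet hsp
    exact this
  · rintro _ ⟨S, hS, _, ⟨n, t, ht, rfl⟩, rfl⟩
    exact h S hS n t ht

/-- The law of independent random variables with laws `κ x_1, …, κ x_N`, where `(x_1, …, x_N)` is
the given configuration. -/
noncomputable def childKernel (κ : Kernel α β) [IsMarkovKernel κ] :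
    Kernel (Config α) (Config β) where
  toFun o := (Measure.pi fun i => κ (o.2 i)).map (configMk o.1)
  measurable' := by
    refine measurable_config_iff.2 fun n => ?_
    refine (Measure.measurable_map _ (measurable_configMk n)).comp ?_
    refine Measurable.measure_of_isPiSystem_of_isProbabilityMeasure generateFrom_pi.symm
      isPiSystem_pi ?_
    rintro _ ⟨t, ht, rfl⟩
    simp only [Measure.pi_pi]
    refine Finset.measurable_prod Finset.univ (f := fun i (v : Fin n → α) => κ (v i) (t i))
      fun i _ => ?_
    exact (κ.measurable_coe (ht i trivial)).comp (measurable_pi_apply i)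

instance (κ : Kernel α β) [IsMarkovKernel κ] : IsMarkovKernel (childKernel κ) :=
  ⟨fun o => Measure.isProbabilityMeasure_map (measurable_configMk o.1).aemeasurable⟩

theorem lintegral_childKernel (κ : Kernel α β) [IsMarkovKernel κ] (o : Config α)
    {f : Config β → ℝ≥0∞} (hf : Measurable f) :
    ∫⁻ c, f c ∂(childKernel κ o) = ∫⁻ v, f ⟨o.1, v⟩ ∂(Measure.pi fun i => κ (o.2 i)) :=
  lintegral_map hf (measurable_configMk o.1)

theorem lintegral_pi_prod {n : ℕ} (μ : Fin n → Measure β) [∀ i, IsProbabilityMeasure (μ i)]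
    (h : Fin n → β → ℝ≥0∞) (hh : ∀ i, Measurable (h i)) :
    ∫⁻ v, ∏ i, h i (v i) ∂(Measure.pi μ) = ∏ i, ∫⁻ y, h i y ∂(μ i) := by
  rw [lintegral_prod_eq_prod_lintegral_of_indepFun _ _
    (iIndepFun_pi fun i => (hh i).aemeasurable) fun i => (hh i).comp (measurable_pi_apply i)]
  refine Finset.prod_congr rfl fun i _ => ?_
  rw [← (measurePreserving_eval μ i).lintegral_comp (hh i)]

end Config

/-- The subtrees rooted at the children of the root. -/
def children {E Ξ : Type*} (τ : Tree E Ξ) : Config (Tree E Ξ) :=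
  ⟨(τ []).2.2.1, fun i => subtree i τ⟩

section Tree

variable {E Ξ : Type*} [MeasurableSpace E] [MeasurableSpace Ξ]

@[fun_prop]
theorem measurable_subtree (i : ℕ) : Measurable (subtree i : Tree E Ξ → Tree E Ξ) :=
  measurable_pi_lambda _ fun u => measurable_pi_apply (i :: u)

theorem measurable_root : Measurable fun τ : Tree E Ξ => τ [] := measurable_pi_apply _

theorem measurable_root_card : Measurable fun τ : Tree E Ξ => (τ []).2.2.1 :=
  measurable_config_fst.comp (measurable_root.snd.snd)

theorem measurable_children : Measurable (children : Tree E Ξ → Config (Tree E Ξ)) := by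
  intro s hs
  have e : children ⁻¹' s = ⋃ n : ℕ, {τ : Tree E Ξ | (τ []).2.2.1 = n} ∩
      {τ | (fun i : Fin n => subtree i τ) ∈ (configMk n) ⁻¹' s} := by
    ext τ
    simp only [Set.mem_preimage, Set.mem_iUnion, Set.mem_inter_iff, Set.mem_ofPred_eq]
    constructor
    · intro h; exact ⟨_, rfl, h⟩
    · rintro ⟨n, rfl, h⟩; exact h
  rw [e]
  refine MeasurableSet.iUnion fun n => (measurable_root_card (measurableSet_singleton n)).inter ?_
  exact (measurable_pi_lambda _ fun i : Fin n => measurable_subtree (E := E) (Ξ := Ξ) i)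
    (measurableSet_config_iff.1 hs n)

end Tree

/-! ### The tree law decomposed at the root. -/

namespace BranchingModel

variable {E Ξ : Type*} [MeasurableSpace E] [MeasurableSpace Ξ] (M : BranchingModel E Ξ)

instance : IsMarkovKernel M.motion.law := M.motion.isMarkovKernel
instance : IsMarkovKernel M.offspring := M.isMarkovKernel

/-- The empty family. -/
def noOffspring (E : Type*) : Config E := ⟨0, Fin.elim0⟩

/-- The offspring law at a position, extended by the empty family at the cemetery. -/
noncomputable def offspringExt (z : WithCemetery E) : Measure (Config E) :=
  Sum.elim (fun y => M.offspring y) (fun _ => Measure.dirac (noOffspring E)) z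

theorem measurable_offspringExt : Measurable M.offspringExt :=
  M.offspring.measurable.sumElim measurable_const

theorem offspringAt_eq (w : Ξ) (e : ℝ) : M.offspringAt w e =
    if M.branchAge w e = ∞ then Measure.dirac (noOffspring E)
    else M.offspringExt (M.motion.path (M.branchAge w e).toNNReal w) := by
  unfold offspringAt offspringExt
  split_ifs
  · rfl
  · cases M.motion.path (M.branchAge w e).toNNReal w <;> rfl

/-- `offspringAt` as a kernel. -/
noncomputable def offspringKernel : Kernel (Ξ × ℝ) (Config E) where
  toFun q := M.offspringAt q.1 q.2
  measurable' := by
    simp_rw [offspringAt_eq]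
    refine Measurable.ite (M.measurable_branchAge (measurableSet_singleton _)) measurable_const ?_
    refine M.measurable_offspringExt.comp ?_
    exact M.motion.measurable_path.comp (M.measurable_branchAge.ennreal_toNNReal.prodMk measurable_fst)

instance : IsMarkovKernel M.offspringKernel := by
  refine ⟨fun q => ?_⟩
  change IsProbabilityMeasure (M.offspringAt q.1 q.2)
  rw [offspringAt_eq]
  split_ifs
  · infer_instance
  · unfold offspringExt
    cases M.motion.path (M.branchAge q.1 q.2).toNNReal q.1 with
    | inl y => exact M.isMarkovKernel.isProbabilityMeasure y
    | inr _ => exact inferInstanceAs (IsProbabilityMeasure (Measure.dirac _))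

/-- The law of the mark of a particle born at `x`. -/
noncomputable def rootLaw (x : E) : Measure (Mark E Ξ) :=
  (((M.motion.law (Sum.inl x)).prod (expMeasure 1)) ⊗ₘ M.offspringKernel).map
    fun q => (q.1.1, q.1.2, q.2)

theorem measurable_markAssoc :
    Measurable fun q : (Ξ × ℝ) × Config E => (q.1.1, q.1.2, q.2) := by fun_prop

instance (x : E) : IsProbabilityMeasure (M.rootLaw x) :=
  Measure.isProbabilityMeasure_map measurable_markAssoc.aemeasurable

theorem lintegral_rootLaw (x : E) {g : Mark E Ξ → ℝ≥0∞} (hg : Measurable g) :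
    ∫⁻ a, g a ∂(M.rootLaw x) = ∫⁻ w, ∫⁻ e, ∫⁻ o, g (w, e, o)
      ∂(M.offspringAt w e) ∂(expMeasure 1) ∂(M.motion.law (Sum.inl x)) := by
  have hg' : Measurable fun q : (Ξ × ℝ) × Config E => g (q.1.1, q.1.2, q.2) :=
    hg.comp measurable_markAssoc
  rw [rootLaw, lintegral_map hg measurable_markAssoc, Measure.lintegral_compProd hg',
    lintegral_prod _ (hg'.lintegral_kernel_prod_right' (κ := M.offspringKernel)).aemeasurable]
  rfl

variable {M} {Q : Kernel E (Tree E Ξ)}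

/-- Given the mark of the root, the subtrees are independent trees issued from the offspring. -/
theorem IsTreeLaw.map_root_children [IsMarkovKernel Q] (hQ : M.IsTreeLaw Q) (x : E) :
    (Q x).map (fun τ => (τ [], children τ))
      = M.rootLaw x ⊗ₘ ((childKernel Q).comap (fun a : Mark E Ξ => a.2.2) (by fun_prop)) := by
  have hmeas : Measurable fun τ : Tree E Ξ => (τ [], children τ) :=
    measurable_root.prodMk measurable_children
  have := Measure.isProbabilityMeasure_map (μ := Q x) hmeas.aemeasurable
  refine ext_of_configBoxes (by simp) fun S hS n t ht => ?_
  have hbox : MeasurableSet (configMk n '' Set.univ.pi t) :=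
    measurableSet_config_image (MeasurableSet.univ_pi ht)
  rw [Measure.map_apply hmeas (hS.prod hbox), Measure.compProd_apply_prod hS hbox,
    ← lintegral_indicator hS]
  -- The branching identity is tested with indicators: `g` restricts the mark and fixes the number
  -- of children, and `h i` restricts the `i`-th subtree.
  set g : Mark E Ξ → ℝ≥0∞ := (S ∩ {a | a.2.2.1 = n}).indicator 1 with hg
  have hgm : Measurable g := measurable_one.indicator
    (hS.inter ((measurable_config_fst.comp measurable_snd.snd) (measurableSet_singleton n)))
  set h : ℕ → Tree E Ξ → ℝ≥0∞ := fun i => if hi : i < n then (t ⟨i, hi⟩).indicator 1 else 1 with hh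
  have hhm : ∀ i, Measurable (h i) := by
    intro i
    simp only [hh]
    split_ifs with hi
    · exact measurable_one.indicator (ht _)
    · exact measurable_one
  have hhi : ∀ i : Fin n, h i = (t i).indicator 1 := fun i => by simp [hh]
  have key := hQ.branching x g h hgm hhm
  have e1 : (Q x) ((fun τ => (τ [], children τ)) ⁻¹' S ×ˢ (configMk n '' Set.univ.pi t))
      = ∫⁻ τ, g (τ []) * ∏ i ∈ Finset.range (τ []).2.2.1, h i (subtree i τ) ∂(Q x) := by
    rw [← lintegral_indicator_one (hmeas (hS.prod hbox))]
    refine lintegral_congr fun τ => ?_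
    by_cases hS' : τ [] ∈ S
    · by_cases hn : (τ []).2.2.1 = n
      · rw [hn, Finset.prod_range]
        simp only [hhi]
        have hgg : g (τ []) = 1 := by simp [hg, hS', hn]
        rw [hgg, one_mul]
        have hc : children τ = ⟨n, fun i => subtree i τ⟩ := by subst hn; rfl
        by_cases hall : ∀ i : Fin n, subtree i τ ∈ t i
        · rw [Set.indicator_of_mem]
          · symm
            simp only [Pi.one_apply]
            exact Finset.prod_eq_one fun i _ => by simp [hall i]
          · exact ⟨hS', _, fun i _ => hall i, hc.symm⟩
        · rw [Set.indicator_of_notMem]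
          · symm
            push Not at hall
            obtain ⟨i, hi⟩ := hall
            exact Finset.prod_eq_zero (Finset.mem_univ i) (by simp [hi])
          · rintro ⟨-, v, hv, hv'⟩
            obtain rfl := configMk_injective n ((show configMk n v = children τ from hv').trans hc)
            exact hall fun i => hv i trivial
      · have hgg : g (τ []) = 0 := by simp [hg, hn]
        rw [hgg, zero_mul, Set.indicator_of_notMem]
        rintro ⟨-, v, hv, hv'⟩
        exact hn (congrArg Sigma.fst hv').symm
    · have hgg : g (τ []) = 0 := by simp [hg, hS']
      rw [hgg, zero_mul, Set.indicator_of_notMem]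
      exact fun h' => hS' h'.1
  have e2 : ∀ a : Mark E Ξ, S.indicator (fun a => (childKernel Q).comap
      (fun a : Mark E Ξ => a.2.2) (by fun_prop) a (configMk n '' Set.univ.pi t)) a
      = g a * ∏ i : Fin a.2.2.1, ∫⁻ τ, h i τ ∂(Q (a.2.2.2 i)) := by
    rintro ⟨w, e, m, o⟩
    by_cases hS' : (⟨w, e, m, o⟩ : Mark E Ξ) ∈ S
    · rw [Set.indicator_of_mem hS', Kernel.comap_apply]
      change (Measure.pi fun i => Q (o i)).map (configMk m) _ = _
      rw [Measure.map_apply (measurable_configMk m) hbox]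
      by_cases hn : m = n
      · subst hn
        rw [Set.preimage_image_eq _ (configMk_injective _), Measure.pi_pi]
        have hgg : g (w, e, ⟨m, o⟩) = 1 := by simp [hg, hS']
        rw [hgg, one_mul]
        refine Finset.prod_congr rfl fun i _ => ?_
        rw [hhi, lintegral_indicator_one (ht i)]
      · have hgg : g (w, e, ⟨m, o⟩) = 0 := by simp [hg, hn]
        rw [hgg, zero_mul]
        convert measure_empty (μ := Measure.pi fun i => Q (o i))
        ext v
        simp only [Set.mem_preimage, Set.mem_image, Set.mem_empty_iff_false, iff_false, not_exists,
          not_and]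
        intro v' _ h'
        exact hn (congrArg Sigma.fst h').symm
    · have hgg : g (w, e, ⟨m, o⟩) = 0 := by simp [hg, hS']
      rw [hgg, zero_mul, Set.indicator_of_notMem hS']
  rw [e1, key, lintegral_rootLaw]
  · simp_rw [e2]
  · exact (Kernel.measurable_coe _ hbox).indicator hS

theorem IsTreeLaw.lintegral_root_children [IsMarkovKernel Q] (hQ : M.IsTreeLaw Q) (x : E)
    {H : Mark E Ξ × Config (Tree E Ξ) → ℝ≥0∞} (hH : Measurable H) :
    ∫⁻ τ, H (τ [], children τ) ∂(Q x) = ∫⁻ w, ∫⁻ e, ∫⁻ o, ∫⁻ c, H ((w, e, o), c)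
      ∂(childKernel Q o) ∂(M.offspringAt w e) ∂(expMeasure 1) ∂(M.motion.law (Sum.inl x)) := by
  rw [← lintegral_map (μ := Q x) hH (measurable_root.prodMk measurable_children),
    hQ.map_root_children, Measure.lintegral_compProd hH, lintegral_rootLaw]
  · rfl
  · exact hH.lintegral_kernel_prod_right'

variable (M)

/-- The semigroup of the motion killed at rate `γ`. -/
noncomputable def killed (t : ℝ≥0) (F : E → ℝ≥0∞) (x : E) : ℝ≥0∞ :=
  ∫⁻ w, M.survival w t * Sum.elim F (fun _ => 0) (M.motion.path t w) ∂(M.motion.law (Sum.inl x))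

/-- `γ(y)` times the expected value of a functional of the offspring at `y`. -/
noncomputable def rateOffspring (R : Config E → ℝ≥0∞) (y : E) : ℝ≥0∞ :=
  M.rate y * ∫⁻ o, R o ∂(M.offspring y)

variable {M}

/-- Decomposition at the first branching time. -/
theorem IsTreeLaw.lintegral_first_branching [IsMarkovKernel Q] (hQ : M.IsTreeLaw Q) (x : E)
    (t : ℝ≥0) {F : E → ℝ≥0∞} (hF : Measurable F) {R : ℝ≥0 × Config (Tree E Ξ) → ℝ≥0∞}
    (hR : Measurable R) :
    ∫⁻ τ, (if (t : ℝ≥0∞) < M.branchAge (τ []).1 (τ []).2.1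
        then Sum.elim F (fun _ => 0) (M.motion.path t (τ []).1)
        else R (t - (M.branchAge (τ []).1 (τ []).2.1).toNNReal, children τ)) ∂(Q x)
      = M.killed t F x + ∫⁻ s in Set.Ioc (0 : ℝ) t,
          M.killed s.toNNReal (M.rateOffspring fun o =>
            ∫⁻ c, R (t - s.toNNReal, c) ∂(childKernel Q o)) x := by
  have hFe : Measurable (Sum.elim F (fun _ => 0) : WithCemetery E → ℝ≥0∞) :=
    hF.sumElim measurable_const
  have hA : Measurable fun q : Mark E Ξ × Config (Tree E Ξ) => M.branchAge q.1.1 q.1.2.1 :=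
    M.measurable_branchAge.comp (f := fun q : Mark E Ξ × Config (Tree E Ξ) => (q.1.1, q.1.2.1))
      (by fun_prop)
  have hp : Measurable (M.motion.path t) :=
    M.motion.measurable_path.comp (measurable_const.prodMk measurable_id)
  set H : Mark E Ξ × Config (Tree E Ξ) → ℝ≥0∞ := fun q =>
    if (t : ℝ≥0∞) < M.branchAge q.1.1 q.1.2.1
        then Sum.elim F (fun _ => 0) (M.motion.path t q.1.1)
        else R (t - (M.branchAge q.1.1 q.1.2.1).toNNReal, q.2) with hHdef
  have hH : Measurable H := by
    refine Measurable.ite (measurableSet_lt measurable_const hA) ?_ ?_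
    · exact hFe.comp (hp.comp measurable_fst.fst)
    · exact hR.comp ((measurable_const.sub hA.ennreal_toNNReal).prodMk measurable_snd)
  have hR1 : Measurable fun q : ℝ≥0 × Config E => ∫⁻ c, R (t - q.1, c) ∂(childKernel Q q.2) := by
    have : Measurable fun p : (ℝ≥0 × Config E) × Config (Tree E Ξ) => R (t - p.1.1, p.2) :=
      hR.comp ((measurable_const.sub measurable_fst.fst).prodMk measurable_snd)
    exact this.lintegral_kernel_prod_right' (κ := (childKernel Q).comap Prod.snd measurable_snd)
  -- The mean contribution after branching at age `s` in position `z`. The value at the cemetery is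
  -- irrelevant, since the rate vanishes there.
  set K : ℝ≥0 → WithCemetery E → ℝ≥0∞ := fun s z =>
    ∫⁻ o, ∫⁻ c, R (t - s, c) ∂(childKernel Q o) ∂(M.offspringExt z) with hK
  have hKm : Measurable fun q : ℝ≥0 × WithCemetery E => K q.1 q.2 := by
    let κ : Kernel (WithCemetery E) (Config E) := ⟨M.offspringExt, M.measurable_offspringExt⟩
    have : IsMarkovKernel κ := ⟨fun z => by
      cases z with
      | inl y => exact M.isMarkovKernel.isProbabilityMeasure y
      | inr _ => exact inferInstanceAs (IsProbabilityMeasure (Measure.dirac _))⟩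
    have h2 : Measurable fun p : (ℝ≥0 × WithCemetery E) × Config E =>
        ∫⁻ c, R (t - p.1.1, c) ∂(childKernel Q p.2) :=
      hR1.comp (measurable_fst.fst.prodMk measurable_snd)
    exact h2.lintegral_kernel_prod_right' (κ := κ.comap Prod.snd measurable_snd)
  have hKpath : Measurable fun q : ℝ≥0 × Ξ => K q.1 (M.motion.path q.1 q.2) :=
    hKm.comp (measurable_fst.prodMk M.motion.measurable_path)
  -- For a fixed trajectory the exponential clock is integrated out: either there is no branching by
  -- time `t`, or it occurs at age `s` with the density from `lintegral_branchAge`.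
  have inner : ∀ w : Ξ, ∫⁻ e, ∫⁻ o, ∫⁻ c, H ((w, e, o), c)
      ∂(childKernel Q o) ∂(M.offspringAt w e) ∂(expMeasure 1)
      = M.survival w t * Sum.elim F (fun _ => 0) (M.motion.path t w)
        + ∫⁻ s in Set.Ioc (0 : ℝ) t, (M.pathRate s.toNNReal w : ℝ≥0∞) * M.survival w s.toNNReal
            * K s.toNNReal (M.motion.path s.toNNReal w) := by
    intro w
    have hm : Measurable fun e => M.branchAge w e :=
      M.measurable_branchAge.comp (f := fun e : ℝ => (w, e)) measurable_prodMk_left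
    have hset : MeasurableSet {e | M.branchAge w e ≤ t} := hm measurableSet_Iic
    have hcompl : {e | M.branchAge w e ≤ t}ᶜ = {e | (t : ℝ≥0∞) < M.branchAge w e} := by
      ext e; simp
    rw [← lintegral_add_compl _ hset, add_comm]
    congr 1
    · rw [hcompl, setLIntegral_congr_fun (g := fun _ => Sum.elim F (fun _ => 0) (M.motion.path t w))
        (hcompl ▸ hset.compl)]
      · rw [setLIntegral_const, lintegral_survive, mul_comm]
      · intro e he
        have he' : (t : ℝ≥0∞) < M.branchAge w e := he
        have : IsProbabilityMeasure (M.offspringAt w e) :=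
          inferInstanceAs (IsProbabilityMeasure (M.offspringKernel (w, e)))
        simp [hHdef, he']
    · rw [← lintegral_branchAge M w t (H := fun s => K s (M.motion.path s w))
        (hKpath.comp (f := fun s : ℝ≥0 => (s, w)) measurable_prodMk_right)]
      refine setLIntegral_congr_fun hset fun e he => ?_
      have he' : M.branchAge w e ≤ t := he
      have hne : M.branchAge w e ≠ ∞ := (he'.trans_lt ENNReal.coe_lt_top).ne
      simp only [hHdef, not_lt.2 he', if_false, hK]
      rw [offspringAt_eq, if_neg hne]
  rw [show (∫⁻ τ, (if (t : ℝ≥0∞) < M.branchAge (τ []).1 (τ []).2.1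
        then Sum.elim F (fun _ => 0) (M.motion.path t (τ []).1)
        else R (t - (M.branchAge (τ []).1 (τ []).2.1).toNNReal, children τ)) ∂(Q x))
      = ∫⁻ τ, H (τ [], children τ) ∂(Q x) from rfl, hQ.lintegral_root_children x hH]
  simp_rw [inner]
  have hsm : Measurable fun w => M.survival w t :=
    M.measurable_survival.comp (f := fun w : Ξ => (w, t)) measurable_prodMk_right
  have hl : Measurable fun w => M.survival w t * Sum.elim F (fun _ => 0) (M.motion.path t w) :=
    hsm.mul (hFe.comp hp)
  rw [lintegral_add_left hl]
  congr 1
  have hrate : ∀ (s : ℝ≥0) (z : WithCemetery E),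
      ((Sum.elim M.rate (fun _ => 0) z : ℝ≥0) : ℝ≥0∞) * K s z
        = Sum.elim (M.rateOffspring fun o => ∫⁻ c, R (t - s, c) ∂(childKernel Q o))
          (fun _ => 0) z := by
    rintro s (y | _)
    · rfl
    · exact zero_mul _
  rw [lintegral_lintegral_swap]
  · refine lintegral_congr fun s => ?_
    rw [killed]
    refine lintegral_congr fun w => ?_
    rw [mul_comm (M.pathRate s.toNNReal w : ℝ≥0∞), mul_assoc]
    congr 1
    exact hrate s.toNNReal (M.motion.path s.toNNReal w)
  · refine Measurable.aemeasurable ?_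
    have hsw : Measurable fun q : Ξ × ℝ => (q.2.toNNReal, q.1) := by fun_prop
    have h1 : Measurable fun q : Ξ × ℝ => (M.pathRate q.2.toNNReal q.1 : ℝ≥0∞) :=
      (M.measurable_pathRate.comp hsw).coe_nnreal_ennreal
    have h2 : Measurable fun q : Ξ × ℝ => M.survival q.1 q.2.toNNReal :=
      M.measurable_survival.comp (f := fun q : Ξ × ℝ => (q.1, q.2.toNNReal)) (by fun_prop)
    exact (h1.mul h2).mul (hKpath.comp hsw)

end BranchingModel

/-! ### The population, truncated by generation. -/

theorem tsum_list_eq_add {α : Type*} (g : List α → ℝ≥0∞) :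
    ∑' u, g u = g [] + ∑' i, ∑' u, g (i :: u) := by
  let e : Unit ⊕ (α × List α) ≃ List α :=
    { toFun := Sum.elim (fun _ => []) fun q => q.1 :: q.2
      invFun := fun u => match u with
        | [] => Sum.inl ()
        | i :: u => Sum.inr (i, u)
      left_inv := by rintro (_ | ⟨i, u⟩) <;> rfl
      right_inv := by rintro (_ | ⟨i, u⟩) <;> rfl }
  rw [← e.tsum_eq, ← ENNReal.tsum_prod, Summable.tsum_sum ENNReal.summable ENNReal.summable]
  congr 1
  exact tsum_fintype (L := .unconditional _) _ |>.trans (by simp [e])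

/-- The unit mass at a point of `E`, and no mass for the cemetery. -/
noncomputable def aliveKernel (E : Type*) [MeasurableSpace E] : Kernel (WithCemetery E) E where
  toFun := Sum.elim (fun y => Measure.dirac y) fun _ => 0
  measurable' := Measure.measurable_dirac.sumElim measurable_const

instance (E : Type*) [MeasurableSpace E] : IsFiniteKernel (aliveKernel E) :=
  ⟨1, ENNReal.one_lt_top, fun z => by
    cases z with
    | inl y => exact le_of_eq (measure_univ (μ := Measure.dirac y))
    | inr _ => exact zero_le_one⟩

theorem lintegral_aliveKernel {E : Type*} [MeasurableSpace E] {F : E → ℝ≥0∞} (hF : Measurable F)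
    (z : WithCemetery E) : ∫⁻ y, F y ∂(aliveKernel E z) = Sum.elim F (fun _ => 0) z := by
  cases z with
  | inl y => exact lintegral_dirac' y hF
  | inr _ => exact lintegral_zero_measure _

/-- Writing the extension by zero as an integral against `aliveKernel` reduces joint measurability
to that of kernel integrals. -/
theorem measurable_sumElim_zero {E α : Type*} [MeasurableSpace E] [MeasurableSpace α]
    {G : α × E → ℝ≥0∞} (hG : Measurable G) {a : α → WithCemetery E} (ha : Measurable a) :
    Measurable fun q : α => Sum.elim (fun y => G (q, y)) (fun _ => 0) (a q) := by
  have h : ∀ q : α, Sum.elim (fun y => G (q, y)) (fun _ => 0) (a q)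
      = ∫⁻ y, G (q, y) ∂((aliveKernel E).comap a ha q) := fun q =>
    (lintegral_aliveKernel (hG.comp measurable_prodMk_left) _).symm
  simp_rw [h]
  exact hG.lintegral_kernel_prod_right'

theorem measurable_sum_config {E α : Type*} [MeasurableSpace E] [MeasurableSpace α]
    {G : α × E → ℝ≥0∞} (hG : Measurable G) :
    Measurable fun q : α × Config E => ∑ c, G (q.1, q.2.2 c) := by
  refine measurable_prod_config fun n => ?_
  exact Finset.measurable_fun_sum Finset.univ (f := fun c (q : α × (Fin n → E)) => G (q.1, q.2 c))
    fun c _ => hG.comp (measurable_fst.prodMk ((measurable_pi_apply c).comp measurable_snd))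

theorem measurable_sum_config' {E : Type*} [MeasurableSpace E]
    {G : E → ℝ≥0∞} (hG : Measurable G) : Measurable fun o : Config E => ∑ c, G (o.2 c) := by
  refine measurable_config_iff.2 fun n => ?_
  exact Finset.measurable_fun_sum Finset.univ (f := fun c (v : Fin n → E) => G (v c))
    fun c _ => hG.comp (measurable_pi_apply c)

namespace BranchingModel

variable {E Ξ : Type*} [MeasurableSpace E] [MeasurableSpace Ξ] (M : BranchingModel E Ξ)

theorem measurable_rootAge :
    Measurable fun τ : Tree E Ξ => M.branchAge (τ []).1 (τ []).2.1 :=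
  M.measurable_branchAge.comp (f := fun τ : Tree E Ξ => ((τ []).1, (τ []).2.1))
    (measurable_root.fst.prodMk measurable_root.snd.fst)

theorem measurable_position (u : List ℕ) :
    Measurable fun q : ℝ≥0 × Tree E Ξ => M.position u q.2 q.1 := by
  have hA : Measurable fun q : ℝ≥0 × Tree E Ξ => M.branchAge (q.2 []).1 (q.2 []).2.1 :=
    M.measurable_rootAge.comp measurable_snd
  induction u with
  | nil =>
    unfold position
    refine Measurable.ite (measurableSet_lt measurable_fst.coe_nnreal_ennreal hA) ?_ measurable_const
    exact M.motion.measurable_path.comp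
      (measurable_fst.prodMk ((measurable_root.comp measurable_snd).fst))
  | cons i u ih =>
    unfold position
    refine Measurable.ite ?_ ?_ measurable_const
    · exact (measurableSet_le hA measurable_fst.coe_nnreal_ennreal).inter
        (measurableSet_lt measurable_const (measurable_root_card.comp measurable_snd))
    · exact ih.comp ((measurable_fst.sub hA.ennreal_toNNReal).prodMk
        ((measurable_subtree i).comp measurable_snd))

/-- The population at a given time, restricted to the particles of generation less than `n`. -/
noncomputable def popKernel (n : ℕ∞) : Kernel (ℝ≥0 × Tree E Ξ) E :=
  Kernel.sum fun u : List ℕ => if (u.length : ℕ∞) < n then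
    (aliveKernel E).comap (fun q : ℝ≥0 × Tree E Ξ => M.position u q.2 q.1) (M.measurable_position u)
    else 0

instance (n : ℕ∞) : IsSFiniteKernel (M.popKernel n) := by
  unfold popKernel
  refine Kernel.isSFiniteKernel_sum (hκs := fun u => ?_)
  split_ifs <;> infer_instance

theorem popKernel_top (t : ℝ≥0) (τ : Tree E Ξ) : M.popKernel ⊤ (t, τ) = M.X t τ := by
  unfold popKernel X
  rw [Kernel.sum_apply]
  congr 1

/-- The integral of a nonnegative function over the particles of generation less than `n`. -/
noncomputable def pop (n : ℕ∞) (F : E → ℝ≥0∞) (t : ℝ≥0) (τ : Tree E Ξ) : ℝ≥0∞ :=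
  ∫⁻ y, F y ∂(M.popKernel n (t, τ))

theorem pop_top (F : E → ℝ≥0∞) (t : ℝ≥0) (τ : Tree E Ξ) :
    M.pop ⊤ F t τ = ∫⁻ y, F y ∂(M.X t τ) := by rw [pop, popKernel_top]

theorem pop_eq_tsum (n : ℕ∞) {F : E → ℝ≥0∞} (hF : Measurable F) (t : ℝ≥0) (τ : Tree E Ξ) :
    M.pop n F t τ = ∑' u : List ℕ, if (u.length : ℕ∞) < n then
      Sum.elim F (fun _ => 0) (M.position u τ t) else 0 := by
  rw [pop, popKernel, Kernel.sum_apply, lintegral_sum_measure]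
  refine tsum_congr fun u => ?_
  split_ifs
  · rw [Kernel.comap_apply, lintegral_aliveKernel hF]
  · simp

theorem pop_zero {F : E → ℝ≥0∞} (hF : Measurable F) (t : ℝ≥0) (τ : Tree E Ξ) :
    M.pop 0 F t τ = 0 := by
  simp [pop_eq_tsum _ _ hF]

theorem pop_mono {m n : ℕ∞} (h : m ≤ n) {F : E → ℝ≥0∞} (hF : Measurable F) (t : ℝ≥0)
    (τ : Tree E Ξ) : M.pop m F t τ ≤ M.pop n F t τ := by
  rw [pop_eq_tsum _ _ hF, pop_eq_tsum _ _ hF]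
  refine ENNReal.tsum_le_tsum fun u => ?_
  split_ifs with h1 h2
  · exact le_rfl
  · exact absurd (h1.trans_le h) h2
  · exact zero_le
  · exact le_rfl

/-- A finite set of labels has bounded length, so every finite partial sum is already seen by some
truncation. -/
theorem iSup_pop {F : E → ℝ≥0∞} (hF : Measurable F) (t : ℝ≥0) (τ : Tree E Ξ) :
    ⨆ n : ℕ, M.pop n F t τ = M.pop ⊤ F t τ := by
  refine le_antisymm (iSup_le fun n => M.pop_mono le_top hF t τ) ?_
  rw [pop_eq_tsum _ _ hF, ENNReal.tsum_eq_iSup_sum]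
  refine iSup_le fun s => ?_
  refine le_trans ?_ (le_iSup _ (s.sup List.length + 1))
  rw [pop_eq_tsum _ _ hF]
  refine le_trans (Finset.sum_le_sum fun u hu => ?_) (ENNReal.sum_le_tsum s)
  rw [if_pos (ENat.natCast_lt_top _), if_pos]
  exact_mod_cast Nat.lt_succ_of_le (Finset.le_sup (f := List.length) hu)

/-- Decomposition of the population at the first branching time. -/
theorem pop_succ (n : ℕ∞) {F : E → ℝ≥0∞} (hF : Measurable F) (t : ℝ≥0) (τ : Tree E Ξ) :
    M.pop (n + 1) F t τ = if (t : ℝ≥0∞) < M.branchAge (τ []).1 (τ []).2.1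
      then Sum.elim F (fun _ => 0) (M.motion.path t (τ []).1)
      else ∑ j : Fin (children τ).1,
        M.pop n F (t - (M.branchAge (τ []).1 (τ []).2.1).toNNReal) ((children τ).2 j) := by
  rw [pop_eq_tsum _ _ hF, tsum_list_eq_add]
  have h0 : (([] : List ℕ).length : ℕ∞) < n + 1 := by
    simp only [List.length_nil, Nat.cast_zero]
    exact lt_of_lt_of_le zero_lt_one le_add_self
  rw [if_pos h0]
  by_cases h : (t : ℝ≥0∞) < M.branchAge (τ []).1 (τ []).2.1
  · have : ∀ (i : ℕ) (u : List ℕ), M.position (i :: u) τ t = Sum.inr () := fun i u => by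
      rw [position, if_neg (fun h' => not_le.2 h h'.1)]
    simp only [this, Sum.elim_inr, ite_self, tsum_zero, add_zero]
    rw [position, if_pos h, if_pos h]
  · rw [if_neg h, position, if_neg h, Sum.elim_inr, zero_add]
    -- Labels beyond the number of children carry no particle, so the sum over the first letter is
    -- finite.
    have hz : ∀ i, i ∉ Finset.range (τ []).2.2.1 →
        ∑' u : List ℕ, (if ((i :: u).length : ℕ∞) < n + 1 then
          Sum.elim F (fun _ => 0) (M.position (i :: u) τ t) else 0) = 0 := by
      intro i hi
      have : ∀ u : List ℕ, M.position (i :: u) τ t = Sum.inr () := fun u => by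
        rw [position, if_neg (fun h' => hi (Finset.mem_range.2 h'.2))]
      simp [this]
    rw [tsum_eq_sum (fun i hi => hz i hi), Finset.sum_range]
    refine Finset.sum_congr rfl fun i _ => ?_
    rw [pop_eq_tsum _ _ hF]
    refine tsum_congr fun u => ?_
    have hl : ((((i : ℕ) :: u).length : ℕ∞) < n + 1) ↔ ((u.length : ℕ∞) < n) := by
      rw [List.length_cons]
      push_cast
      exact ENat.add_lt_add_iff_right (by simp)
    have hp : M.position ((i : ℕ) :: u) τ t
        = M.position u (subtree i τ) (t - (M.branchAge (τ []).1 (τ []).2.1).toNNReal) := by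
      rw [position, if_pos ⟨not_lt.1 h, i.2⟩]
    simp only [hl, hp]
    rfl

section Measurability

variable {α : Type*} [MeasurableSpace α]

theorem measurable_pop (n : ℕ∞) {G : α × E → ℝ≥0∞} (hG : Measurable G) {t : α → ℝ≥0}
    (ht : Measurable t) {τ : α → Tree E Ξ} (hτ : Measurable τ) :
    Measurable fun a => M.pop n (fun y => G (a, y)) (t a) (τ a) :=
  hG.lintegral_kernel_prod_right' (κ := (M.popKernel n).comap (fun a => (t a, τ a)) (ht.prodMk hτ))

theorem measurable_pop' (n : ℕ∞) {G : E → ℝ≥0∞} (hG : Measurable G) {t : α → ℝ≥0}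
    (ht : Measurable t) {τ : α → Tree E Ξ} (hτ : Measurable τ) :
    Measurable fun a => M.pop n G (t a) (τ a) :=
  M.measurable_pop n (hG.comp measurable_snd) ht hτ

theorem measurable_killed {G : α × E → ℝ≥0∞} (hG : Measurable G) {t : α → ℝ≥0}
    (ht : Measurable t) {x : α → E} (hx : Measurable x) :
    Measurable fun a => M.killed (t a) (fun y => G (a, y)) (x a) := by
  have h1 : Measurable fun q : α × Ξ => M.survival q.2 (t q.1) :=
    M.measurable_survival.comp (f := fun q : α × Ξ => (q.2, t q.1))
      (measurable_snd.prodMk (ht.comp measurable_fst))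
  have h2 : Measurable fun q : α × Ξ => Sum.elim (fun y => G (q.1, y)) (fun _ => 0)
      (M.motion.path (t q.1) q.2) :=
    measurable_sumElim_zero (G := fun p : (α × Ξ) × E => G (p.1.1, p.2))
      (hG.comp (measurable_fst.fst.prodMk measurable_snd))
      (M.motion.measurable_path.comp ((ht.comp measurable_fst).prodMk measurable_snd))
  exact (h1.mul h2).lintegral_kernel_prod_right'
    (κ := M.motion.law.comap (fun a => Sum.inl (x a)) (measurable_inl.comp hx))

theorem measurable_rateOffspring {R : α × Config E → ℝ≥0∞} (hR : Measurable R) {x : α → E}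
    (hx : Measurable x) : Measurable fun a => M.rateOffspring (fun o => R (a, o)) (x a) :=
  ((M.measurable_rate.comp hx).coe_nnreal_ennreal).mul
    (hR.lintegral_kernel_prod_right' (κ := M.offspring.comap x hx))

end Measurability

section Operators

variable {M}

theorem killed_mono {F G : E → ℝ≥0∞} (h : ∀ y, F y ≤ G y) (t : ℝ≥0) (x : E) :
    M.killed t F x ≤ M.killed t G x := by
  refine lintegral_mono fun w => mul_le_mul_right ?_ _
  cases M.motion.path t w with
  | inl y => exact h y
  | inr _ => exact le_rfl

theorem rateOffspring_mono {R S : Config E → ℝ≥0∞} (h : ∀ o, R o ≤ S o) (y : E) :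
    M.rateOffspring R y ≤ M.rateOffspring S y :=
  mul_le_mul_right (lintegral_mono h) _

theorem rateOffspring_add {R S : Config E → ℝ≥0∞} (hR : Measurable R) (y : E) :
    M.rateOffspring (fun o => R o + S o) y = M.rateOffspring R y + M.rateOffspring S y := by
  unfold rateOffspring
  rw [lintegral_add_left hR, mul_add]

theorem killed_add {F G : E → ℝ≥0∞} (hF : Measurable F) (t : ℝ≥0) (x : E) :
    M.killed t (fun y => F y + G y) x = M.killed t F x + M.killed t G x := by
  unfold killed
  rw [← lintegral_add_left]
  · refine lintegral_congr fun w => ?_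
    rw [← mul_add]
    congr 1
    cases M.motion.path t w <;> simp
  · exact (M.measurable_survival.comp (f := fun w : Ξ => (w, t)) measurable_prodMk_right).mul
      ((hF.sumElim measurable_const).comp
        (M.motion.measurable_path.comp (f := fun w : Ξ => (t, w)) measurable_prodMk_left))

theorem killed_lintegral {β : Type*} [MeasurableSpace β] {μ : Measure β} [SFinite μ]
    {G : β × E → ℝ≥0∞} (hG : Measurable G) (t : ℝ≥0) (x : E) :
    M.killed t (fun y => ∫⁻ b, G (b, y) ∂μ) x = ∫⁻ b, M.killed t (fun y => G (b, y)) x ∂μ := by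
  have h2 : Measurable fun q : Ξ × β => Sum.elim (fun y => G (q.2, y)) (fun _ => 0)
      (M.motion.path t q.1) :=
    measurable_sumElim_zero (G := fun p : (Ξ × β) × E => G (p.1.2, p.2))
      (hG.comp (measurable_fst.snd.prodMk measurable_snd))
      (M.motion.measurable_path.comp (measurable_const.prodMk measurable_fst))
  have h1 : Measurable fun q : Ξ × β => M.survival q.1 t :=
    M.measurable_survival.comp (f := fun q : Ξ × β => (q.1, t))
      (measurable_fst.prodMk measurable_const)
  unfold killed
  rw [← lintegral_lintegral_swap (h1.mul h2).aemeasurable]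
  refine lintegral_congr fun w => ?_
  have h3 : Measurable fun b => Sum.elim (fun y => G (b, y)) (fun _ => 0) (M.motion.path t w) :=
    h2.comp (measurable_prodMk_left (x := w))
  rw [lintegral_const_mul _ h3]
  congr 1
  cases M.motion.path t w <;> simp

theorem rateOffspring_lintegral {β : Type*} [MeasurableSpace β] {μ : Measure β} [SFinite μ]
    {R : β × Config E → ℝ≥0∞} (hR : Measurable R) (y : E) :
    M.rateOffspring (fun o => ∫⁻ b, R (b, o) ∂μ) y
      = ∫⁻ b, M.rateOffspring (fun o => R (b, o)) y ∂μ := by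
  unfold rateOffspring
  rw [lintegral_const_mul _ (hR.lintegral_prod_right' (ν := M.offspring y))]
  congr 1
  exact lintegral_lintegral_swap (f := fun o b => R (b, o)) (hR.comp measurable_swap).aemeasurable

end Operators

end BranchingModel

/-! ### Products of sums as sums over partitions. -/

section Assignments

variable {l n : ℕ} {A : Finset (Fin l)}

/-- The indices that are assigned to `j`. -/
def fiberBlock (α : A → Fin n) (j : Fin n) : Finset (Fin l) :=
  (Finset.univ.filter fun a : A => α a = j).map (Function.Embedding.subtype _)

theorem mem_fiberBlock {α : A → Fin n} {j : Fin n} {i : Fin l} :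
    i ∈ fiberBlock α j ↔ ∃ h : i ∈ A, α ⟨i, h⟩ = j := by
  simp [fiberBlock]

/-- The assignment that sends all indices in a block of a partition to the same value. -/
def blockAssign (q : Σ σ : Finpartition A, (σ.parts ↪ Fin n)) : A → Fin n :=
  fun a => q.2 ⟨q.1.part a, q.1.part_mem.2 a.2⟩

theorem fiberBlock_blockAssign (q : Σ σ : Finpartition A, (σ.parts ↪ Fin n)) (b : q.1.parts) :
    fiberBlock (blockAssign q) (q.2 b) = b := by
  ext i
  rw [mem_fiberBlock]
  constructor
  · rintro ⟨h, h'⟩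
    have := q.2.injective h'
    rw [← this]
    exact q.1.mem_part h
  · intro h
    refine ⟨q.1.le b.2 h, ?_⟩
    unfold blockAssign
    congr 1
    exact Subtype.ext (q.1.part_eq_of_mem b.2 h)

/-- The blocks and their labels are recovered from the assignment as its nonempty fibres and their
values. -/
theorem blockAssign_injective :
    Function.Injective (blockAssign : (Σ σ : Finpartition A, (σ.parts ↪ Fin n)) → A → Fin n) := by
  have key : ∀ q q' : Σ σ : Finpartition A, (σ.parts ↪ Fin n), blockAssign q = blockAssign q' →
      ∀ b : q.1.parts, ∃ b' : q'.1.parts, (b' : Finset (Fin l)) = b ∧ q'.2 b' = q.2 b := by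
    intro q q' h b
    obtain ⟨i, hi⟩ := q.1.nonempty_of_mem_parts b.2
    have hiA := q.1.le b.2 hi
    have e1 : blockAssign q ⟨i, hiA⟩ = q.2 b := by
      have hi' := hi
      rw [← fiberBlock_blockAssign q b, mem_fiberBlock] at hi'
      exact hi'.2
    refine ⟨⟨q'.1.part i, q'.1.part_mem.2 hiA⟩, ?_, ?_⟩
    · have e2 := fiberBlock_blockAssign q' ⟨q'.1.part i, q'.1.part_mem.2 hiA⟩
      have e3 : q'.2 ⟨q'.1.part i, q'.1.part_mem.2 hiA⟩ = q.2 b := by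
        rw [← e1, h]; rfl
      rw [e3, ← h, fiberBlock_blockAssign] at e2
      exact e2.symm
    · rw [← e1, h]; rfl
  intro q q' h
  obtain ⟨σ, e⟩ := q
  obtain ⟨σ', e'⟩ := q'
  have hσ : σ = σ' := by
    apply Finpartition.ext
    ext b
    constructor
    · intro hb
      obtain ⟨b', h1, -⟩ := key _ _ h ⟨b, hb⟩
      have h2 := b'.2
      rw [h1] at h2
      exact h2
    · intro hb
      obtain ⟨b', h1, -⟩ := key _ _ h.symm ⟨b, hb⟩
      have h2 := b'.2
      rw [h1] at h2
      exact h2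
  subst hσ
  congr 1
  ext b
  obtain ⟨b', h1, h2⟩ := key _ _ h b
  have : b' = b := Subtype.ext h1
  subst this
  exact congrArg Fin.val h2.symm

/-- The nonempty fibres of an assignment form a partition, and each of them is labelled by its
value. -/
theorem blockAssign_surjective :
    Function.Surjective (blockAssign : (Σ σ : Finpartition A, (σ.parts ↪ Fin n)) → A → Fin n) := by
  intro α
  let σ : Finpartition A := Finpartition.ofExistsUnique
    ((Finset.univ.image (fiberBlock α)).erase ∅)
    (by
      intro p hp
      obtain ⟨j, -, rfl⟩ := Finset.mem_image.1 (Finset.mem_of_mem_erase hp)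
      intro i hi
      exact (mem_fiberBlock.1 hi).1)
    (by
      intro a ha
      have hmem : a ∈ fiberBlock α (α ⟨a, ha⟩) := mem_fiberBlock.2 ⟨ha, rfl⟩
      refine ⟨fiberBlock α (α ⟨a, ha⟩), ⟨Finset.mem_erase.2 ⟨Finset.ne_empty_of_mem hmem,
        Finset.mem_image_of_mem _ (Finset.mem_univ _)⟩, hmem⟩, ?_⟩
      rintro p ⟨hp, hap⟩
      obtain ⟨j, -, rfl⟩ := Finset.mem_image.1 (Finset.mem_of_mem_erase hp)
      obtain ⟨_, hj⟩ := mem_fiberBlock.1 hap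
      rw [hj])
    (Finset.notMem_erase _ _)
  have hσ : ∀ b : σ.parts, ∃ j, fiberBlock α j = b := by
    intro b
    obtain ⟨j, -, hj⟩ := Finset.mem_image.1 (Finset.mem_of_mem_erase b.2)
    exact ⟨j, hj⟩
  choose e he using hσ
  refine ⟨⟨σ, ⟨e, fun b b' h => Subtype.ext ?_⟩⟩, ?_⟩
  · rw [← he b, ← he b', h]
  · funext a
    have h := he ⟨σ.part a, σ.part_mem.2 a.2⟩
    have ha : (a : Fin l) ∈ σ.part a := σ.mem_part a.2
    rw [show σ.part a = _ from h.symm, mem_fiberBlock] at ha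
    exact ha.2.symm

/-- Assigning indices to children amounts to choosing a partition and labelling its blocks
injectively. A child that receives no index contributes the factor `g ∅ = 1`. -/
theorem sum_assign_eq_sum_finpartition {R : Type*} [CommSemiring R] (g : Finset (Fin l) → Fin n → R)
    (hg : ∀ j, g ∅ j = 1) :
    ∑ α : A → Fin n, ∏ j, g (fiberBlock α j) j
      = ∑ σ : Finpartition A, ∑ e : σ.parts ↪ Fin n, ∏ b : σ.parts, g b (e b) := by
  rw [← Fintype.sum_sigma' fun (σ : Finpartition A) (e : σ.parts ↪ Fin n) =>
    ∏ b : σ.parts, g b (e b)]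
  symm
  refine Fintype.sum_bijective blockAssign ⟨blockAssign_injective, blockAssign_surjective⟩ _ _
    fun q => ?_
  refine Fintype.prod_of_injective q.2 q.2.injective _ _ ?_ ?_
  · intro j hj
    have : fiberBlock (blockAssign q) j = ∅ := by
      refine Finset.eq_empty_of_forall_notMem fun i hi => hj ?_
      exact ⟨_, (mem_fiberBlock.1 hi).2⟩
    rw [this, hg]
  · intro b
    rw [fiberBlock_blockAssign]

/-- On expanding, each index picks a child; the factors are then grouped by child so that
independence of the subtrees can be applied. -/
theorem prod_sum_eq_sum_assign {R : Type*} [CommSemiring R] (X : Fin l → Fin n → R) :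
    ∏ i ∈ A, ∑ j, X i j = ∑ α : A → Fin n, ∏ j, ∏ i ∈ fiberBlock α j, X i j := by
  rw [← Finset.prod_coe_sort, Finset.prod_univ_sum, Fintype.piFinset_univ]
  refine Finset.sum_congr rfl fun α _ => ?_
  rw [← Finset.prod_fiberwise Finset.univ α]
  refine Finset.prod_congr rfl fun j _ => ?_
  rw [fiberBlock, Finset.prod_map]
  refine Finset.prod_congr rfl fun a ha => ?_
  rw [(Finset.mem_filter.1 ha).2]
  rfl

theorem sum_indiscrete {R : Type*} [CommSemiring R] (hA : A.Nonempty)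
    (g : Finset (Fin l) → Fin n → R) :
    ∑ σ : Finpartition A with σ.parts = {A}, ∑ e : σ.parts ↪ Fin n, ∏ b : σ.parts, g b (e b)
      = ∑ j, g A j := by
  have hs : (Finset.univ.filter fun σ : Finpartition A => σ.parts = {A})
      = {Finpartition.indiscrete hA.ne_empty} := by
    ext σ
    simp only [Finset.mem_filter, Finset.mem_univ, true_and, Finset.mem_singleton]
    exact ⟨fun h => Finpartition.ext h, fun h => by rw [h]; rfl⟩
  rw [hs, Finset.sum_singleton]
  change ∑ e : ({A} : Finset (Finset (Fin l))) ↪ Fin n,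
    ∏ b : ({A} : Finset (Finset (Fin l))), g b (e b) = _
  let a₀ : ({A} : Finset (Finset (Fin l))) := ⟨A, Finset.mem_singleton_self A⟩
  have ha₀ : ∀ b : ({A} : Finset (Finset (Fin l))), b = a₀ :=
    fun b => Subtype.ext (Finset.mem_singleton.1 b.2)
  refine Fintype.sum_bijective (fun e : ({A} : Finset (Finset (Fin l))) ↪ Fin n => e a₀)
    ⟨fun e e' h => ?_, fun j => ?_⟩ _ _ fun e => ?_
  · ext b
    rw [ha₀ b]
    exact congrArg Fin.val h
  · exact ⟨⟨fun _ => j, fun b b' _ => by rw [ha₀ b, ha₀ b']⟩, rfl⟩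
  · rw [Fintype.prod_eq_single a₀ fun b hb => absurd (ha₀ b) hb]

end Assignments

/-- The sum over the partitions of `A` other than `{A}` and over the choices of pairwise distinct
offspring for their blocks. -/
noncomputable def zetaSum {E R : Type*} [CommSemiring R] {l : ℕ} (A : Finset (Fin l))
    (g : Finset (Fin l) → E → R) (o : Config E) : R :=
  ∑ σ : Finpartition A with σ.parts ≠ {A}, ∑ i : σ.parts ↪ Fin o.1, ∏ b : σ.parts, g b (o.2 (i b))

/-- The one-block partition sends all indices to a single child and gives the term that generates
the mean semigroup. The other partitions form the source ζ. -/
theorem sum_assign_eq_add_zetaSum {E R : Type*} [CommSemiring R] {l : ℕ} {A : Finset (Fin l)}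
    (hA : A.Nonempty) (g : Finset (Fin l) → E → R) (hg : ∀ y, g ∅ y = 1) (o : Config E) :
    ∑ α : A → Fin o.1, ∏ j, g (fiberBlock α j) (o.2 j)
      = ∑ j, g A (o.2 j) + zetaSum A g o := by
  rw [sum_assign_eq_sum_finpartition (fun b j => g b (o.2 j)) (fun j => hg _),
    ← Finset.sum_filter_add_sum_filter_not Finset.univ (fun σ : Finpartition A => σ.parts = {A}),
    sum_indiscrete hA fun b j => g b (o.2 j)]
  rfl

/-- A block equal to `A` would meet every other block, leaving only the partition `{A}`. Hence ζ
involves only proper subsets, which is what makes induction on the size possible. -/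
theorem ssubset_of_mem_parts {l : ℕ} {A : Finset (Fin l)} {σ : Finpartition A}
    (hσ : σ.parts ≠ {A}) {b : Finset (Fin l)} (hb : b ∈ σ.parts) : b ⊂ A := by
  refine lt_of_le_of_ne (σ.le hb) fun h => hσ ?_
  subst h
  refine Finset.eq_singleton_iff_unique_mem.2 ⟨hb, fun c hc => ?_⟩
  obtain ⟨i, hi⟩ := σ.nonempty_of_mem_parts hc
  exact σ.eq_of_mem_parts hc hb hi (σ.le hc hi)

theorem measurable_zetaSum {E R α : Type*} [CommSemiring R] [MeasurableSpace R] [MeasurableAdd₂ R]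
    [MeasurableMul₂ R] [MeasurableSpace E] [MeasurableSpace α] {l : ℕ} (A : Finset (Fin l))
    {g : α → Finset (Fin l) → E → R} (hg : ∀ b ⊂ A, b.Nonempty → Measurable fun q : α × E => g q.1 b q.2) :
    Measurable fun q : α × Config E => zetaSum A (g q.1) q.2 := by
  refine measurable_prod_config fun n => ?_
  have hb : ∀ (σ : Finpartition A), σ.parts ≠ {A} → ∀ (i : σ.parts ↪ Fin n) (b : σ.parts),
      Measurable fun q : α × (Fin n → E) => g q.1 b (q.2 (i b)) := fun σ hσ i b => by
    have h1 : Measurable fun q : α × (Fin n → E) => (q.1, q.2 (i b)) :=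
      measurable_fst.prodMk ((measurable_pi_apply (i b)).comp measurable_snd)
    exact (hg b (ssubset_of_mem_parts hσ b.2) (σ.nonempty_of_mem_parts b.2)).comp h1
  have hp : ∀ (σ : Finpartition A), σ.parts ≠ {A} → ∀ (i : σ.parts ↪ Fin n),
      Measurable fun q : α × (Fin n → E) => ∏ b : σ.parts, g q.1 b (q.2 (i b)) :=
    fun σ hσ i => Finset.measurable_fun_prod _ fun b _ => hb σ hσ i b
  have hs : ∀ (σ : Finpartition A), σ.parts ≠ {A} → Measurable fun q : α × (Fin n → E) =>
      ∑ i : σ.parts ↪ Fin n, ∏ b : σ.parts, g q.1 b (q.2 (i b)) :=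
    fun σ hσ => Finset.measurable_fun_sum _ fun i _ => hp σ hσ i
  exact Finset.measurable_fun_sum _ fun σ hσ => hs σ (Finset.mem_filter.1 hσ).2

/-- Tonelli on the triangle `0 < r ≤ s ≤ t`, followed by the translation `s = u + r`. -/
theorem lintegral_triangle {Φ : ℝ → ℝ → ℝ≥0∞} (hΦ : Measurable (Function.uncurry Φ)) (t : ℝ) :
    ∫⁻ s in Set.Ioc 0 t, ∫⁻ r in Set.Ioc 0 s, Φ r s
      = ∫⁻ r in Set.Ioc 0 t, ∫⁻ u in Set.Ioc 0 (t - r), Φ r (u + r) := by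
  set S : Set (ℝ × ℝ) := {q | 0 < q.1 ∧ q.1 ≤ q.2 ∧ q.2 ≤ t} with hS
  have hSm : MeasurableSet S :=
    (measurableSet_lt measurable_const measurable_fst).inter
      ((measurableSet_le measurable_fst measurable_snd).inter
        (measurableSet_le measurable_snd measurable_const))
  have hI : Measurable (S.indicator (Function.uncurry Φ)) := hΦ.indicator hSm
  have h1 : ∀ s, (Set.Ioc 0 t).indicator (fun s => ∫⁻ r in Set.Ioc 0 s, Φ r s) s
      = ∫⁻ r, S.indicator (Function.uncurry Φ) (r, s) := by
    intro s
    by_cases hs : s ∈ Set.Ioc 0 t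
    · rw [Set.indicator_of_mem hs, ← lintegral_indicator measurableSet_Ioc]
      refine lintegral_congr fun r => ?_
      simp only [Set.indicator_apply, Set.mem_Ioc, hS, Set.mem_ofPred_eq, hs.2, and_true]
      rfl
    · rw [Set.indicator_of_notMem hs]
      have : ∀ r, S.indicator (Function.uncurry Φ) (r, s) = 0 := fun r =>
        Set.indicator_of_notMem (fun h => hs ⟨h.1.trans_le h.2.1, h.2.2⟩) _
      simp [this]
  have h2 : ∀ r, (Set.Ioc 0 t).indicator (fun r => ∫⁻ u in Set.Ioc 0 (t - r), Φ r (u + r)) r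
      = ∫⁻ s, S.indicator (Function.uncurry Φ) (r, s) := by
    intro r
    rw [← lintegral_add_right_eq_self _ r]
    by_cases hr : r ∈ Set.Ioc 0 t
    -- The condition `r ≤ u + r` reads `0 ≤ u`, so the interval is first closed at its left end,
    -- which changes a null set only.
    · rw [Set.indicator_of_mem hr, setLIntegral_congr Ioc_ae_eq_Icc,
        ← lintegral_indicator measurableSet_Icc]
      refine lintegral_congr fun u => ?_
      have : u ∈ Set.Icc 0 (t - r) ↔ (r, u + r) ∈ S := by
        simp only [Set.mem_Icc, hS, Set.mem_ofPred_eq, hr.1, true_and, le_add_iff_nonneg_left,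
          le_sub_iff_add_le]
      simp only [Set.indicator_apply, this]
      rfl
    · rw [Set.indicator_of_notMem hr]
      have : ∀ u, S.indicator (Function.uncurry Φ) (r, u + r) = 0 := fun u =>
        Set.indicator_of_notMem (fun h => hr ⟨h.1, h.2.1.trans h.2.2⟩) _
      simp [this]
  rw [← lintegral_indicator measurableSet_Ioc, ← lintegral_indicator measurableSet_Ioc]
  simp_rw [h1, h2]
  exact lintegral_lintegral_swap (f := fun s r => S.indicator (Function.uncurry Φ) (r, s))
    (hI.comp measurable_swap).aemeasurable

theorem lintegral_childKernel_sum {α β : Type*} [MeasurableSpace α] [MeasurableSpace β]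
    (κ : Kernel α β) [IsMarkovKernel κ] (o : Config α) {h : β → ℝ≥0∞} (hh : Measurable h) :
    ∫⁻ c, ∑ j, h (c.2 j) ∂(childKernel κ o) = ∑ j, ∫⁻ y, h y ∂(κ (o.2 j)) := by
  have hm : Measurable fun c : Config β => ∑ j, h (c.2 j) := measurable_sum_config' hh
  rw [lintegral_childKernel κ o hm]
  change ∫⁻ v : Fin o.1 → β, ∑ j, h (v j) ∂_ = _
  rw [lintegral_finsetSum]
  · refine Finset.sum_congr rfl fun j _ => ?_
    rw [← (measurePreserving_eval (fun i => κ (o.2 i)) j).lintegral_comp hh]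
  · exact fun j _ => hh.comp (measurable_pi_apply j)

/-! ### The evolution equation for nonnegative functions. -/

section Moments

variable {E Ξ : Type*} [MeasurableSpace E] [MeasurableSpace Ξ] (M : BranchingModel E Ξ)
  (Q : Kernel E (Tree E Ξ))

/-- The mean semigroup on nonnegative functions, restricted to generations less than `n`. -/
noncomputable def meanE (n : ℕ∞) (F : E → ℝ≥0∞) (t : ℝ≥0) (x : E) : ℝ≥0∞ :=
  ∫⁻ τ, M.pop n F t τ ∂(Q x)

/-- The moments for nonnegative functions, restricted to generations less than `n`. -/
noncomputable def momentE {l : ℕ} (n : ℕ∞) (F : Fin l → E → ℝ≥0∞) (t : ℝ≥0) (A : Finset (Fin l))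
    (x : E) : ℝ≥0∞ :=
  ∫⁻ τ, ∏ i ∈ A, M.pop n (F i) t τ ∂(Q x)

section Measurability

variable {α : Type*} [MeasurableSpace α] [IsMarkovKernel Q]

theorem measurable_meanE (n : ℕ∞) {G : α × E → ℝ≥0∞} (hG : Measurable G) {t : α → ℝ≥0}
    (ht : Measurable t) {x : α → E} (hx : Measurable x) :
    Measurable fun a => meanE M Q n (fun y => G (a, y)) (t a) (x a) := by
  have h : Measurable fun q : α × Tree E Ξ => M.pop n (fun y => G (q.1, y)) (t q.1) q.2 :=
    M.measurable_pop n (G := fun p : (α × Tree E Ξ) × E => G (p.1.1, p.2))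
      (hG.comp (measurable_fst.fst.prodMk measurable_snd)) (ht.comp measurable_fst) measurable_snd
  exact h.lintegral_kernel_prod_right' (κ := Q.comap x hx)

theorem measurable_momentE {l : ℕ} (n : ℕ∞) {F : Fin l → E → ℝ≥0∞} (hF : ∀ i, Measurable (F i))
    (A : Finset (Fin l)) {t : α → ℝ≥0} (ht : Measurable t) {x : α → E} (hx : Measurable x) :
    Measurable fun a => momentE M Q n F (t a) A (x a) := by
  have h : Measurable fun q : α × Tree E Ξ => ∏ i ∈ A, M.pop n (F i) (t q.1) q.2 :=
    Finset.measurable_fun_prod _ fun i _ =>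
      M.measurable_pop' n (hF i) (ht.comp measurable_fst) measurable_snd
  exact h.lintegral_kernel_prod_right' (κ := Q.comap x hx)

end Measurability

variable {M Q}

theorem momentE_empty [IsMarkovKernel Q] {l : ℕ} (n : ℕ∞) (F : Fin l → E → ℝ≥0∞) (t : ℝ≥0) (x : E) :
    momentE M Q n F t ∅ x = 1 := by simp [momentE]

theorem momentE_mono {l : ℕ} {m n : ℕ∞} (h : m ≤ n) {F : Fin l → E → ℝ≥0∞}
    (hF : ∀ i, Measurable (F i)) (t : ℝ≥0) (A : Finset (Fin l)) (x : E) :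
    momentE M Q m F t A x ≤ momentE M Q n F t A x :=
  lintegral_mono fun τ => Finset.prod_le_prod' fun i _ => M.pop_mono h (hF i) t τ

theorem meanE_mono {m n : ℕ∞} (h : m ≤ n) {F : E → ℝ≥0∞} (hF : Measurable F) (t : ℝ≥0) (x : E) :
    meanE M Q m F t x ≤ meanE M Q n F t x :=
  lintegral_mono fun τ => M.pop_mono h hF t τ

theorem iSup_meanE {F : E → ℝ≥0∞} (hF : Measurable F) (t : ℝ≥0) (x : E) :
    ⨆ n : ℕ, meanE M Q n F t x = meanE M Q ⊤ F t x := by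
  unfold meanE
  rw [← lintegral_iSup (f := fun (n : ℕ) τ => M.pop n F t τ)
    (fun n => M.measurable_pop' n hF measurable_const measurable_id) fun m n h τ => M.pop_mono (by exact_mod_cast h) hF t τ]
  simp_rw [M.iSup_pop hF]

theorem iSup_momentE {l : ℕ} {F : Fin l → E → ℝ≥0∞} (hF : ∀ i, Measurable (F i)) (t : ℝ≥0)
    (A : Finset (Fin l)) (x : E) : ⨆ n : ℕ, momentE M Q n F t A x = momentE M Q ⊤ F t A x := by
  have hmono : ∀ τ, Monotone fun n : ℕ => ∏ i ∈ A, M.pop n (F i) t τ := fun τ m n h =>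
    Finset.prod_le_prod' fun i _ => M.pop_mono (by exact_mod_cast h) (hF i) t τ
  unfold momentE
  rw [← lintegral_iSup (f := fun (n : ℕ) τ => ∏ i ∈ A, M.pop n (F i) t τ)
    (fun n => Finset.measurable_fun_prod _ fun i _ =>
    M.measurable_pop' n (hF i) measurable_const measurable_id) fun m n h τ => hmono τ h]
  refine lintegral_congr fun τ => ?_
  refine tendsto_nhds_unique (tendsto_atTop_iSup (hmono τ)) ?_
  clear hmono
  classical
  induction A using Finset.induction_on with
  | empty => simp
  | insert i s his ih =>
    simp only [Finset.prod_insert his]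
    have hi : Monotone fun n : ℕ => M.pop n (F i) t τ := fun m n h =>
      M.pop_mono (by exact_mod_cast h) (hF i) t τ
    have hs : Monotone fun n : ℕ => ∏ j ∈ s, M.pop n (F j) t τ := fun m n h =>
      Finset.prod_le_prod' fun j _ => M.pop_mono (by exact_mod_cast h) (hF j) t τ
    have e : M.pop ⊤ (F i) t τ * ∏ j ∈ s, M.pop ⊤ (F j) t τ
        = ⨆ n : ℕ, M.pop n (F i) t τ * ∏ j ∈ s, M.pop n (F j) t τ := by
      rw [← M.iSup_pop (hF i), tendsto_nhds_unique ih (tendsto_atTop_iSup hs)]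
      refine le_antisymm ?_ (iSup_le fun n => mul_le_mul' (le_iSup (fun n : ℕ =>
        M.pop n (F i) t τ) n) (le_iSup (fun n : ℕ => ∏ j ∈ s, M.pop n (F j) t τ) n))
      rw [ENNReal.iSup_mul]
      refine iSup_le fun m => ?_
      rw [ENNReal.mul_iSup]
      exact iSup_le fun n => le_iSup_of_le (max m n)
        (mul_le_mul' (hi (le_max_left _ _)) (hs (le_max_right _ _)))
    rw [e]
    exact tendsto_atTop_iSup fun m n h => mul_le_mul' (hi h) (hs h)

/-- The recursion for moments, generation by generation. -/
theorem momentE_succ [IsMarkovKernel Q] (hQ : M.IsTreeLaw Q) {l : ℕ} (n : ℕ∞)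
    {F : Fin l → E → ℝ≥0∞} (hF : ∀ i, Measurable (F i)) (t : ℝ≥0) {A : Finset (Fin l)}
    (hA : A.Nonempty) (x : E) :
    momentE M Q (n + 1) F t A x = M.killed t (fun y => ∏ i ∈ A, F i y) x
      + ∫⁻ s in Set.Ioc (0 : ℝ) t, M.killed s.toNNReal (M.rateOffspring fun o =>
          ∑ j, momentE M Q n F (t - s.toNNReal) A (o.2 j)
            + zetaSum A (fun b => momentE M Q n F (t - s.toNNReal) b) o) x := by
  -- After the first branching, every linear statistic is the sum of the statistics of the children.
  set R : ℝ≥0 × Config (Tree E Ξ) → ℝ≥0∞ := fun q =>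
    ∏ i ∈ A, ∑ j, M.pop n (F i) q.1 (q.2.2 j) with hR
  have hRm : Measurable R := by
    exact Finset.measurable_fun_prod _ fun i _ => measurable_sum_config
      (G := fun q : ℝ≥0 × Tree E Ξ => M.pop n (F i) q.1 q.2)
      (M.measurable_pop' n (hF i) measurable_fst measurable_snd)
  have hFm : Measurable fun y => ∏ i ∈ A, F i y := Finset.measurable_fun_prod _ fun i _ => hF i
  have e1 : momentE M Q (n + 1) F t A x = ∫⁻ τ, (if (t : ℝ≥0∞) < M.branchAge (τ []).1 (τ []).2.1
        then Sum.elim (fun y => ∏ i ∈ A, F i y) (fun _ => 0) (M.motion.path t (τ []).1)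
        else R (t - (M.branchAge (τ []).1 (τ []).2.1).toNNReal, children τ)) ∂(Q x) := by
    refine lintegral_congr fun τ => ?_
    simp_rw [M.pop_succ n (hF _)]
    split_ifs with h
    · cases M.motion.path t (τ []).1 with
      | inl y => rfl
      | inr _ =>
        obtain ⟨i, hi⟩ := hA
        exact Finset.prod_eq_zero hi rfl
    · rfl
  rw [e1, hQ.lintegral_first_branching x t hFm hRm]
  congr 1
  refine lintegral_congr fun s => ?_
  congr 2
  funext o
  have hR' : Measurable fun c => R (t - s.toNNReal, c) := hRm.comp measurable_prodMk_left
  have hpm : ∀ (b : Finset (Fin l)), Measurable fun τ : Tree E Ξ =>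
      ∏ i ∈ b, M.pop n (F i) (t - s.toNNReal) τ := fun b =>
    Finset.measurable_fun_prod _ fun i _ => M.measurable_pop' n (hF i) measurable_const measurable_id
  rw [lintegral_childKernel Q o hR',
    ← sum_assign_eq_add_zetaSum hA (fun b => momentE M Q n F (t - s.toNNReal) b)
      (fun y => momentE_empty n F _ y) o]
  -- Once expanded into assignments, each summand factorises over the independent subtrees.
  have hexp : ∀ v : Fin o.1 → Tree E Ξ, R (t - s.toNNReal, ⟨o.1, v⟩)
      = ∑ α : A → Fin o.1, ∏ j, ∏ i ∈ fiberBlock α j, M.pop n (F i) (t - s.toNNReal) (v j) :=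
    fun v => prod_sum_eq_sum_assign fun i j => M.pop n (F i) (t - s.toNNReal) (v j)
  simp_rw [hexp]
  rw [lintegral_finsetSum]
  · refine Finset.sum_congr rfl fun α _ => ?_
    exact lintegral_pi_prod (fun j => Q (o.2 j))
      (fun j τ => ∏ i ∈ fiberBlock α j, M.pop n (F i) (t - s.toNNReal) τ) fun j => hpm _
  · exact fun α _ => Finset.measurable_fun_prod _ fun j _ => (hpm _).comp (measurable_pi_apply j)

theorem meanE_succ [IsMarkovKernel Q] (hQ : M.IsTreeLaw Q) (n : ℕ∞)
    {F : E → ℝ≥0∞} (hF : Measurable F) (t : ℝ≥0) (x : E) :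
    meanE M Q (n + 1) F t x = M.killed t F x
      + ∫⁻ s in Set.Ioc (0 : ℝ) t, M.killed s.toNNReal (M.rateOffspring fun o =>
          ∑ j, meanE M Q n F (t - s.toNNReal) (o.2 j)) x := by
  set R : ℝ≥0 × Config (Tree E Ξ) → ℝ≥0∞ := fun q => ∑ j, M.pop n F q.1 (q.2.2 j) with hR
  have hRm : Measurable R := measurable_sum_config
    (G := fun q : ℝ≥0 × Tree E Ξ => M.pop n F q.1 q.2)
    (M.measurable_pop' n hF measurable_fst measurable_snd)
  have e1 : meanE M Q (n + 1) F t x = ∫⁻ τ, (if (t : ℝ≥0∞) < M.branchAge (τ []).1 (τ []).2.1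
        then Sum.elim F (fun _ => 0) (M.motion.path t (τ []).1)
        else R (t - (M.branchAge (τ []).1 (τ []).2.1).toNNReal, children τ)) ∂(Q x) :=
    lintegral_congr fun τ => M.pop_succ n hF t τ
  rw [e1, hQ.lintegral_first_branching x t hF hRm]
  congr 1
  refine lintegral_congr fun s => ?_
  congr 2
  funext o
  exact lintegral_childKernel_sum Q o (M.measurable_pop' n hF measurable_const measurable_id)

variable (M Q) in
/-- The mild solution of the linear equation with initial value `F` and source `h`. -/
noncomputable def duhamelE (n : ℕ∞) (F : E → ℝ≥0∞) (h : ℝ≥0 → E → ℝ≥0∞) (t : ℝ≥0) (x : E) : ℝ≥0∞ :=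
  meanE M Q n F t x + ∫⁻ s in Set.Ioc (0 : ℝ) t, meanE M Q n (h (t - s.toNNReal)) s.toNNReal x

/-- The mild solution built from the mean semigroup also solves the first-branching equation of the
killed semigroup: the mean semigroup does by `meanE_succ`, and the resulting double time integral is
rearranged by `lintegral_triangle`. The shift by one generation makes this a recursion that can be
compared with `momentE_succ`. -/
theorem duhamelE_succ [IsMarkovKernel Q] (hQ : M.IsTreeLaw Q) (n : ℕ∞)
    {F : E → ℝ≥0∞} (hF : Measurable F) {h : ℝ≥0 → E → ℝ≥0∞}
    (hh : Measurable (Function.uncurry h)) (t : ℝ≥0) (x : E) :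
    duhamelE M Q (n + 1) F h t x = M.killed t F x
      + ∫⁻ s in Set.Ioc (0 : ℝ) t, M.killed s.toNNReal (fun y =>
          M.rateOffspring (fun o => ∑ j, duhamelE M Q n F h (t - s.toNNReal) (o.2 j)) y
            + h (t - s.toNNReal) y) x := by
  have hh1 : ∀ u, Measurable (h u) := fun u => hh.comp measurable_prodMk_left
  have hh2 : Measurable fun q : ℝ × E => h (t - q.1.toNNReal) q.2 :=
    hh.comp (f := fun q : ℝ × E => (t - q.1.toNNReal, q.2)) (by fun_prop)
  -- the operator `f ↦ γ m[f]`
  let ρ : (E → ℝ≥0∞) → E → ℝ≥0∞ := fun f y => M.rateOffspring (fun o => ∑ j, f (o.2 j)) y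
  have hρm : ∀ {f : ℝ × E → ℝ≥0∞}, Measurable f →
      Measurable fun q : ℝ × E => ρ (fun y => f (q.1, y)) q.2 := by
    intro f hf
    exact M.measurable_rateOffspring (α := ℝ × E) (R := fun p => ∑ j, f (p.1.1, p.2.2 j))
      (measurable_sum_config (α := ℝ × E) (G := fun p => f (p.1.1, p.2))
        (hf.comp (measurable_fst.fst.prodMk measurable_snd))) measurable_snd
  have hρadd : ∀ {f g : E → ℝ≥0∞}, Measurable f → ∀ y,
      ρ (fun y => f y + g y) y = ρ f y + ρ g y := by
    intro f g hf y
    simp only [ρ, Finset.sum_add_distrib]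
    exact M.rateOffspring_add (measurable_sum_config' hf) y
  have hρint : ∀ (S : Set ℝ) {f : ℝ × E → ℝ≥0∞}, Measurable f → ∀ y,
      ρ (fun y => ∫⁻ u in S, f (u, y)) y = ∫⁻ u in S, ρ (fun y => f (u, y)) y := by
    intro S f hf y
    have hs : Measurable fun q : ℝ × Config E => ∑ j, f (q.1, q.2.2 j) := measurable_sum_config hf
    have := M.rateOffspring_lintegral (μ := volume.restrict S) hs y
    simp only [ρ]
    rw [← this]
    congr 1
    funext o
    exact (lintegral_finsetSum Finset.univ (f := fun (j : Fin o.1) u => f (u, o.2 j))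
      fun j _ => hf.comp measurable_prodMk_right).symm
  have hmF : ∀ u, Measurable fun y => meanE M Q n F u y := fun u =>
    measurable_meanE M Q n (hF.comp measurable_snd) measurable_const measurable_id
  -- measurability of `(r, s, y) ↦ meanE n (h (t - s)) (s - r) y`
  have hmh : Measurable fun p : (ℝ × ℝ) × E =>
      meanE M Q n (h (t - p.1.2.toNNReal)) (p.1.2.toNNReal - p.1.1.toNNReal) p.2 :=
    measurable_meanE M Q n (G := fun q : ((ℝ × ℝ) × E) × E => h (t - q.1.1.2.toNNReal) q.2)
      (hh.comp (f := fun q : ((ℝ × ℝ) × E) × E => (t - q.1.1.2.toNNReal, q.2)) (by fun_prop))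
      (by fun_prop) measurable_snd
  set Φ : ℝ → ℝ → ℝ≥0∞ := fun r s => M.killed r.toNNReal
    (ρ fun y => meanE M Q n (h (t - s.toNNReal)) (s.toNNReal - r.toNNReal) y) x with hΦ
  have hΦm : Measurable (Function.uncurry Φ) := by
    have h1 : Measurable fun p : (ℝ × ℝ) × E =>
        ρ (fun y => meanE M Q n (h (t - p.1.2.toNNReal)) (p.1.2.toNNReal - p.1.1.toNNReal) y) p.2 :=
      M.measurable_rateOffspring (α := (ℝ × ℝ) × E) (R := fun p => ∑ j,
          meanE M Q n (h (t - p.1.1.2.toNNReal)) (p.1.1.2.toNNReal - p.1.1.1.toNNReal) (p.2.2 j))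
        (measurable_sum_config (α := (ℝ × ℝ) × E) (G := fun p =>
          meanE M Q n (h (t - p.1.1.2.toNNReal)) (p.1.1.2.toNNReal - p.1.1.1.toNNReal) p.2)
          (hmh.comp (measurable_fst.fst.prodMk measurable_snd))) measurable_snd
    exact M.measurable_killed (α := ℝ × ℝ) h1 (t := fun q => q.1.toNNReal) (by fun_prop)
      (x := fun _ => x) measurable_const
  -- measurability of `(r, u, y) ↦ meanE n (h (t - r - u)) u y`
  have hmu : ∀ v : ℝ≥0, Measurable fun p : ℝ × E => meanE M Q n (h (v - p.1.toNNReal)) p.1.toNNReal p.2 :=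
    fun v => measurable_meanE M Q n (G := fun q : (ℝ × E) × E => h (v - q.1.1.toNNReal) q.2)
      (hh.comp (f := fun q : (ℝ × E) × E => (v - q.1.1.toNNReal, q.2)) (by fun_prop))
      (by fun_prop) measurable_snd
  -- With `s = u + r` the inner integral is the source part of the mild solution for the children
  -- born at age `r`.
  have hinner : ∀ r ∈ Set.Ioc (0 : ℝ) t, ∫⁻ u in Set.Ioc 0 (t - r), Φ r (u + r)
      = M.killed r.toNNReal (ρ fun y => ∫⁻ u in Set.Ioc (0 : ℝ) (t - r.toNNReal : ℝ≥0),
          meanE M Q n (h (t - r.toNNReal - u.toNNReal)) u.toNNReal y) x := by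
    intro r hr
    have hset : Set.Ioc (0 : ℝ) (t - r.toNNReal : ℝ≥0) = Set.Ioc (0 : ℝ) (t - r) := by
      rw [NNReal.coe_sub (Real.toNNReal_le_iff_le_coe.2 hr.2), Real.coe_toNNReal _ hr.1.le]
    rw [hset]
    have e1 : (ρ fun y => ∫⁻ u in Set.Ioc (0 : ℝ) (t - r),
          meanE M Q n (h (t - r.toNNReal - u.toNNReal)) u.toNNReal y)
        = fun y => ∫⁻ u in Set.Ioc (0 : ℝ) (t - r),
          ρ (fun y => meanE M Q n (h (t - r.toNNReal - u.toNNReal)) u.toNNReal y) y := by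
      funext y
      exact hρint _ (hmu (t - r.toNNReal)) y
    rw [e1, M.killed_lintegral (μ := volume.restrict (Set.Ioc (0 : ℝ) (t - r)))
      (hρm (hmu (t - r.toNNReal)))]
    refine setLIntegral_congr_fun measurableSet_Ioc fun u hu => ?_
    simp only [hΦ]
    rw [Real.toNNReal_add hu.1.le hr.1.le, add_tsub_cancel_right, add_comm u.toNNReal,
      tsub_add_eq_tsub_tsub]
  have hsrc : Measurable fun s : ℝ => M.killed s.toNNReal (h (t - s.toNNReal)) x :=
    M.measurable_killed (α := ℝ) hh2 measurable_real_toNNReal measurable_const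
  have hF1 : Measurable fun s : ℝ => M.killed s.toNNReal
      (ρ fun y => meanE M Q n F (t - s.toNNReal) y) x := by
    have hm : Measurable fun q : ℝ × E => meanE M Q n F (t - q.1.toNNReal) q.2 :=
      measurable_meanE M Q n (G := fun q : (ℝ × E) × E => F q.2) (hF.comp measurable_snd)
        (by fun_prop) measurable_snd
    exact M.measurable_killed (α := ℝ) (hρm hm) measurable_real_toNNReal measurable_const
  have lhs : ∫⁻ s in Set.Ioc (0 : ℝ) t, meanE M Q (n + 1) (h (t - s.toNNReal)) s.toNNReal x
      = (∫⁻ s in Set.Ioc (0 : ℝ) t, M.killed s.toNNReal (h (t - s.toNNReal)) x)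
        + ∫⁻ r in Set.Ioc (0 : ℝ) t, M.killed r.toNNReal
          (ρ fun y => ∫⁻ u in Set.Ioc (0 : ℝ) (t - r.toNNReal : ℝ≥0),
            meanE M Q n (h (t - r.toNNReal - u.toNNReal)) u.toNNReal y) x := by
    rw [← setLIntegral_congr_fun measurableSet_Ioc hinner, ← lintegral_triangle hΦm,
      ← lintegral_add_left hsrc]
    refine setLIntegral_congr_fun measurableSet_Ioc fun s hs => ?_
    rw [meanE_succ hQ n (hh1 _), Real.coe_toNNReal _ hs.1.le]
  rw [duhamelE, lhs, meanE_succ hQ n hF, add_assoc]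
  congr 1
  rw [add_left_comm, ← lintegral_add_left hF1, ← lintegral_add_left hsrc]
  refine lintegral_congr fun r => ?_
  have hhm : Measurable (h (t - r.toNNReal)) := hh1 _
  have e2 : ∀ y, M.rateOffspring (fun o => ∑ j, duhamelE M Q n F h (t - r.toNNReal) (o.2 j)) y
      = ρ (fun y => meanE M Q n F (t - r.toNNReal) y) y
        + ρ (fun y => ∫⁻ u in Set.Ioc (0 : ℝ) (t - r.toNNReal : ℝ≥0),
            meanE M Q n (h (t - r.toNNReal - u.toNNReal)) u.toNNReal y) y :=
    fun y => hρadd (f := fun y => meanE M Q n F (t - r.toNNReal) y)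
      (g := fun y => ∫⁻ u in Set.Ioc (0 : ℝ) (t - r.toNNReal : ℝ≥0),
        meanE M Q n (h (t - r.toNNReal - u.toNNReal)) u.toNNReal y) (hmF _) y
  simp_rw [e2, add_comm _ (h (t - r.toNNReal) _)]
  have hρF : Measurable (ρ fun y => meanE M Q n F (t - r.toNNReal) y) :=
    (hρm (f := fun q => meanE M Q n F (t - r.toNNReal) q.2) ((hmF _).comp measurable_snd)).comp
      (measurable_prodMk_left (x := (0 : ℝ)))
  rw [M.killed_add hhm, M.killed_add hρF]

/-- The evolution equation for the moments of nonnegative functions. -/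
theorem momentE_evolution [IsMarkovKernel Q] (hQ : M.IsTreeLaw Q) {l : ℕ}
    {F : Fin l → E → ℝ≥0∞} (hF : ∀ i, Measurable (F i)) (t : ℝ≥0) {A : Finset (Fin l)}
    (hA : A.Nonempty) (x : E) :
    momentE M Q ⊤ F t A x = meanE M Q ⊤ (fun y => ∏ i ∈ A, F i y) t x
      + ∫⁻ s in Set.Ioc (0 : ℝ) t, meanE M Q ⊤
          (M.rateOffspring (zetaSum A fun b => momentE M Q ⊤ F (t - s.toNNReal) b)) s.toNNReal x := by
  set h : ℝ≥0 → E → ℝ≥0∞ := fun u =>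
    M.rateOffspring (zetaSum A fun b => momentE M Q ⊤ F u b) with hh
  have hzm : ∀ n, Measurable fun q : ℝ≥0 × Config E =>
      zetaSum A (fun b => momentE M Q n F q.1 b) q.2 := fun n =>
    measurable_zetaSum A (g := fun u b => momentE M Q n F u b) fun b _ _ =>
      measurable_momentE M Q n hF b measurable_fst measurable_snd
  have hhm : Measurable (Function.uncurry h) :=
    M.measurable_rateOffspring (α := ℝ≥0 × E)
      (R := fun p => zetaSum A (fun b => momentE M Q ⊤ F p.1.1 b) p.2)
      ((hzm ⊤).comp (f := fun p : (ℝ≥0 × E) × Config E => (p.1.1, p.2))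
        (measurable_fst.fst.prodMk measurable_snd)) measurable_snd
  have hFm : Measurable fun y => ∏ i ∈ A, F i y := Finset.measurable_fun_prod _ fun i _ => hF i
  have hsm : ∀ n u, Measurable fun o : Config E => ∑ j, momentE M Q n F u A (o.2 j) := fun n u =>
    measurable_sum_config' (G := momentE M Q n F u A)
      (measurable_momentE M Q n hF A measurable_const measurable_id)
  have hsplit : ∀ n u y, M.rateOffspring (fun o => ∑ j, momentE M Q n F u A (o.2 j)
      + zetaSum A (fun b => momentE M Q n F u b) o) y
      = M.rateOffspring (fun o => ∑ j, momentE M Q n F u A (o.2 j)) y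
        + M.rateOffspring (zetaSum A (fun b => momentE M Q n F u b)) y := fun n u y =>
    M.rateOffspring_add (hsm n u) y
  have hzmono : ∀ (n : ℕ∞) u o, zetaSum A (fun b => momentE M Q n F u b) o
      ≤ zetaSum A (fun b => momentE M Q ⊤ F u b) o := fun n u o =>
    Finset.sum_le_sum fun σ _ => Finset.sum_le_sum fun i _ => Finset.prod_le_prod' fun b _ =>
      momentE_mono le_top hF u _ _
  -- A comparison in both directions replaces uniqueness: truncated mild solutions stay below the
  -- full moment, and, in `hUV`, truncated moments stay below the full mild solution.
  have hVU : ∀ (n : ℕ) t x, duhamelE M Q n (fun y => ∏ i ∈ A, F i y) h t x ≤ momentE M Q ⊤ F t A x := by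
    intro n
    induction n with
    | zero =>
      intro t x
      have hz : ∀ {G : E → ℝ≥0∞}, Measurable G → ∀ u x, meanE M Q ((0 : ℕ) : ℕ∞) G u x = 0 := by
        intro G hG u x
        simp [meanE, M.pop_zero hG]
      have hz' : ∀ s : ℝ, meanE M Q ((0 : ℕ) : ℕ∞) (h (t - s.toNNReal)) s.toNNReal x = 0 :=
        fun s => hz (hhm.comp measurable_prodMk_left) _ _
      rw [duhamelE, hz hFm]
      simp_rw [hz']
      simp
    | succ n ih =>
      intro t x
      push_cast
      -- Since `⊤ + 1 = ⊤`, the full moment is a fixed point of the recursion.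
      rw [duhamelE_succ hQ n hFm hhm, ← top_add (1 : ℕ∞), momentE_succ hQ ⊤ hF t hA]
      refine add_le_add le_rfl (lintegral_mono fun s => M.killed_mono (fun y => ?_) _ _)
      rw [hsplit]
      refine add_le_add (M.rateOffspring_mono (fun o => ?_) y) le_rfl
      exact Finset.sum_le_sum fun j _ => ih _ _
  have hUV : ∀ (n : ℕ) t x, momentE M Q n F t A x ≤ duhamelE M Q ⊤ (fun y => ∏ i ∈ A, F i y) h t x := by
    intro n
    induction n with
    | zero =>
      intro t x
      -- Nonemptiness starts the induction: the empty product would be `1`, not `0`.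
      obtain ⟨i, hi⟩ := hA
      have : ∀ τ, ∏ i ∈ A, M.pop 0 (F i) t τ = 0 := fun τ =>
        Finset.prod_eq_zero hi (M.pop_zero (hF i) t τ)
      simp [momentE, this]
    | succ n ih =>
      intro t x
      push_cast
      rw [momentE_succ hQ n hF t hA, ← top_add (1 : ℕ∞), duhamelE_succ hQ ⊤ hFm hhm]
      refine add_le_add le_rfl (lintegral_mono fun s => M.killed_mono (fun y => ?_) _ _)
      rw [hsplit]
      refine add_le_add (M.rateOffspring_mono (fun o => ?_) y)
        (M.rateOffspring_mono (fun o => hzmono _ _ o) y)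
      exact Finset.sum_le_sum fun j _ => ih _ _
  refine le_antisymm ?_ ?_
  · rw [← iSup_momentE hF]
    exact iSup_le fun n => hUV n t x
  -- Monotone convergence in the truncation level, both in the mean and under the time integral.
  · have hlim : duhamelE M Q ⊤ (fun y => ∏ i ∈ A, F i y) h t x
        ≤ ⨆ n : ℕ, duhamelE M Q n (fun y => ∏ i ∈ A, F i y) h t x := by
      have hu : ∀ u, Measurable (h u) := fun u => hhm.comp measurable_prodMk_left
      have hm1 : Monotone fun n : ℕ => meanE M Q n (fun y => ∏ i ∈ A, F i y) t x :=
        fun m n hmn => meanE_mono (by exact_mod_cast hmn) hFm t x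
      have hm2 : Monotone fun (n : ℕ) (s : ℝ) => meanE M Q n (h (t - s.toNNReal)) s.toNNReal x :=
        fun m n hmn s => meanE_mono (by exact_mod_cast hmn) (hu _) _ x
      unfold duhamelE
      rw [← iSup_meanE hFm]
      simp_rw [← iSup_meanE (hu _)]
      rw [lintegral_iSup _ hm2]
      · rw [ENNReal.iSup_add_iSup_of_monotone hm1 fun m n hmn => lintegral_mono (hm2 hmn)]
      · intro n
        exact measurable_meanE M Q n (G := fun q : ℝ × E => h (t - q.1.toNNReal) q.2)
          (hhm.comp (f := fun q : ℝ × E => (t - q.1.toNNReal, q.2)) (by fun_prop))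
          (by fun_prop) measurable_const
    exact hlim.trans (iSup_le fun n => hVU n t x)

end Moments

/-! ### Growth of the moments of the population size. -/

theorem sum_pow_le_card_pow_mul_sum_pow {n k : ℕ} (hk : 1 ≤ k) (a : Fin n → ℝ≥0∞) :
    (∑ j, a j) ^ k ≤ (n : ℝ≥0∞) ^ (k - 1) * ∑ j, a j ^ k := by
  have h := ENNReal.rpow_sum_le_const_mul_sum_rpow Finset.univ a (p := k) (by exact_mod_cast hk)
  have e : (k : ℝ) - 1 = ((k - 1 : ℕ) : ℝ) := by push_cast [hk]; ring
  rw [e] at h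
  simpa only [ENNReal.rpow_natCast, Finset.card_univ, Fintype.card_fin] using h

theorem lintegral_exp_growth (c t : ℝ≥0) :
    ∫⁻ s in Set.Ioc (0 : ℝ) t, ENNReal.ofReal (c * Real.exp (c * (t - s.toNNReal : ℝ≥0)))
      = ENNReal.ofReal (Real.exp (c * t) - 1) := by
  have h : ∫ s in (0 : ℝ)..t, (c : ℝ) * Real.exp (c * (t - s)) = Real.exp (c * t) - 1 := by
    have hd : ∀ s ∈ Set.uIcc (0 : ℝ) t, HasDerivAt (fun s => -Real.exp (c * (t - s)))
        (c * Real.exp (c * (t - s))) s := by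
      intro s _
      have := ((((hasDerivAt_id s).const_sub (t : ℝ)).const_mul (c : ℝ)).exp).neg
      refine this.congr_deriv ?_
      simp only [id_eq]
      ring
    rw [intervalIntegral.integral_eq_sub_of_hasDerivAt hd
      ((by fun_prop : Continuous _).intervalIntegrable _ _)]
    simp
    ring
  rw [← h, intervalIntegral.integral_of_le t.coe_nonneg, ofReal_integral_eq_lintegral_ofReal]
  · refine setLIntegral_congr_fun measurableSet_Ioc fun s hs => ?_
    simp only [NNReal.coe_sub (Real.toNNReal_le_iff_le_coe.2 hs.2), Real.coe_toNNReal _ hs.1.le]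
  · exact ((by fun_prop : Continuous fun s : ℝ => (c : ℝ) * Real.exp (c * (t - s))).integrableOn_Ioc)
  · exact Eventually.of_forall fun s => by positivity

section MomentBound

variable {E Ξ : Type*} [MeasurableSpace E] [MeasurableSpace Ξ] {M : BranchingModel E Ξ}
  {Q : Kernel E (Tree E Ξ)}

theorem BranchingModel.killed_le {F : E → ℝ≥0∞} {C : ℝ≥0∞} (h : ∀ y, F y ≤ C) (t : ℝ≥0) (x : E) :
    M.killed t F x ≤ C := by
  calc M.killed t F x ≤ ∫⁻ _, C ∂(M.motion.law (Sum.inl x)) := by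
        refine lintegral_mono fun w => ?_
        calc _ ≤ 1 * C := by
              refine mul_le_mul' (M.survival_le_one w t) ?_
              cases M.motion.path t w with
              | inl y => exact h y
              | inr _ => exact zero_le
          _ = C := one_mul C
    _ = C := by simp

/-- Exponential growth of the moments of the population size. -/
theorem lintegral_pop_one_pow_le [IsMarkovKernel Q] (hQ : M.IsTreeLaw Q) {k : ℕ} (hk : 1 ≤ k)
    {K : ℝ≥0} (hK : ∀ x, ∫⁻ o, (o.1 : ℝ≥0∞) ^ k ∂(M.offspring x) ≤ K) (n : ℕ) (t : ℝ≥0) (x : E) :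
    ∫⁻ τ, M.pop n (fun _ => 1) t τ ^ k ∂(Q x)
      ≤ ENNReal.ofReal (Real.exp ((M.rateBound * K : ℝ≥0) * t)) := by
  induction n generalizing t x with
  | zero =>
    have : ∀ τ : Tree E Ξ, M.pop ((0 : ℕ) : ℕ∞) (fun _ => 1) t τ = 0 := fun τ =>
      M.pop_zero measurable_const t τ
    simp only [this, zero_pow (Nat.one_le_iff_ne_zero.1 hk)]
    simp
  | succ n ih =>
    -- With this rate the recursion closes, because `1 + ∫₀ᵗ c e^{c(t-s)} ds = e^{ct}`.
    set c : ℝ≥0 := M.rateBound * K with hc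
    have hpm : Measurable fun q : ℝ≥0 × Tree E Ξ => M.pop n (fun _ => 1) q.1 q.2 :=
      M.measurable_pop' n measurable_const measurable_fst measurable_snd
    set R : ℝ≥0 × Config (Tree E Ξ) → ℝ≥0∞ := fun q => (∑ j, M.pop n (fun _ => 1) q.1 (q.2.2 j)) ^ k
      with hR
    have hRm : Measurable R := (measurable_sum_config hpm).pow_const k
    have e1 : ∫⁻ τ, M.pop ((n + 1 : ℕ) : ℕ∞) (fun _ => 1) t τ ^ k ∂(Q x)
        = ∫⁻ τ, (if (t : ℝ≥0∞) < M.branchAge (τ []).1 (τ []).2.1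
        then Sum.elim (fun _ => 1) (fun _ => 0) (M.motion.path t (τ []).1)
        else R (t - (M.branchAge (τ []).1 (τ []).2.1).toNNReal, children τ)) ∂(Q x) := by
      refine lintegral_congr fun τ => ?_
      push_cast
      rw [M.pop_succ n measurable_const]
      split_ifs with h
      · cases M.motion.path t (τ []).1 with
        | inl y => exact one_pow k
        | inr _ => exact zero_pow (Nat.one_le_iff_ne_zero.1 hk)
      · rfl
    rw [e1, hQ.lintegral_first_branching x t measurable_const hRm]
    have hbd : ∀ s : ℝ, M.killed s.toNNReal (M.rateOffspring fun o =>
        ∫⁻ c, R (t - s.toNNReal, c) ∂(childKernel Q o)) x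
        ≤ ENNReal.ofReal (c * Real.exp (c * (t - s.toNNReal : ℝ≥0))) := by
      intro s
      refine BranchingModel.killed_le (fun y => ?_) _ _
      set u := t - s.toNNReal
      have hpu : Measurable fun τ : Tree E Ξ => M.pop n (fun _ => 1) u τ ^ k :=
        (M.measurable_pop' n measurable_const measurable_const measurable_id).pow_const k
      -- Convexity of the `k`-th power costs `N^{k-1}` and the sum over the children another `N`, so
      -- the offspring moment of order `k` is what is needed.
      have hchild : ∀ o : Config E, ∫⁻ c, R (u, c) ∂(childKernel Q o)
          ≤ (o.1 : ℝ≥0∞) ^ k * ENNReal.ofReal (Real.exp (c * u)) := by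
        intro o
        have hRu : Measurable fun c => R (u, c) := hRm.comp measurable_prodMk_left
        calc ∫⁻ c, R (u, c) ∂(childKernel Q o)
            = ∫⁻ v : Fin o.1 → Tree E Ξ, (∑ j, M.pop n (fun _ => 1) u (v j)) ^ k
                ∂(Measure.pi fun i => Q (o.2 i)) := lintegral_childKernel Q o hRu
          _ ≤ ∫⁻ v : Fin o.1 → Tree E Ξ, (o.1 : ℝ≥0∞) ^ (k - 1) *
                ∑ j, M.pop n (fun _ => 1) u (v j) ^ k ∂(Measure.pi fun i => Q (o.2 i)) :=
              lintegral_mono fun v => sum_pow_le_card_pow_mul_sum_pow hk _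
          _ = (o.1 : ℝ≥0∞) ^ (k - 1) *
                ∑ j, ∫⁻ τ, M.pop n (fun _ => 1) u τ ^ k ∂(Q (o.2 j)) := by
              have hsm : Measurable fun v : Fin o.1 → Tree E Ξ =>
                  ∑ j, M.pop n (fun _ => 1) u (v j) ^ k :=
                Finset.measurable_fun_sum _ fun j _ => hpu.comp (measurable_pi_apply j)
              rw [lintegral_const_mul _ hsm, ← lintegral_childKernel_sum Q o hpu,
                lintegral_childKernel Q o (measurable_sum_config' hpu)]
          _ ≤ (o.1 : ℝ≥0∞) ^ (k - 1) * ∑ j : Fin o.1, ENNReal.ofReal (Real.exp (c * u)) := by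
              gcongr with j _
              exact ih u (o.2 j)
          _ = (o.1 : ℝ≥0∞) ^ k * ENNReal.ofReal (Real.exp (c * u)) := by
              rw [Finset.sum_const, Finset.card_univ, Fintype.card_fin, nsmul_eq_mul, ← mul_assoc,
                ← pow_succ, Nat.sub_add_cancel hk]
      calc M.rateOffspring (fun o => ∫⁻ c, R (u, c) ∂(childKernel Q o)) y
          ≤ M.rateOffspring (fun o => (o.1 : ℝ≥0∞) ^ k * ENNReal.ofReal (Real.exp (c * u))) y :=
            M.rateOffspring_mono hchild y
        _ = M.rate y * ((∫⁻ o, (o.1 : ℝ≥0∞) ^ k ∂(M.offspring y))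
              * ENNReal.ofReal (Real.exp (c * u))) := by
            rw [BranchingModel.rateOffspring, lintegral_mul_const]
            exact (measurable_from_nat.comp measurable_config_fst).pow_const k
        _ ≤ M.rateBound * (K * ENNReal.ofReal (Real.exp (c * u))) := by
            gcongr
            · exact M.rate_le y
            · exact hK y
        _ = ENNReal.ofReal (c * Real.exp (c * u)) := by
            rw [ENNReal.ofReal_mul (NNReal.coe_nonneg _), ENNReal.ofReal_coe_nnreal, hc,
              ENNReal.coe_mul, mul_assoc]
    calc _ ≤ 1 + ∫⁻ s in Set.Ioc (0 : ℝ) t,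
          ENNReal.ofReal (c * Real.exp (c * (t - s.toNNReal : ℝ≥0))) :=
          add_le_add (BranchingModel.killed_le (fun _ => le_rfl) _ _) (lintegral_mono hbd)
      _ = ENNReal.ofReal (Real.exp (c * t)) := by
          rw [lintegral_exp_growth, ← ENNReal.ofReal_one, ← ENNReal.ofReal_add zero_le_one]
          · congr 1; ring
          · rw [sub_nonneg]; exact Real.one_le_exp (by positivity)

theorem lintegral_X_univ_pow_le [IsMarkovKernel Q] (hQ : M.IsTreeLaw Q) {k : ℕ} (hk : 1 ≤ k)
    {K : ℝ≥0} (hK : ∀ x, ∫⁻ o, (o.1 : ℝ≥0∞) ^ k ∂(M.offspring x) ≤ K) (t : ℝ≥0) (x : E) :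
    ∫⁻ τ, M.X t τ Set.univ ^ k ∂(Q x)
      ≤ ENNReal.ofReal (Real.exp ((M.rateBound * K : ℝ≥0) * t)) := by
  have h := iSup_momentE (M := M) (Q := Q) (F := fun (_ : Fin k) (_ : E) => 1)
    (fun _ => measurable_const) t Finset.univ x
  simp only [momentE, Finset.prod_const, Finset.card_univ, Fintype.card_fin, M.pop_top,
    lintegral_one] at h
  rw [← h]
  exact iSup_le fun n => lintegral_pop_one_pow_le hQ hk hK n t x

variable (M) in
/-- A bound for the growth of the moments up to order `k`, given a bound `K` for the `k`-th moment
of the offspring number. -/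
noncomputable def growth (K t : ℝ≥0) : ℝ := 1 + Real.exp ((M.rateBound * K : ℝ≥0) * t)

theorem growth_pos (K t : ℝ≥0) : 0 < growth M K t := by
  unfold growth; positivity

theorem growth_mono (K : ℝ≥0) {s t : ℝ≥0} (h : s ≤ t) : growth M K s ≤ growth M K t := by
  unfold growth; gcongr

theorem lintegral_X_univ_pow_le_growth [IsMarkovKernel Q] (hQ : M.IsTreeLaw Q) {k : ℕ} (hk : 1 ≤ k)
    {K : ℝ≥0} (hK : ∀ x, ∫⁻ o, (o.1 : ℝ≥0∞) ^ k ∂(M.offspring x) ≤ K) {j : ℕ} (hj : j ≤ k)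
    (t : ℝ≥0) (x : E) :
    ∫⁻ τ, M.X t τ Set.univ ^ j ∂(Q x) ≤ ENNReal.ofReal (growth M K t) := by
  -- This lets one bound serve all orders up to `k`.
  have hle : ∀ a : ℝ≥0∞, a ^ j ≤ 1 + a ^ k := fun a => by
    rcases le_total a 1 with h | h
    · exact (pow_le_one' h j).trans le_self_add
    · exact (pow_le_pow_right₀ h hj).trans le_add_self
  calc _ ≤ ∫⁻ τ, (1 + M.X t τ Set.univ ^ k) ∂(Q x) := lintegral_mono fun τ => hle _
    _ = 1 + ∫⁻ τ, M.X t τ Set.univ ^ k ∂(Q x) := by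
        rw [lintegral_add_left measurable_const]; simp
    _ ≤ 1 + ENNReal.ofReal (Real.exp ((M.rateBound * K : ℝ≥0) * t)) :=
        add_le_add le_rfl (lintegral_X_univ_pow_le hQ hk hK t x)
    _ = _ := by
        rw [growth, ENNReal.ofReal_add zero_le_one (Real.exp_pos _).le, ENNReal.ofReal_one]

/-- Bounded functions are integrable against a finite population, so this is what makes `f ↦ X_t[f]`
almost surely linear. -/
theorem ae_isFiniteMeasure_X [IsMarkovKernel Q] (hQ : M.IsTreeLaw Q) {k : ℕ} (hk : 1 ≤ k)
    {K : ℝ≥0} (hK : ∀ x, ∫⁻ o, (o.1 : ℝ≥0∞) ^ k ∂(M.offspring x) ≤ K) (t : ℝ≥0) (x : E) :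
    ∀ᵐ τ ∂(Q x), IsFiniteMeasure (M.X t τ) := by
  have h := lintegral_X_univ_pow_le_growth hQ hk hK hk t x
  simp only [pow_one] at h
  have hm : Measurable fun τ : Tree E Ξ => M.X t τ Set.univ := by
    have := M.measurable_pop' (α := Tree E Ξ) (t := fun _ => t) ⊤ (G := fun _ => 1) measurable_const
      measurable_const measurable_id
    simpa only [M.pop_top, lintegral_one, id] using this
  filter_upwards [ae_lt_top hm (h.trans_lt ENNReal.ofReal_lt_top).ne] with τ hτ
  exact ⟨hτ⟩

end MomentBound

/-! ### Moments of complex functions. -/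

section Complex

variable {E Ξ : Type*} [MeasurableSpace E] [MeasurableSpace Ξ] (M : BranchingModel E Ξ)
  (Q : Kernel E (Tree E Ξ))

/-- `X_t[f]` for a complex function `f`. -/
noncomputable def BranchingModel.linearStat (t : ℝ≥0) (f : E → ℂ) (τ : Tree E Ξ) : ℂ :=
  ∫ y, f y ∂(M.X t τ)

variable {M Q}

theorem measurable_linearStat {α : Type*} [MeasurableSpace α] {G : α × E → ℂ} (hG : Measurable G)
    {t : α → ℝ≥0} (ht : Measurable t) {τ : α → Tree E Ξ} (hτ : Measurable τ) :
    Measurable fun a => M.linearStat (t a) (fun y => G (a, y)) (τ a) := by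
  have h := hG.stronglyMeasurable.integral_kernel_prod_right'
    (κ := (M.popKernel ⊤).comap (fun a => (t a, τ a)) (ht.prodMk hτ))
  simp only [Kernel.comap_apply, M.popKernel_top] at h
  exact h.measurable

theorem enorm_linearStat_le {f : E → ℂ} {R : ℝ} (hf : ∀ y, ‖f y‖ ≤ R) (t : ℝ≥0) (τ : Tree E Ξ) :
    ‖M.linearStat t f τ‖ₑ ≤ ENNReal.ofReal R * M.X t τ Set.univ := by
  calc ‖M.linearStat t f τ‖ₑ ≤ ∫⁻ y, ‖f y‖ₑ ∂(M.X t τ) := enorm_integral_le_lintegral_enorm _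
    _ ≤ ∫⁻ _, ENNReal.ofReal R ∂(M.X t τ) := lintegral_mono fun y => by
        rw [← ofReal_norm]; exact ENNReal.ofReal_le_ofReal (hf y)
    _ = _ := by rw [lintegral_const]

theorem psi_eq (t : ℝ≥0) (f : E → ℂ) (x : E) : psi M Q t f x = ∫ τ, M.linearStat t f τ ∂(Q x) := rfl

theorem psiMoment_eq {l : ℕ} (t : ℝ≥0) (f : Fin l → B E) (A : Finset (Fin l)) (x : E) :
    psiMoment M Q t f A x = ∫ τ, ∏ i ∈ A, M.linearStat t (f i : E → ℂ) τ ∂(Q x) := rfl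

theorem psiMoment_singleton {l : ℕ} (t : ℝ≥0) (f : Fin l → B E) (i : Fin l) (x : E) :
    psiMoment M Q t f {i} x = psi M Q t (f i : E → ℂ) x := by
  simp [psiMoment, psi]

theorem measurable_psi [IsMarkovKernel Q] {α : Type*} [MeasurableSpace α] {G : α × E → ℂ}
    (hG : Measurable G) {t : α → ℝ≥0} (ht : Measurable t) {x : α → E} (hx : Measurable x) :
    Measurable fun a => psi M Q (t a) (fun y => G (a, y)) (x a) := by
  have h : Measurable fun q : α × Tree E Ξ => M.linearStat (t q.1) (fun y => G (q.1, y)) q.2 :=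
    measurable_linearStat (G := fun p : (α × Tree E Ξ) × E => G (p.1.1, p.2))
      (hG.comp (measurable_fst.fst.prodMk measurable_snd)) (ht.comp measurable_fst) measurable_snd
  exact (h.stronglyMeasurable.integral_kernel_prod_right' (κ := Q.comap x hx)).measurable

theorem measurable_psiMoment [IsMarkovKernel Q] {l : ℕ} (f : Fin l → B E) (A : Finset (Fin l))
    {α : Type*} [MeasurableSpace α] {t : α → ℝ≥0} (ht : Measurable t) {x : α → E}
    (hx : Measurable x) : Measurable fun a => psiMoment M Q (t a) f A (x a) := by
  have h : Measurable fun q : α × Tree E Ξ =>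
      ∏ i ∈ A, M.linearStat (t q.1) (f i : E → ℂ) q.2 :=
    Finset.measurable_fun_prod _ fun i _ => measurable_linearStat
      (G := fun p : (α × Tree E Ξ) × E => (f i : E → ℂ) p.2) ((f i).2.1.comp measurable_snd)
      (ht.comp measurable_fst) measurable_snd
  exact (h.stronglyMeasurable.integral_kernel_prod_right' (κ := Q.comap x hx)).measurable

theorem psi_const_mul (g : E → ℂ) (c : ℂ) (t : ℝ≥0) (x : E) :
    psi M Q t (fun y => c * g y) x = c * psi M Q t g x := by
  simp only [psi_eq, BranchingModel.linearStat, integral_const_mul]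

section Bounds

variable [IsMarkovKernel Q] (hQ : M.IsTreeLaw Q) {k : ℕ} (hk : 1 ≤ k)
    {K : ℝ≥0} (hK : ∀ x, ∫⁻ o, (o.1 : ℝ≥0∞) ^ k ∂(M.offspring x) ≤ K)

include hQ hk hK

/-- Each factor is at most `R` times the population size, whose moments up to order `k` are
controlled by `growth`. -/
theorem lintegral_prod_linearStat_le {l : ℕ} {A : Finset (Fin l)} (hA : A.card ≤ k)
    {f : Fin l → E → ℂ} {R : ℝ} (hR : 0 ≤ R) (hf : ∀ i, ∀ y, ‖f i y‖ ≤ R) (t : ℝ≥0) (x : E) :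
    ∫⁻ τ, ‖∏ i ∈ A, M.linearStat t (f i) τ‖ₑ ∂(Q x)
      ≤ ENNReal.ofReal (R ^ A.card * growth M K t) := by
  calc _ ≤ ∫⁻ τ, ENNReal.ofReal R ^ A.card * M.X t τ Set.univ ^ A.card ∂(Q x) := by
        refine lintegral_mono fun τ => ?_
        rw [← mul_pow, ← ofReal_norm, norm_prod,
          ENNReal.ofReal_prod_of_nonneg fun i _ => norm_nonneg _]
        refine Finset.prod_le_pow_card _ _ _ fun i _ => ?_
        rw [ofReal_norm]
        exact enorm_linearStat_le (hf i) t τ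
    _ ≤ ENNReal.ofReal R ^ A.card * ENNReal.ofReal (growth M K t) := by
        rw [lintegral_const_mul' _ _ (ENNReal.pow_ne_top ENNReal.ofReal_ne_top)]
        gcongr
        exact lintegral_X_univ_pow_le_growth hQ hk hK hA t x
    _ = _ := by rw [← ENNReal.ofReal_pow hR, ← ENNReal.ofReal_mul (by positivity)]

theorem integrable_prod_linearStat {l : ℕ} {A : Finset (Fin l)} (hA : A.card ≤ k)
    (f : Fin l → B E) (t : ℝ≥0) (x : E) :
    Integrable (fun τ => ∏ i ∈ A, M.linearStat t (f i : E → ℂ) τ) (Q x) := by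
  choose C hC using fun i => (f i).2.2
  have hR : ∀ i, ∀ y, ‖(f i : E → ℂ) y‖ ≤ ∑ j, |C j| := fun i y =>
    (hC i y).trans ((le_abs_self _).trans
      (Finset.single_le_sum (f := fun j => |C j|) (fun j _ => abs_nonneg _) (Finset.mem_univ i)))
  refine ⟨?_, (lintegral_prod_linearStat_le hQ hk hK hA
    (Finset.sum_nonneg fun j _ => abs_nonneg _) hR t x).trans_lt ENNReal.ofReal_lt_top⟩
  exact (Finset.measurable_fun_prod _ fun i _ => measurable_linearStat
    (G := fun p : Tree E Ξ × E => (f i : E → ℂ) p.2) ((f i).2.1.comp measurable_snd)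
    measurable_const measurable_id).aestronglyMeasurable

theorem norm_psiMoment_le {l : ℕ} {A : Finset (Fin l)} (hA : A.card ≤ k)
    {f : Fin l → B E} {R : ℝ} (hR : 0 ≤ R) (hf : ∀ i, ∀ y, ‖(f i : E → ℂ) y‖ ≤ R) (t : ℝ≥0) (x : E) :
    ‖psiMoment M Q t f A x‖ ≤ R ^ A.card * growth M K t := by
  have h := lintegral_prod_linearStat_le hQ hk hK hA hR hf t x
  have h2 : ‖psiMoment M Q t f A x‖ₑ ≤ ENNReal.ofReal (R ^ A.card * growth M K t) :=
    (enorm_integral_le_lintegral_enorm _).trans h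
  rw [← ofReal_norm] at h2
  exact (ENNReal.ofReal_le_ofReal_iff (mul_nonneg (pow_nonneg hR _) (growth_pos K t).le)).1 h2

theorem integrable_linearStat {g : E → ℂ} (hg : g ∈ B E) (t : ℝ≥0) (x : E) :
    Integrable (M.linearStat t g) (Q x) := by
  simpa using integrable_prod_linearStat hQ hk hK (l := 1) (A := {0}) (by simpa using hk)
    (fun _ => ⟨g, hg⟩) t x

theorem norm_psi_le {g : E → ℂ} (hgm : Measurable g) {R : ℝ} (hR : 0 ≤ R) (hg : ∀ y, ‖g y‖ ≤ R) (t : ℝ≥0) (x : E) :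
    ‖psi M Q t g x‖ ≤ R * growth M K t := by
  have := norm_psiMoment_le hQ hk hK (l := 1) (A := {0}) (by simpa using hk)
    (f := fun _ => ⟨g, hgm, R, hg⟩) hR (fun _ => hg) t x
  rw [psiMoment_singleton] at this
  simpa using this

theorem linearStat_lin {g h : E → ℂ} (hg : g ∈ B E) (hh : h ∈ B E) (c : ℂ) (t : ℝ≥0) (x : E) :
    ∀ᵐ τ ∂(Q x), M.linearStat t (fun y => c * g y + h y) τ
      = c * M.linearStat t g τ + M.linearStat t h τ := by
  filter_upwards [ae_isFiniteMeasure_X hQ hk hK t x] with τ hτ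
  have hi : ∀ {g : E → ℂ}, g ∈ B E → Integrable g (M.X t τ) := fun {g} hg => by
    obtain ⟨hgm, R, hR⟩ := hg
    exact Integrable.of_bound hgm.aestronglyMeasurable R (Eventually.of_forall hR)
  unfold BranchingModel.linearStat
  rw [integral_add ((hi hg).const_mul c) (hi hh), integral_const_mul]

theorem psi_lin {g h : E → ℂ} (hg : g ∈ B E) (hh : h ∈ B E) (c : ℂ) (t : ℝ≥0) (x : E) :
    psi M Q t (fun y => c * g y + h y) x = c * psi M Q t g x + psi M Q t h x := by
  simp only [psi_eq]
  rw [integral_congr_ae (linearStat_lin hQ hk hK hg hh c t x),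
    integral_add ((integrable_linearStat hQ hk hK hg t x).const_mul c)
      (integrable_linearStat hQ hk hK hh t x), integral_const_mul]

theorem psi_sub {g h : E → ℂ} (hg : g ∈ B E) (hh : h ∈ B E) (t : ℝ≥0) (x : E) :
    psi M Q t (fun y => g y - h y) x = psi M Q t g x - psi M Q t h x := by
  have := psi_lin hQ hk hK hh hg (-1) t x
  simp only [neg_mul, one_mul, neg_add_eq_sub] at this
  exact this

end Bounds

end Complex

/-! ### Estimates for the sum over partitions. -/

section ZetaSum

variable {E : Type*} {l : ℕ} {A : Finset (Fin l)}

/-- A bound for the number of the summands of `zetaSum`. -/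
theorem sum_card_embedding_le {k : ℕ} (hA : A.card ≤ k) (n : ℕ) :
    ∑ σ : Finpartition A with σ.parts ≠ {A}, Fintype.card (σ.parts ↪ Fin n)
      ≤ Fintype.card (Finpartition A) * (1 + n ^ k) := by
  calc _ ≤ ∑ σ : Finpartition A with σ.parts ≠ {A}, (1 + n ^ k) := by
        refine Finset.sum_le_sum fun σ _ => ?_
        have hc : σ.parts.card ≤ k := σ.card_parts_le_card.trans hA
        rw [Fintype.card_embedding_eq, Fintype.card_fin, Fintype.card_coe]
        refine (Nat.descFactorial_le_pow _ _).trans ?_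
        rcases Nat.eq_zero_or_pos n with h | h
        · subst h
          rcases Nat.eq_zero_or_pos σ.parts.card with h0 | h0
          · simp [h0]
          · simp [zero_pow h0.ne']
        · exact (Nat.pow_le_pow_right h hc).trans (Nat.le_add_left _ _)
    _ = (Finset.univ.filter fun σ : Finpartition A => σ.parts ≠ {A}).card * (1 + n ^ k) := by
        rw [Finset.sum_const, smul_eq_mul]
    _ ≤ _ := Nat.mul_le_mul_right _ (Finset.card_le_univ _)

theorem prod_parts_pow {R : Type*} [CommMonoid R] (σ : Finpartition A) (v : R) :
    ∏ b : σ.parts, v ^ b.1.card = v ^ A.card := by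
  rw [Finset.prod_coe_sort σ.parts fun b => v ^ b.card, Finset.prod_pow_eq_pow_sum,
    σ.sum_card_parts]

/-- The block sizes add up to `|A|`, so the factors `v ^ |b|` multiply to `v ^ |A|` for every
partition; there are at most `|A|` blocks, hence at most that many factors `D`. -/
theorem zetaSum_le {k : ℕ} (hA : A.card ≤ k) {g : Finset (Fin l) → E → ℝ≥0∞} {D v : ℝ≥0∞}
    (hD : 1 ≤ D) (hg : ∀ b ⊂ A, b.Nonempty → ∀ y, g b y ≤ D * v ^ b.card) (o : Config E) :
    zetaSum A g o ≤ (Fintype.card (Finpartition A) * (1 + o.1 ^ k) : ℝ≥0∞)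
      * (D ^ A.card * v ^ A.card) := by
  calc zetaSum A g o ≤ ∑ σ : Finpartition A with σ.parts ≠ {A}, ∑ _i : σ.parts ↪ Fin o.1,
        (D ^ A.card * v ^ A.card) := by
        refine Finset.sum_le_sum fun σ hσ => Finset.sum_le_sum fun i _ => ?_
        have hσ' : σ.parts ≠ {A} := (Finset.mem_filter.1 hσ).2
        calc _ ≤ ∏ b : σ.parts, D * v ^ b.1.card := Finset.prod_le_prod' fun b _ =>
              hg b (ssubset_of_mem_parts hσ' b.2) (σ.nonempty_of_mem_parts b.2) _
          _ = D ^ σ.parts.card * v ^ A.card := by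
              rw [Finset.prod_mul_distrib, prod_parts_pow, Finset.prod_const, Finset.card_univ,
                Fintype.card_coe]
          _ ≤ _ := by gcongr; exact σ.card_parts_le_card
    _ = ((∑ σ : Finpartition A with σ.parts ≠ {A}, Fintype.card (σ.parts ↪ Fin o.1) : ℕ) : ℝ≥0∞)
        * (D ^ A.card * v ^ A.card) := by
        simp only [Finset.sum_const, nsmul_eq_mul, Finset.card_univ, Nat.cast_sum,
          Finset.sum_mul]
    _ ≤ _ := by
        gcongr
        exact_mod_cast sum_card_embedding_le hA o.1

theorem enorm_zetaSum_le (g : Finset (Fin l) → E → ℂ) (o : Config E) :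
    ‖zetaSum A g o‖ₑ ≤ zetaSum A (fun b y => ‖g b y‖ₑ) o := by
  refine (enorm_sum_le _ _).trans (Finset.sum_le_sum fun σ _ => ?_)
  refine (enorm_sum_le _ _).trans (Finset.sum_le_sum fun i _ => ?_)
  rw [← ofReal_norm, norm_prod, ENNReal.ofReal_prod_of_nonneg fun _ _ => norm_nonneg _]
  exact (Finset.prod_congr rfl fun _ _ => ofReal_norm _).le

theorem zetaSum_sub (g h : Finset (Fin l) → E → ℂ) (o : Config E) :
    zetaSum A g o - zetaSum A h o = ∑ σ : Finpartition A with σ.parts ≠ {A},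
      ∑ i : σ.parts ↪ Fin o.1, (∏ b : σ.parts, g b (o.2 (i b)) - ∏ b : σ.parts, h b (o.2 (i b))) := by
  simp only [zetaSum, Finset.sum_sub_distrib]

/-- The factors are replaced one at a time, each replacement costing `ε` times a product of bounded
factors. -/
theorem norm_prod_sub_prod_le {ι : Type*} (s : Finset ι) {a b : ι → ℂ} {C ε : ℝ} (hC : 1 ≤ C)
    (ha : ∀ i ∈ s, ‖a i‖ ≤ C) (hb : ∀ i ∈ s, ‖b i‖ ≤ C) (hab : ∀ i ∈ s, ‖a i - b i‖ ≤ ε) :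
    ‖∏ i ∈ s, a i - ∏ i ∈ s, b i‖ ≤ s.card * C ^ s.card * ε := by
  classical
  induction s using Finset.induction_on with
  | empty => simp
  | insert i s hi ih =>
    rw [Finset.prod_insert hi, Finset.prod_insert hi, Finset.card_insert_of_notMem hi]
    have ih' := ih (fun j hj => ha j (Finset.mem_insert_of_mem hj))
      (fun j hj => hb j (Finset.mem_insert_of_mem hj))
      fun j hj => hab j (Finset.mem_insert_of_mem hj)
    have hε : 0 ≤ ε := (norm_nonneg _).trans (hab i (Finset.mem_insert_self i s))
    have hpb : ‖∏ j ∈ s, b j‖ ≤ C ^ s.card := by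
      rw [norm_prod, ← Finset.prod_const]
      exact Finset.prod_le_prod (fun _ _ => norm_nonneg _) fun j hj =>
        hb j (Finset.mem_insert_of_mem hj)
    have hCs : C ^ s.card ≤ C ^ (s.card + 1) := pow_le_pow_right₀ hC (Nat.le_succ _)
    calc ‖a i * ∏ j ∈ s, a j - b i * ∏ j ∈ s, b j‖
        = ‖a i * (∏ j ∈ s, a j - ∏ j ∈ s, b j) + (a i - b i) * ∏ j ∈ s, b j‖ := by
          congr 1; ring
      _ ≤ C * (s.card * C ^ s.card * ε) + ε * C ^ s.card := by
          refine (norm_add_le _ _).trans ?_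
          rw [norm_mul, norm_mul]
          gcongr
          · exact ha i (Finset.mem_insert_self i s)
          · exact hab i (Finset.mem_insert_self i s)
      _ ≤ C * (s.card * C ^ s.card * ε) + ε * C ^ (s.card + 1) := by gcongr
      _ = ((s.card + 1 : ℕ) : ℝ) * C ^ (s.card + 1) * ε := by push_cast; ring

theorem norm_zetaSum_sub_le {k : ℕ} (hA : A.card ≤ k) {g h : Finset (Fin l) → E → ℂ} {C ε : ℝ}
    (hC : 1 ≤ C) (hε : 0 ≤ ε) (hg : ∀ b ⊂ A, b.Nonempty → ∀ y, ‖g b y‖ ≤ C)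
    (hh : ∀ b ⊂ A, b.Nonempty → ∀ y, ‖h b y‖ ≤ C)
    (hgh : ∀ b ⊂ A, b.Nonempty → ∀ y, ‖g b y - h b y‖ ≤ ε) (o : Config E) :
    ‖zetaSum A g o - zetaSum A h o‖ ≤ (Fintype.card (Finpartition A) * (1 + o.1 ^ k) : ℝ)
      * (A.card * C ^ A.card * ε) := by
  rw [zetaSum_sub]
  calc _ ≤ ∑ σ : Finpartition A with σ.parts ≠ {A}, ∑ _i : σ.parts ↪ Fin o.1,
        (A.card * C ^ A.card * ε) := by
        refine (norm_sum_le _ _).trans (Finset.sum_le_sum fun σ hσ => ?_)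
        refine (norm_sum_le _ _).trans (Finset.sum_le_sum fun i _ => ?_)
        have hσ' : σ.parts ≠ {A} := (Finset.mem_filter.1 hσ).2
        have hs : ∀ b : σ.parts, b.1 ⊂ A := fun b => ssubset_of_mem_parts hσ' b.2
        have hn : ∀ b : σ.parts, b.1.Nonempty := fun b => σ.nonempty_of_mem_parts b.2
        refine (norm_prod_sub_prod_le (Finset.univ : Finset σ.parts)
          (a := fun b => g b (o.2 (i b))) (b := fun b => h b (o.2 (i b))) hC (fun b _ => hg b (hs b) (hn b) _)
          (fun b _ => hh b (hs b) (hn b) _) (fun b _ => hgh b (hs b) (hn b) _)).trans ?_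
        rw [Finset.card_univ, Fintype.card_coe]
        have := σ.card_parts_le_card
        gcongr
    _ = ((∑ σ : Finpartition A with σ.parts ≠ {A}, Fintype.card (σ.parts ↪ Fin o.1) : ℕ) : ℝ)
        * (A.card * C ^ A.card * ε) := by
        simp only [Finset.sum_const, nsmul_eq_mul, Finset.card_univ, Nat.cast_sum,
          Finset.sum_mul]
    _ ≤ _ := by
        gcongr
        exact_mod_cast sum_card_embedding_le hA o.1

/-- The block sizes of any partition add up to `|A|`. This lets the normalising weight be moved
inside ζ. -/
theorem zetaSum_homogeneous {R : Type*} [CommSemiring R] (v : R) (g : Finset (Fin l) → E → R)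
    (o : Config E) :
    zetaSum A (fun b y => v ^ b.card * g b y) o = v ^ A.card * zetaSum A g o := by
  simp only [zetaSum, Finset.mul_sum, Finset.prod_mul_distrib, prod_parts_pow]

/-- `zetaSum` is linear in each of the coordinates. -/
theorem zetaSum_linear {j : Fin l} (hj : j ∈ A) {F G H : Finset (Fin l) → E → ℂ} {c : ℂ}
    (hmem : ∀ b ⊂ A, j ∈ b → ∀ y, F b y = c * G b y + H b y)
    (hG : ∀ b, j ∉ b → F b = G b) (hH : ∀ b, j ∉ b → F b = H b) (o : Config E) :
    zetaSum A F o = c * zetaSum A G o + zetaSum A H o := by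
  classical
  simp only [zetaSum, Finset.mul_sum, ← Finset.sum_add_distrib]
  refine Finset.sum_congr rfl fun σ hσ => Finset.sum_congr rfl fun i _ => ?_
  -- Exactly one block contains `j`; on the others the three families agree.
  obtain ⟨b₀, hb₀, hjb⟩ := σ.exists_mem hj
  have hne : ∀ b ∈ ({⟨b₀, hb₀⟩}ᶜ : Finset σ.parts), j ∉ b.1 := fun b hb hjb' => by
    refine (Finset.mem_compl.1 hb) (Finset.mem_singleton.2 (Subtype.ext ?_))
    exact σ.eq_of_mem_parts b.2 hb₀ hjb' hjb
  rw [Fintype.prod_eq_mul_prod_compl (⟨b₀, hb₀⟩ : σ.parts),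
    Fintype.prod_eq_mul_prod_compl (⟨b₀, hb₀⟩ : σ.parts),
    Fintype.prod_eq_mul_prod_compl (⟨b₀, hb₀⟩ : σ.parts) fun b : σ.parts => H b (o.2 (i b)),
    hmem b₀ (ssubset_of_mem_parts (Finset.mem_filter.1 hσ).2 hb₀) hjb]
  have e1 : ∏ b ∈ ({⟨b₀, hb₀⟩}ᶜ : Finset σ.parts), F b (o.2 (i b))
      = ∏ b ∈ ({⟨b₀, hb₀⟩}ᶜ : Finset σ.parts), G b (o.2 (i b)) :=
    Finset.prod_congr rfl fun b hb => by rw [hG b (hne b hb)]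
  have e2 : ∏ b ∈ ({⟨b₀, hb₀⟩}ᶜ : Finset σ.parts), F b (o.2 (i b))
      = ∏ b ∈ ({⟨b₀, hb₀⟩}ᶜ : Finset σ.parts), H b (o.2 (i b)) :=
    Finset.prod_congr rfl fun b hb => by rw [hH b (hne b hb)]
  rw [← e1, ← e2]
  ring

theorem zetaSum_lt_top {g : Finset (Fin l) → E → ℝ≥0∞}
    (hg : ∀ b ⊂ A, b.Nonempty → ∀ y, g b y < ∞) (o : Config E) : zetaSum A g o < ∞ := by
  refine ENNReal.sum_lt_top.2 fun σ hσ => ENNReal.sum_lt_top.2 fun i _ => ?_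
  exact ENNReal.prod_lt_top fun b _ =>
    hg b (ssubset_of_mem_parts (Finset.mem_filter.1 hσ).2 b.2) (σ.nonempty_of_mem_parts b.2) _

theorem zetaSum_toReal {g : Finset (Fin l) → E → ℝ≥0∞}
    (hg : ∀ b ⊂ A, b.Nonempty → ∀ y, g b y < ∞) (o : Config E) :
    zetaSum A (fun b y => (((g b y).toReal : ℝ) : ℂ)) o = ((zetaSum A g o).toReal : ℂ) := by
  have hp : ∀ σ ∈ Finset.univ.filter fun σ : Finpartition A => σ.parts ≠ {A},
      ∀ i : σ.parts ↪ Fin o.1, ∏ b : σ.parts, g b (o.2 (i b)) < ∞ := fun σ hσ i =>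
    ENNReal.prod_lt_top fun b _ =>
      hg b (ssubset_of_mem_parts (Finset.mem_filter.1 hσ).2 b.2) (σ.nonempty_of_mem_parts b.2) _
  unfold zetaSum
  rw [ENNReal.toReal_sum fun σ hσ => (ENNReal.sum_lt_top.2 fun i _ => hp σ hσ i).ne]
  push_cast
  refine Finset.sum_congr rfl fun σ hσ => ?_
  rw [ENNReal.toReal_sum fun i _ => (hp σ hσ i).ne]
  push_cast
  refine Finset.sum_congr rfl fun i _ => ?_
  rw [ENNReal.toReal_prod]
  push_cast
  rfl

end ZetaSum

/-! ### The branching operator γ ζ on bounded functions. -/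

section RateZeta

variable {E Ξ : Type*} [MeasurableSpace E] [MeasurableSpace Ξ] {M : BranchingModel E Ξ}
  {l : ℕ} {A : Finset (Fin l)} {k : ℕ} {K : ℝ≥0}

theorem rateZeta_eq (g : Finset (Fin l) → E → ℂ) (x : E) :
    rateZeta M A g x = (M.rate x : ℝ) * ∫ o, zetaSum A g o ∂(M.offspring x) := rfl

theorem measurable_rateZeta {α : Type*} [MeasurableSpace α] {g : α → Finset (Fin l) → E → ℂ}
    (hg : ∀ b ⊂ A, b.Nonempty → Measurable fun q : α × E => g q.1 b q.2) {x : α → E}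
    (hx : Measurable x) : Measurable fun a => rateZeta M A (g a) (x a) := by
  have h1 := (measurable_zetaSum A hg).stronglyMeasurable.integral_kernel_prod_right'
    (κ := M.offspring.comap x hx)
  have h2 : Measurable fun a => ((M.rate (x a) : ℝ) : ℂ) :=
    Complex.measurable_ofReal.comp (measurable_coe_nnreal_real.comp (M.measurable_rate.comp hx))
  exact h2.mul h1.measurable

theorem rateZeta_homogeneous (v : ℂ) (g : Finset (Fin l) → E → ℂ) (x : E) :
    rateZeta M A (fun b y => v ^ b.card * g b y) x = v ^ A.card * rateZeta M A g x := by
  simp only [rateZeta_eq, zetaSum_homogeneous, integral_const_mul]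
  ring

variable (M) in
/-- The constant in the bounds for `rateZeta`. -/
noncomputable def zetaConst (A : Finset (Fin l)) (K : ℝ≥0) : ℝ≥0 :=
  M.rateBound * (Fintype.card (Finpartition A) * (1 + K))

section

variable (hA : A.card ≤ k) (hK : ∀ x, ∫⁻ o, (o.1 : ℝ≥0∞) ^ k ∂(M.offspring x) ≤ K)

include hK

theorem lintegral_one_add_pow_le (x : E) :
    ∫⁻ o, (Fintype.card (Finpartition A) * (1 + o.1 ^ k) : ℝ≥0∞) ∂(M.offspring x)
      ≤ (Fintype.card (Finpartition A) * (1 + K) : ℝ≥0∞) := by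
  have hm : Measurable fun o : Config E => (o.1 : ℝ≥0∞) ^ k :=
    (measurable_from_nat.comp measurable_config_fst).pow_const k
  rw [lintegral_const_mul _ (hm.const_add 1), lintegral_add_left measurable_const]
  gcongr
  · simp
  · exact hK x

include hA

theorem rateOffspring_zetaSum_le {g : Finset (Fin l) → E → ℝ≥0∞} {D v : ℝ≥0∞}
    (hD : 1 ≤ D) (hg : ∀ b ⊂ A, b.Nonempty → ∀ y, g b y ≤ D * v ^ b.card) (x : E) :
    M.rateOffspring (zetaSum A g) x ≤ zetaConst M A K * (D ^ A.card * v ^ A.card) := by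
  have hm : Measurable fun o : Config E =>
      (Fintype.card (Finpartition A) * (1 + o.1 ^ k) : ℝ≥0∞) :=
    ((((measurable_from_nat (f := fun n : ℕ => (n : ℝ≥0∞))).comp
      measurable_config_fst).pow_const k).const_add 1).const_mul _
  calc _ ≤ M.rate x * ∫⁻ o, (Fintype.card (Finpartition A) * (1 + o.1 ^ k) : ℝ≥0∞)
          * (D ^ A.card * v ^ A.card) ∂(M.offspring x) :=
        mul_le_mul' le_rfl (lintegral_mono fun o => zetaSum_le hA hD hg o)
    _ ≤ M.rateBound * ((Fintype.card (Finpartition A) * (1 + K) : ℝ≥0∞)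
          * (D ^ A.card * v ^ A.card)) := by
        rw [lintegral_mul_const _ hm]
        gcongr
        · exact M.rate_le x
        · exact lintegral_one_add_pow_le hK x
    _ = _ := by
        rw [zetaConst]; push_cast; ring

/-- The power `v ^ |A|` is kept explicit because `v` will be `e^{βu}` for pairs and the inverse
weight for larger sets. -/
theorem norm_rateZeta_le {g : Finset (Fin l) → E → ℂ} {D v : ℝ}
    (hD : 1 ≤ D) (hv : 0 ≤ v) (hg : ∀ b ⊂ A, b.Nonempty → ∀ y, ‖g b y‖ ≤ D * v ^ b.card) (x : E) :
    ‖rateZeta M A g x‖ ≤ zetaConst M A K * (D ^ A.card * v ^ A.card) := by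
  have hD0 : 0 ≤ D := zero_le_one.trans hD
  have h1 : ‖rateZeta M A g x‖ₑ ≤ M.rateOffspring (zetaSum A fun b y => ‖g b y‖ₑ) x := by
    rw [rateZeta_eq, enorm_mul]
    refine mul_le_mul' ?_ ((enorm_integral_le_lintegral_enorm _).trans
      (lintegral_mono fun o => enorm_zetaSum_le g o))
    rw [← ofReal_norm, Complex.norm_real, Real.norm_eq_abs, abs_of_nonneg (M.rate x).coe_nonneg,
      ENNReal.ofReal_coe_nnreal]
  have h2 := h1.trans (rateOffspring_zetaSum_le (M := M) (g := fun b y => ‖g b y‖ₑ) hA hK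
    (D := ENNReal.ofReal D) (v := ENNReal.ofReal v) (ENNReal.one_le_ofReal.2 hD)
    (fun b hb hn y => by
      rw [← ofReal_norm, ← ENNReal.ofReal_pow hv, ← ENNReal.ofReal_mul hD0]
      exact ENNReal.ofReal_le_ofReal (hg b hb hn y)) x)
  rw [← ENNReal.ofReal_pow hv, ← ENNReal.ofReal_pow hD0, ← ENNReal.ofReal_mul (by positivity),
    ← ENNReal.ofReal_coe_nnreal, ← ENNReal.ofReal_mul (by positivity), ← ofReal_norm] at h2
  exact (ENNReal.ofReal_le_ofReal_iff (by positivity)).1 h2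

theorem integrable_zetaSum {g : Finset (Fin l) → E → ℂ} {D : ℝ} (hD : 1 ≤ D)
    (hm : ∀ b ⊂ A, b.Nonempty → Measurable (g b))
    (hg : ∀ b ⊂ A, b.Nonempty → ∀ y, ‖g b y‖ ≤ D) (x : E) :
    Integrable (zetaSum A g) (M.offspring x) := by
  have hmz : Measurable fun q : Unit × Config E => zetaSum A g q.2 :=
    measurable_zetaSum A (g := fun _ : Unit => g) fun b hb hn => (hm b hb hn).comp measurable_snd
  refine ⟨(hmz.comp (measurable_prodMk_left (x := ()))).aestronglyMeasurable, ?_⟩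
  have hmN : Measurable fun o : Config E =>
      (Fintype.card (Finpartition A) * (1 + o.1 ^ k) : ℝ≥0∞) :=
    ((((measurable_from_nat (f := fun n : ℕ => (n : ℝ≥0∞))).comp
      measurable_config_fst).pow_const k).const_add 1).const_mul _
  calc ∫⁻ o, ‖zetaSum A g o‖ₑ ∂(M.offspring x)
      ≤ ∫⁻ o, (Fintype.card (Finpartition A) * (1 + o.1 ^ k) : ℝ≥0∞)
          * (ENNReal.ofReal D ^ A.card * 1 ^ A.card) ∂(M.offspring x) := by
        refine lintegral_mono fun o => (enorm_zetaSum_le g o).trans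
          (zetaSum_le hA (ENNReal.one_le_ofReal.2 hD) (fun b hb hn y => ?_) o)
        rw [one_pow, mul_one, ← ofReal_norm]
        exact ENNReal.ofReal_le_ofReal (hg b hb hn y)
    _ ≤ (Fintype.card (Finpartition A) * (1 + K) : ℝ≥0∞)
          * (ENNReal.ofReal D ^ A.card * 1 ^ A.card) := by
        rw [lintegral_mul_const _ hmN]
        gcongr
        exact lintegral_one_add_pow_le hK x
    _ < ∞ := by
        rw [one_pow, mul_one]
        refine ENNReal.mul_lt_top ?_ (ENNReal.pow_lt_top ENNReal.ofReal_lt_top)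
        exact ENNReal.mul_lt_top (ENNReal.natCast_lt_top _)
          (ENNReal.add_lt_top.2 ⟨ENNReal.one_lt_top, ENNReal.coe_lt_top⟩)

theorem rateZeta_mem_B {g : Finset (Fin l) → E → ℂ} {D : ℝ}
    (hm : ∀ b ⊂ A, b.Nonempty → Measurable (g b))
    (hg : ∀ b ⊂ A, b.Nonempty → ∀ y, ‖g b y‖ ≤ D) : rateZeta M A g ∈ B E := by
  refine ⟨?_, zetaConst M A K * (max 1 D ^ A.card * 1 ^ A.card), fun x => ?_⟩
  · exact measurable_rateZeta (α := E) (g := fun _ => g) (x := id)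
      (fun b hb hn => (hm b hb hn).comp measurable_snd) measurable_id
  · refine norm_rateZeta_le hA hK (le_max_left _ _) zero_le_one (fun b hb hn y => ?_) x
    rw [one_pow, mul_one]
    exact (hg b hb hn y).trans (le_max_right _ _)

/-- A Lipschitz bound uniform in the point; it carries the uniform convergence of the lower moments
through the branching operator. -/
theorem norm_rateZeta_sub_le {g h : Finset (Fin l) → E → ℂ} {C ε : ℝ}
    (hC : 1 ≤ C) (hε : 0 ≤ ε) (hgm : ∀ b ⊂ A, b.Nonempty → Measurable (g b))
    (hhm : ∀ b ⊂ A, b.Nonempty → Measurable (h b))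
    (hg : ∀ b ⊂ A, b.Nonempty → ∀ y, ‖g b y‖ ≤ C)
    (hh : ∀ b ⊂ A, b.Nonempty → ∀ y, ‖h b y‖ ≤ C)
    (hgh : ∀ b ⊂ A, b.Nonempty → ∀ y, ‖g b y - h b y‖ ≤ ε) (x : E) :
    ‖rateZeta M A g x - rateZeta M A h x‖ ≤ zetaConst M A K * (A.card * C ^ A.card * ε) := by
  have hD : 0 ≤ A.card * C ^ A.card * ε := by positivity
  have hmN : Measurable fun o : Config E =>
      (Fintype.card (Finpartition A) * (1 + o.1 ^ k) : ℝ≥0∞) :=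
    ((((measurable_from_nat (f := fun n : ℕ => (n : ℝ≥0∞))).comp
      measurable_config_fst).pow_const k).const_add 1).const_mul _
  have h1 : ‖rateZeta M A g x - rateZeta M A h x‖ₑ
      ≤ ENNReal.ofReal (zetaConst M A K * (A.card * C ^ A.card * ε)) := by
    rw [rateZeta_eq, rateZeta_eq, ← mul_sub, ← integral_sub (integrable_zetaSum hA hK hC hgm hg x)
      (integrable_zetaSum hA hK hC hhm hh x), enorm_mul]
    calc _ ≤ (M.rate x : ℝ≥0∞) * ∫⁻ o, (Fintype.card (Finpartition A) * (1 + o.1 ^ k) : ℝ≥0∞)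
          * ENNReal.ofReal (A.card * C ^ A.card * ε) ∂(M.offspring x) := by
          refine mul_le_mul' ?_ ((enorm_integral_le_lintegral_enorm _).trans
            (lintegral_mono fun o => ?_))
          · rw [← ofReal_norm, Complex.norm_real, Real.norm_eq_abs,
              abs_of_nonneg (M.rate x).coe_nonneg, ENNReal.ofReal_coe_nnreal]
          · have := norm_zetaSum_sub_le hA hC hε hg hh hgh o
            rw [← ofReal_norm]
            refine (ENNReal.ofReal_le_ofReal this).trans_eq ?_
            rw [ENNReal.ofReal_mul (by positivity), ENNReal.ofReal_mul (by positivity),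
              ENNReal.ofReal_add zero_le_one (by positivity), ENNReal.ofReal_pow (by positivity),
              ENNReal.ofReal_natCast, ENNReal.ofReal_natCast, ENNReal.ofReal_one]
      _ ≤ M.rateBound * ((Fintype.card (Finpartition A) * (1 + K) : ℝ≥0∞)
          * ENNReal.ofReal (A.card * C ^ A.card * ε)) := by
          rw [lintegral_mul_const _ hmN]
          gcongr
          · exact M.rate_le x
          · exact lintegral_one_add_pow_le hK x
      _ = _ := by
          rw [ENNReal.ofReal_mul (NNReal.coe_nonneg _), ENNReal.ofReal_coe_nnreal, zetaConst]
          push_cast; ring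
  rw [← ofReal_norm] at h1
  exact (ENNReal.ofReal_le_ofReal_iff (by positivity)).1 h1

/-- `rateZeta` is linear in each of the coordinates. -/
theorem rateZeta_linear {j : Fin l} (hj : j ∈ A) {F G H : Finset (Fin l) → E → ℂ} {c : ℂ} {D : ℝ}
    (hmem : ∀ b ⊂ A, j ∈ b → ∀ y, F b y = c * G b y + H b y)
    (hFG : ∀ b, j ∉ b → F b = G b) (hFH : ∀ b, j ∉ b → F b = H b) (hD : 1 ≤ D)
    (hGm : ∀ b ⊂ A, b.Nonempty → Measurable (G b))
    (hHm : ∀ b ⊂ A, b.Nonempty → Measurable (H b))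
    (hG : ∀ b ⊂ A, b.Nonempty → ∀ y, ‖G b y‖ ≤ D)
    (hH : ∀ b ⊂ A, b.Nonempty → ∀ y, ‖H b y‖ ≤ D) (x : E) :
    rateZeta M A F x = c * rateZeta M A G x + rateZeta M A H x := by
  simp only [rateZeta_eq, zetaSum_linear hj hmem hFG hFH]
  rw [integral_add ((integrable_zetaSum hA hK hD hGm hG x).const_mul c)
    (integrable_zetaSum hA hK hD hHm hH x), integral_const_mul]
  ring

end

end RateZeta

theorem integral_ofReal_toReal {α : Type*} [MeasurableSpace α] {μ : Measure α} {G : α → ℝ≥0∞}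
    (hm : AEMeasurable G μ) (hG : ∀ᵐ a ∂μ, G a < ∞) :
    ∫ a, ((G a).toReal : ℂ) ∂μ = ((∫⁻ a, G a ∂μ).toReal : ℂ) := by
  rw [← integral_toReal hm hG]
  exact integral_ofReal

/-! ### The evolution equation for complex functions. -/

section Evolution

variable {E Ξ : Type*} [MeasurableSpace E] [MeasurableSpace Ξ] {M : BranchingModel E Ξ}
  {Q : Kernel E (Tree E Ξ)}

variable (M Q) in
/-- The evolution equation for the moments. -/
def SatisfiesEvolution {l : ℕ} (A : Finset (Fin l)) (t : ℝ≥0) (x : E) (f : Fin l → B E) : Prop :=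
  psiMoment M Q t f A x = psi M Q t (fun y => ∏ i ∈ A, (f i : E → ℂ) y) x
    + ∫ s in Set.Ioc (0 : ℝ) t,
        psi M Q s.toNNReal (rateZeta M A (psiMoment M Q (t - s.toNNReal) f)) x

theorem psiMoment_congr {l : ℕ} {f g : Fin l → B E} {A : Finset (Fin l)} (h : ∀ i ∈ A, f i = g i)
    (t : ℝ≥0) (x : E) : psiMoment M Q t f A x = psiMoment M Q t g A x := by
  simp only [psiMoment_eq]
  refine integral_congr_ae (Eventually.of_forall fun τ => Finset.prod_congr rfl fun i hi => ?_)
  rw [h i hi]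

theorem exists_bound {l : ℕ} (f : Fin l → B E) : ∃ R : ℝ, 1 ≤ R ∧ ∀ i y, ‖(f i : E → ℂ) y‖ ≤ R := by
  choose C hC using fun i => (f i).2.2
  refine ⟨1 + ∑ j, |C j|, le_add_of_nonneg_right (Finset.sum_nonneg fun _ _ => abs_nonneg _),
    fun i y => (hC i y).trans ((le_abs_self _).trans ?_)⟩
  have := Finset.single_le_sum (f := fun j => |C j|) (fun j _ => abs_nonneg _) (Finset.mem_univ i)
  linarith

/-- A function is a linear combination of nonnegative ones. -/
theorem exists_nonneg_combination (u : B E) : ∃ (p : Fin 4 → B E) (F : Fin 4 → E → ℝ≥0∞) (C : ℝ≥0),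
    (∀ n, Measurable (F n) ∧ (∀ y, F n y ≤ C) ∧ (p n : E → ℂ) = fun y => ((F n y).toReal : ℂ)) ∧
    u = (1 : ℂ) • p 0 + ((-1 : ℂ) • p 1 + (Complex.I • p 2 + ((-Complex.I) • p 3 + 0))) := by
  obtain ⟨hm, R, hR⟩ := u.2
  let r : Fin 4 → E → ℝ := ![fun y => ((u : E → ℂ) y).re, fun y => -((u : E → ℂ) y).re,
    fun y => ((u : E → ℂ) y).im, fun y => -((u : E → ℂ) y).im]
  have hre : Measurable fun y => ((u : E → ℂ) y).re := Complex.measurable_re.comp hm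
  have him : Measurable fun y => ((u : E → ℂ) y).im := Complex.measurable_im.comp hm
  have hrm : ∀ n, Measurable (r n) := by
    intro n
    fin_cases n
    exacts [hre, hre.neg, him, him.neg]
  have hrb : ∀ n y, r n y ≤ R := by
    intro n y
    have h1 := (Complex.abs_re_le_norm _).trans (hR y)
    have h2 := (Complex.abs_im_le_norm _).trans (hR y)
    fin_cases n
    exacts [(le_abs_self _).trans h1, (neg_le_abs _).trans h1, (le_abs_self _).trans h2,
      (neg_le_abs _).trans h2]
  have hFm : ∀ n, Measurable fun y => ENNReal.ofReal (r n y) := fun n => (hrm n).ennreal_ofReal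
  have hFC : ∀ n y, ENNReal.ofReal (r n y) ≤ R.toNNReal := fun n y =>
    ENNReal.ofReal_le_ofReal (hrb n y)
  have hmem : ∀ n, (fun y => ((ENNReal.ofReal (r n y)).toReal : ℂ)) ∈ B E := fun n =>
    ⟨Complex.measurable_ofReal.comp (hFm n).ennreal_toReal, R.toNNReal, fun y => by
      rw [Complex.norm_real, Real.norm_eq_abs, abs_of_nonneg ENNReal.toReal_nonneg]
      exact ENNReal.toReal_le_of_le_ofReal NNReal.zero_le_coe
        (by rw [ENNReal.ofReal_coe_nnreal]; exact hFC n y)⟩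
  refine ⟨fun n => ⟨_, hmem n⟩, fun n y => ENNReal.ofReal (r n y), R.toNNReal,
    fun n => ⟨hFm n, hFC n, rfl⟩, ?_⟩
  have hdec : ∀ a : ℝ, a = max a 0 - max (-a) 0 := fun a => by
    rcases le_total a 0 with h | h
    · rw [max_eq_right h, max_eq_left (neg_nonneg.2 h)]; ring
    · rw [max_eq_left h, max_eq_right (neg_nonpos.2 h)]; ring
  refine Subtype.ext (funext fun y => ?_)
  simp only [AddMemClass.coe_add, SetLike.val_smul, Pi.add_apply, Pi.smul_apply, smul_eq_mul,
    ENNReal.toReal_ofReal', ZeroMemClass.coe_zero, Pi.zero_apply]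
  change (u : E → ℂ) y = 1 * ((max ((u : E → ℂ) y).re 0 : ℝ) : ℂ)
    + (-1 * ((max (-((u : E → ℂ) y).re) 0 : ℝ) : ℂ)
      + (Complex.I * ((max ((u : E → ℂ) y).im 0 : ℝ) : ℂ)
        + (-Complex.I * ((max (-((u : E → ℂ) y).im) 0 : ℝ) : ℂ) + 0)))
  conv_lhs => rw [← Complex.re_add_im ((u : E → ℂ) y), hdec ((u : E → ℂ) y).re,
    hdec ((u : E → ℂ) y).im]
  push_cast
  ring

theorem rateZeta_toReal {l : ℕ} {A : Finset (Fin l)} {g : Finset (Fin l) → E → ℝ≥0∞}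
    (hm : ∀ b ⊂ A, b.Nonempty → Measurable (g b))
    (hlt : ∀ b ⊂ A, b.Nonempty → ∀ y, g b y < ∞) :
    rateZeta M A (fun b y => ((g b y).toReal : ℂ))
      = fun y => ((M.rateOffspring (zetaSum A g) y).toReal : ℂ) := by
  funext y
  have hz : Measurable fun q : Unit × Config E => zetaSum A g q.2 :=
    measurable_zetaSum A (α := Unit) (g := fun _ => g)
      fun b hb hn => (hm b hb hn).comp measurable_snd
  have hzm := hz.comp (measurable_prodMk_left (x := ()))
  simp only [Function.comp_def] at hzm
  rw [rateZeta_eq]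
  simp only [zetaSum_toReal hlt]
  rw [integral_ofReal_toReal hzm.aemeasurable
    (Eventually.of_forall fun o => zetaSum_lt_top hlt o), BranchingModel.rateOffspring,
    ENNReal.toReal_mul, ENNReal.coe_toReal, Complex.ofReal_mul]

theorem measurable_psi_rateZeta [IsMarkovKernel Q] {l : ℕ} (A : Finset (Fin l)) (f : Fin l → B E)
    {s u : ℝ → ℝ≥0} (hs : Measurable s) (hu : Measurable u) (x : E) :
    Measurable fun r : ℝ => psi M Q (s r) (rateZeta M A (psiMoment M Q (u r) f)) x := by
  refine measurable_psi (G := fun q : ℝ × E => rateZeta M A (psiMoment M Q (u q.1) f) q.2) ?_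
    hs measurable_const
  refine measurable_rateZeta (α := ℝ × E) (g := fun q => psiMoment M Q (u q.1) f)
    (fun b _ _ => ?_) measurable_snd
  exact measurable_psiMoment f b (t := fun q : (ℝ × E) × E => u q.1.1)
    (x := fun q : (ℝ × E) × E => q.2) (hu.comp measurable_fst.fst) measurable_snd

variable [IsMarkovKernel Q] (hQ : M.IsTreeLaw Q) {k : ℕ} (hk : 1 ≤ k)
    {K : ℝ≥0} (hK : ∀ x, ∫⁻ o, (o.1 : ℝ≥0∞) ^ k ∂(M.offspring x) ≤ K)

include hQ hk hK

section Nonneg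

theorem linearStat_toReal {G : E → ℝ≥0∞} (hG : Measurable G) {C : ℝ≥0} (hC : ∀ y, G y ≤ C)
    (t : ℝ≥0) (x : E) :
    ∀ᵐ τ ∂(Q x), M.pop ⊤ G t τ < ∞ ∧
      M.linearStat t (fun y => ((G y).toReal : ℂ)) τ = ((M.pop ⊤ G t τ).toReal : ℂ) := by
  filter_upwards [ae_isFiniteMeasure_X hQ hk hK t x] with τ hτ
  rw [M.pop_top]
  refine ⟨?_, integral_ofReal_toReal hG.aemeasurable
    (Eventually.of_forall fun y => (hC y).trans_lt ENNReal.coe_lt_top)⟩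
  calc ∫⁻ y, G y ∂(M.X t τ) ≤ ∫⁻ _, C ∂(M.X t τ) := lintegral_mono hC
    _ < ∞ := by
      rw [lintegral_const]
      exact ENNReal.mul_lt_top ENNReal.coe_lt_top (measure_lt_top _ _)

theorem momentE_toReal {l : ℕ} {A : Finset (Fin l)} (hA : A.card ≤ k) {F : Fin l → E → ℝ≥0∞}
    (hF : ∀ i, Measurable (F i)) {C : ℝ≥0} (hC : ∀ i y, F i y ≤ C) {f : Fin l → B E}
    (hf : ∀ i, (f i : E → ℂ) = fun y => ((F i y).toReal : ℂ)) (t : ℝ≥0) (x : E) :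
    momentE M Q ⊤ F t A x ≤ ENNReal.ofReal (C ^ A.card * growth M K t) ∧
      psiMoment M Q t f A x = ((momentE M Q ⊤ F t A x).toReal : ℂ) := by
  have hae : ∀ᵐ τ ∂(Q x), ∀ i, M.pop ⊤ (F i) t τ < ∞ ∧
      M.linearStat t (f i : E → ℂ) τ = ((M.pop ⊤ (F i) t τ).toReal : ℂ) := by
    rw [ae_all_iff]
    intro i
    rw [hf i]
    exact linearStat_toReal hQ hk hK (hF i) (hC i) t x
  have hpm : Measurable fun τ => ∏ i ∈ A, M.pop ⊤ (F i) t τ :=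
    Finset.measurable_fun_prod _ fun i _ => M.measurable_pop' ⊤ (hF i) measurable_const measurable_id
  constructor
  · have hb : ∀ i y, ‖(f i : E → ℂ) y‖ ≤ C := fun i y => by
      rw [hf i, Complex.norm_real, Real.norm_eq_abs, abs_of_nonneg ENNReal.toReal_nonneg]
      exact ENNReal.toReal_le_of_le_ofReal C.coe_nonneg
        (by rw [ENNReal.ofReal_coe_nnreal]; exact hC i y)
    refine le_trans (le_of_eq ?_)
      (lintegral_prod_linearStat_le hQ hk hK hA C.coe_nonneg hb t x)
    refine lintegral_congr_ae ?_
    filter_upwards [hae] with τ hτ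
    rw [← ofReal_norm, norm_prod, ENNReal.ofReal_prod_of_nonneg fun i _ => norm_nonneg _]
    refine Finset.prod_congr rfl fun i _ => ?_
    rw [(hτ i).2, Complex.norm_real, Real.norm_eq_abs, abs_of_nonneg ENNReal.toReal_nonneg,
      ENNReal.ofReal_toReal (hτ i).1.ne]
  · rw [momentE, ← integral_ofReal_toReal hpm.aemeasurable, psiMoment_eq]
    · refine integral_congr_ae ?_
      filter_upwards [hae] with τ hτ
      rw [ENNReal.toReal_prod]
      push_cast
      exact Finset.prod_congr rfl fun i _ => (hτ i).2
    · filter_upwards [hae] with τ hτ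
      exact ENNReal.prod_lt_top fun i _ => (hτ i).1

theorem psi_toReal {G : E → ℝ≥0∞} (hG : Measurable G) {C : ℝ≥0} (hC : ∀ y, G y ≤ C)
    (t : ℝ≥0) (x : E) :
    meanE M Q ⊤ G t x ≤ ENNReal.ofReal (C * growth M K t) ∧
      psi M Q t (fun y => ((G y).toReal : ℂ)) x = ((meanE M Q ⊤ G t x).toReal : ℂ) := by
  have hmem : (fun y => ((G y).toReal : ℂ)) ∈ B E := by
    refine ⟨Complex.measurable_ofReal.comp hG.ennreal_toReal, C, fun y => ?_⟩
    rw [Complex.norm_real, Real.norm_eq_abs, abs_of_nonneg ENNReal.toReal_nonneg]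
    exact ENNReal.toReal_le_of_le_ofReal C.coe_nonneg
      (by rw [ENNReal.ofReal_coe_nnreal]; exact hC y)
  have h := momentE_toReal hQ hk hK (l := 1) (A := {0}) (by simpa using hk) (F := fun _ => G)
    (fun _ => hG) (fun _ => hC) (f := fun _ => ⟨_, hmem⟩) (fun _ => rfl) t x
  rw [psiMoment_singleton] at h
  simpa [momentE, meanE] using h

/-- All terms of the identity in [0,∞] from `momentE_evolution` are finite, so they can be converted
to complex numbers one by one. -/
theorem psiMoment_evolution_of_nonneg {l : ℕ} {A : Finset (Fin l)} (hA : A.card ≤ k)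
    (hA' : A.Nonempty) {F : Fin l → E → ℝ≥0∞} (hF : ∀ i, Measurable (F i)) {C : ℝ≥0}
    (hC : ∀ i y, F i y ≤ C) {f : Fin l → B E}
    (hf : ∀ i, (f i : E → ℂ) = fun y => ((F i y).toReal : ℂ)) (t : ℝ≥0) (x : E) :
    psiMoment M Q t f A x = psi M Q t (fun y => ∏ i ∈ A, (f i : E → ℂ) y) x
      + ∫ s in Set.Ioc (0 : ℝ) t,
          psi M Q s.toNNReal (rateZeta M A (psiMoment M Q (t - s.toNNReal) f)) x := by
  have hcard : ∀ b : Finset (Fin l), b ⊂ A → b.card ≤ k := fun b hb =>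
    (Finset.card_le_card hb.1).trans hA
  -- A single bound for the moments over all proper subsets and all times up to `t`; the maximum
  -- with `1` makes powers monotone in the block size.
  set D : ℝ := (max 1 C : ℝ≥0) ^ A.card * growth M K t with hDdef
  have hg1 : 1 ≤ growth M K t := by unfold growth; linarith [Real.exp_pos ((M.rateBound * K : ℝ≥0) * t)]
  have hD1 : 1 ≤ D := one_le_mul_of_one_le_of_one_le
    (one_le_pow₀ (by exact_mod_cast le_max_left 1 C)) hg1
  have hmom : ∀ (b : Finset (Fin l)), b ⊂ A → ∀ u ≤ t, ∀ y, momentE M Q ⊤ F u b y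
      ≤ ENNReal.ofReal D := by
    intro b hb u hu y
    refine (momentE_toReal hQ hk hK (hcard b hb) hF hC hf u y).1.trans (ENNReal.ofReal_le_ofReal ?_)
    have h1 : (C : ℝ) ^ b.card ≤ (max 1 C : ℝ≥0) ^ A.card := by
      calc (C : ℝ) ^ b.card ≤ (max 1 C : ℝ≥0) ^ b.card := by
            gcongr; exact le_max_right _ _
        _ ≤ _ := pow_le_pow_right₀ (by exact_mod_cast le_max_left 1 C) (Finset.card_le_card hb.1)
    exact mul_le_mul h1 (growth_mono K hu) (growth_pos K u).le (by positivity)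
  set h : ℝ≥0 → E → ℝ≥0∞ := fun u =>
    M.rateOffspring (zetaSum A fun b => momentE M Q ⊤ F u b) with hh
  set H : ℝ≥0 := zetaConst M A K * D.toNNReal ^ A.card with hH
  have hhle : ∀ u ≤ t, ∀ y, h u y ≤ H := by
    intro u hu y
    refine (rateOffspring_zetaSum_le hA hK (D := ENNReal.ofReal D) (v := 1)
      (ENNReal.one_le_ofReal.2 hD1) (fun b hb _ y => ?_) y).trans_eq ?_
    · rw [one_pow, mul_one]; exact hmom b hb u hu y
    · rw [hH, one_pow, mul_one]; push_cast; rfl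
  have hhm : Measurable fun q : ℝ × E => h (t - q.1.toNNReal) q.2 := by
    refine BranchingModel.measurable_rateOffspring (M := M) (α := ℝ × E)
      (R := fun q => zetaSum A (fun b => momentE M Q ⊤ F (t - q.1.1.toNNReal) b) q.2)
      (measurable_zetaSum A (g := fun (q : ℝ × E) b => momentE M Q ⊤ F (t - q.1.toNNReal) b)
        fun b _ _ => ?_) measurable_snd
    exact measurable_momentE M Q ⊤ hF b (t := fun q : (ℝ × E) × E => t - q.1.1.toNNReal)
      (x := fun q : (ℝ × E) × E => q.2)
      (measurable_const.sub (measurable_real_toNNReal.comp measurable_fst.fst)) measurable_snd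
  have hrz : ∀ u ≤ t, rateZeta M A (psiMoment M Q u f) = fun y => ((h u y).toReal : ℂ) := by
    intro u hu
    have hlt : ∀ b ⊂ A, b.Nonempty → ∀ y, momentE M Q ⊤ F u b y < ∞ := fun b hb _ y =>
      (hmom b hb u hu y).trans_lt ENNReal.ofReal_lt_top
    rw [rateZeta_congr M A (h := fun b y => ((momentE M Q ⊤ F u b y).toReal : ℂ)) fun b hb =>
      funext fun y => (momentE_toReal hQ hk hK (hcard b hb) hF hC hf u y).2]
    exact rateZeta_toReal (fun b _ _ => measurable_momentE M Q ⊤ hF b (t := fun _ => u)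
      (x := fun y => y) measurable_const measurable_id) hlt
  have hpsi : ∀ s : ℝ, s ∈ Set.Ioc (0 : ℝ) t →
      meanE M Q ⊤ (h (t - s.toNNReal)) s.toNNReal x < ∞ ∧
      psi M Q s.toNNReal (rateZeta M A (psiMoment M Q (t - s.toNNReal) f)) x
        = ((meanE M Q ⊤ (h (t - s.toNNReal)) s.toNNReal x).toReal : ℂ) := by
    intro s hs
    have hm : Measurable (h (t - s.toNNReal)) := hhm.comp (measurable_prodMk_left (x := s))
    have := psi_toReal hQ hk hK hm (hhle _ tsub_le_self) s.toNNReal x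
    rw [hrz _ tsub_le_self]
    exact ⟨this.1.trans_lt ENNReal.ofReal_lt_top, this.2⟩
  have hint : ∫ s in Set.Ioc (0 : ℝ) t,
          psi M Q s.toNNReal (rateZeta M A (psiMoment M Q (t - s.toNNReal) f)) x
      = ((∫⁻ s in Set.Ioc (0 : ℝ) t,
          meanE M Q ⊤ (h (t - s.toNNReal)) s.toNNReal x).toReal : ℂ) := by
    have hm : Measurable fun s : ℝ => meanE M Q ⊤ (h (t - s.toNNReal)) s.toNNReal x :=
      measurable_meanE M Q ⊤ hhm measurable_real_toNNReal measurable_const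
    rw [← integral_ofReal_toReal hm.aemeasurable
      ((ae_restrict_iff' measurableSet_Ioc).2 (Eventually.of_forall fun s hs => (hpsi s hs).1))]
    exact setIntegral_congr_fun measurableSet_Ioc fun s hs => (hpsi s hs).2
  have hfirst : psi M Q t (fun y => ∏ i ∈ A, (f i : E → ℂ) y) x
      = ((meanE M Q ⊤ (fun y => ∏ i ∈ A, F i y) t x).toReal : ℂ) := by
    have := (psi_toReal hQ hk hK (G := fun y => ∏ i ∈ A, F i y) (C := C ^ A.card)
      (Finset.measurable_fun_prod _ fun i _ => hF i) (fun y => by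
        push_cast
        exact Finset.prod_le_pow_card _ _ _ fun i _ => hC i y) t x).2
    rw [← this]
    congr 1
    funext y
    rw [ENNReal.toReal_prod]
    push_cast
    exact Finset.prod_congr rfl fun i _ => by rw [hf i]
  have hev := momentE_evolution hQ hF t hA' x
  have hfin := (momentE_toReal hQ hk hK hA hF hC hf t x)
  have hne := (hfin.1.trans_lt ENNReal.ofReal_lt_top).ne
  rw [hev] at hne
  rw [hfin.2, hev, hfirst, hint, ENNReal.toReal_add (ENNReal.add_ne_top.1 hne).1
    (ENNReal.add_ne_top.1 hne).2]
  push_cast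
  rfl

end Nonneg

section Multilinear

variable {l : ℕ} {A : Finset (Fin l)} (hA : A.card ≤ k)

include hA

theorem psiMoment_update_lin {j : Fin l} (hj : j ∈ A) (f : Fin l → B E) (c : ℂ) (g h : B E)
    (t : ℝ≥0) (x : E) :
    psiMoment M Q t (Function.update f j (c • g + h)) A x
      = c * psiMoment M Q t (Function.update f j g) A x
        + psiMoment M Q t (Function.update f j h) A x := by
  have hi : ∀ u : B E, Integrable (fun τ => ∏ i ∈ A, M.linearStat t
      (Function.update f j u i : E → ℂ) τ) (Q x) := fun u =>
    integrable_prod_linearStat hQ hk hK hA _ t x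
  simp only [psiMoment_eq]
  rw [← integral_const_mul, ← integral_add ((hi g).const_mul c) (hi h)]
  refine integral_congr_ae ?_
  filter_upwards [linearStat_lin hQ hk hK g.2 h.2 c t x] with τ hτ
  have hp : ∀ u : B E, ∏ i ∈ A, M.linearStat t (Function.update f j u i : E → ℂ) τ
      = M.linearStat t (u : E → ℂ) τ * ∏ i ∈ A.erase j, M.linearStat t (f i : E → ℂ) τ := by
    intro u
    rw [← Finset.mul_prod_erase A _ hj, Function.update_self]
    congr 1
    refine Finset.prod_congr rfl fun i hi => ?_
    rw [Function.update_of_ne (Finset.ne_of_mem_erase hi)]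
  have hτ' : M.linearStat t ((c • g + h : B E) : E → ℂ) τ
      = c * M.linearStat t (g : E → ℂ) τ + M.linearStat t (h : E → ℂ) τ := hτ
  rw [hp, hp, hp, hτ']
  ring

theorem rateZeta_psiMoment_mem_B {f : Fin l → B E} {R : ℝ} (hR : 1 ≤ R)
    (hf : ∀ i y, ‖(f i : E → ℂ) y‖ ≤ R) (u : ℝ≥0) :
    rateZeta M A (psiMoment M Q u f) ∈ B E := by
  refine rateZeta_mem_B hA hK (D := R ^ A.card * growth M K u) (fun b _ _ => ?_)
    fun b hb _ y => ?_
  · exact measurable_psiMoment f b (t := fun _ : E => u) (x := fun y => y) measurable_const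
      measurable_id
  · have hc := Finset.card_le_card hb.1
    refine (norm_psiMoment_le hQ hk hK (hc.trans hA) (zero_le_one.trans hR) hf u y).trans ?_
    have := growth_pos (M := M) K u
    gcongr

theorem integrableOn_psi_rateZeta {f : Fin l → B E} {R : ℝ} (hR : 1 ≤ R)
    (hf : ∀ i y, ‖(f i : E → ℂ) y‖ ≤ R) (t : ℝ≥0) (x : E) :
    IntegrableOn (fun s : ℝ =>
      psi M Q s.toNNReal (rateZeta M A (psiMoment M Q (t - s.toNNReal) f)) x) (Set.Ioc 0 t) := by
  refine Measure.integrableOn_of_bounded (M := zetaConst M A K *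
    ((R ^ A.card * growth M K t) ^ A.card * 1 ^ A.card) * growth M K t) (by simp)
    (measurable_psi_rateZeta A f measurable_real_toNNReal
      (measurable_const.sub measurable_real_toNNReal) x).aestronglyMeasurable
    ((ae_restrict_iff' measurableSet_Ioc).2 (Eventually.of_forall fun s hs => ?_))
  have hg := growth_pos (M := M) K
  have hg1 : 1 ≤ growth M K t := by
    unfold growth; linarith [Real.exp_pos ((M.rateBound * K : ℝ≥0) * t)]
  have hst : s.toNNReal ≤ t := Real.toNNReal_le_iff_le_coe.2 hs.2
  have hR0 : 0 ≤ R := zero_le_one.trans hR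
  refine (norm_psi_le hQ hk hK (rateZeta_psiMoment_mem_B hQ hk hK hA hR hf _).1
    (R := zetaConst M A K * ((R ^ A.card * growth M K t) ^ A.card * 1 ^ A.card))
    (by have := hg t; positivity) (fun y => ?_) _ x).trans ?_
  · refine norm_rateZeta_le hA hK (one_le_mul_of_one_le_of_one_le (one_le_pow₀ hR) hg1) zero_le_one
      (fun b hb _ y => ?_) y
    have hc := Finset.card_le_card hb.1
    refine (norm_psiMoment_le hQ hk hK (hc.trans hA) hR0 hf _ y).trans ?_
    rw [one_pow, mul_one]
    exact mul_le_mul (pow_le_pow_right₀ hR hc) (growth_mono K tsub_le_self) (hg _).le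
      (by positivity)
  · have := hg t
    exact mul_le_mul_of_nonneg_left (growth_mono K hst) (by positivity)

/-- The evolution equation is linear in each coordinate. -/
theorem evolution_update_lin {j : Fin l} (hj : j ∈ A) (f : Fin l → B E) (c : ℂ) (g h : B E)
    (t : ℝ≥0) (x : E)
    (hg : SatisfiesEvolution M Q A t x (Function.update f j g))
    (hh : SatisfiesEvolution M Q A t x (Function.update f j h)) :
    SatisfiesEvolution M Q A t x (Function.update f j (c • g + h)) := by
  unfold SatisfiesEvolution at hg hh ⊢
  have hprodB : ∀ u : B E, (fun y => ∏ i ∈ A, (Function.update f j u i : E → ℂ) y) ∈ B E := by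
    intro u
    have h1 := (∏ i ∈ A, Function.update f j u i : B E).2
    rwa [show ((∏ i ∈ A, Function.update f j u i : B E) : E → ℂ)
      = fun y => ∏ i ∈ A, (Function.update f j u i : E → ℂ) y by
        funext y; simp] at h1
  have hfirst : psi M Q t (fun y => ∏ i ∈ A, (Function.update f j (c • g + h) i : E → ℂ) y) x
      = c * psi M Q t (fun y => ∏ i ∈ A, (Function.update f j g i : E → ℂ) y) x
        + psi M Q t (fun y => ∏ i ∈ A, (Function.update f j h i : E → ℂ) y) x := by
    rw [← psi_lin hQ hk hK (hprodB g) (hprodB h)]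
    congr 1
    funext y
    have hp : ∀ u : B E, ∏ i ∈ A, (Function.update f j u i : E → ℂ) y
        = (u : E → ℂ) y * ∏ i ∈ A.erase j, (f i : E → ℂ) y := by
      intro u
      rw [← Finset.mul_prod_erase A _ hj, Function.update_self]
      congr 1
      refine Finset.prod_congr rfl fun i hi => ?_
      rw [Function.update_of_ne (Finset.ne_of_mem_erase hi)]
    rw [hp, hp, hp]
    simp only [AddMemClass.coe_add, SetLike.val_smul, Pi.add_apply, Pi.smul_apply, smul_eq_mul]
    ring
  have hz : ∀ u : ℝ≥0, rateZeta M A (psiMoment M Q u (Function.update f j (c • g + h)))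
      = fun y => c * rateZeta M A (psiMoment M Q u (Function.update f j g)) y
        + rateZeta M A (psiMoment M Q u (Function.update f j h)) y := by
    intro u
    obtain ⟨R₁, h1R₁, hR₁⟩ := exists_bound (Function.update f j g)
    obtain ⟨R₂, h1R₂, hR₂⟩ := exists_bound (Function.update f j h)
    funext y
    have hb : ∀ {R : ℝ} {f' : Fin l → B E}, 1 ≤ R → R ≤ max R₁ R₂ →
        (∀ i y, ‖(f' i : E → ℂ) y‖ ≤ R) →
        ∀ b ⊂ A, b.Nonempty → ∀ y, ‖psiMoment M Q u f' b y‖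
          ≤ (max R₁ R₂) ^ A.card * growth M K u := by
      intro R f' h1 hR hf' b hb _ y
      have hc := Finset.card_le_card hb.1
      refine (norm_psiMoment_le hQ hk hK (hc.trans hA) (zero_le_one.trans (h1.trans hR))
        (fun i y => (hf' i y).trans hR) u y).trans ?_
      have := growth_pos (M := M) K u
      have := h1.trans hR
      gcongr
    have hm : ∀ f' : Fin l → B E, ∀ b ⊂ A, b.Nonempty → Measurable (psiMoment M Q u f' b) :=
      fun f' b _ _ => measurable_psiMoment f' b (t := fun _ : E => u) (x := fun y => y)
        measurable_const measurable_id
    have hg1 : 1 ≤ growth M K u := by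
      unfold growth; linarith [Real.exp_pos ((M.rateBound * K : ℝ≥0) * u)]
    have hcongr : ∀ u' v' : B E, ∀ b, j ∉ b → psiMoment M Q u (Function.update f j u') b
        = psiMoment M Q u (Function.update f j v') b := fun u' v' b hb => funext fun y =>
      psiMoment_congr (fun i hi => by
        rw [Function.update_of_ne (ne_of_mem_of_not_mem hi hb),
          Function.update_of_ne (ne_of_mem_of_not_mem hi hb)]) u y
    exact rateZeta_linear hA hK hj (D := (max R₁ R₂) ^ A.card * growth M K u)
      (fun b hb hjb y => psiMoment_update_lin hQ hk hK ((Finset.card_le_card hb.1).trans hA)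
        hjb f c g h u y)
      (hcongr _ _) (hcongr _ _)
      (one_le_mul_of_one_le_of_one_le (one_le_pow₀ (h1R₁.trans (le_max_left _ _))) hg1)
      (hm _) (hm _) (hb h1R₁ (le_max_left _ _) hR₁) (hb h1R₂ (le_max_right _ _) hR₂) y
  obtain ⟨R₁, h1R₁, hR₁⟩ := exists_bound (Function.update f j g)
  obtain ⟨R₂, h1R₂, hR₂⟩ := exists_bound (Function.update f j h)
  have hint : ∫ s in Set.Ioc (0 : ℝ) t, psi M Q s.toNNReal
          (rateZeta M A (psiMoment M Q (t - s.toNNReal) (Function.update f j (c • g + h)))) x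
      = c * (∫ s in Set.Ioc (0 : ℝ) t, psi M Q s.toNNReal
          (rateZeta M A (psiMoment M Q (t - s.toNNReal) (Function.update f j g))) x)
        + ∫ s in Set.Ioc (0 : ℝ) t, psi M Q s.toNNReal
          (rateZeta M A (psiMoment M Q (t - s.toNNReal) (Function.update f j h))) x := by
    rw [← integral_const_mul,
      ← integral_add ((integrableOn_psi_rateZeta hQ hk hK hA h1R₁ hR₁ t x).const_mul c)
        (integrableOn_psi_rateZeta hQ hk hK hA h1R₂ hR₂ t x)]
    refine integral_congr_ae (Eventually.of_forall fun s => ?_)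
    simp only
    rw [hz, psi_lin hQ hk hK (rateZeta_psiMoment_mem_B hQ hk hK hA h1R₁ hR₁ _)
      (rateZeta_psiMoment_mem_B hQ hk hK hA h1R₂ hR₂ _)]
  rw [psiMoment_update_lin hQ hk hK hA hj, hg, hh, hfirst, hint]
  ring

/-- Multilinear extension, one coordinate at a time: `S` holds the coordinates that may be complex,
and each new one is a combination of nonnegative functions. -/
theorem satisfiesEvolution_of_nonneg_off (hA' : A.Nonempty) (t : ℝ≥0) (x : E) :
    ∀ S ⊆ A, ∀ f : Fin l → B E, (∀ i ∉ S, ∃ (F : E → ℝ≥0∞) (C : ℝ≥0), Measurable F ∧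
      (∀ y, F y ≤ C) ∧ (f i : E → ℂ) = fun y => ((F y).toReal : ℂ)) →
      SatisfiesEvolution M Q A t x f := by
  intro S
  induction S using Finset.induction_on with
  | empty =>
    intro _ f hf
    choose F C hF hC hfF using fun i => hf i (Finset.notMem_empty i)
    refine psiMoment_evolution_of_nonneg hQ hk hK hA hA' hF (C := ∑ i, C i)
      (fun i y => (hC i y).trans ?_) hfF t x
    exact_mod_cast Finset.single_le_sum (f := C) (fun _ _ => zero_le) (Finset.mem_univ i)
  | insert j S hj ih =>
    intro hS f hf
    have hjA : j ∈ A := hS (Finset.mem_insert_self j S)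
    obtain ⟨p, F, C, hp, huf⟩ := exists_nonneg_combination (f j)
    have hstep : ∀ u : B E, (∃ (F : E → ℝ≥0∞) (C : ℝ≥0), Measurable F ∧
        (∀ y, F y ≤ C) ∧ (u : E → ℂ) = fun y => ((F y).toReal : ℂ)) →
        SatisfiesEvolution M Q A t x (Function.update f j u) := fun u hu => ih ((Finset.subset_insert j S).trans hS) (Function.update f j u)
      fun i hi => by
        rcases eq_or_ne i j with rfl | hij
        · rw [Function.update_self]; exact hu
        · rw [Function.update_of_ne hij]
          exact hf i fun h => (Finset.mem_insert.1 h).elim hij hi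
    have hpn := fun n => hstep (p n) ⟨F n, C, hp n⟩
    have h0 := hstep 0 ⟨fun _ => 0, 0, measurable_const, fun _ => le_rfl, by funext y; simp⟩
    have h1 := evolution_update_lin hQ hk hK hA hjA f (-Complex.I) (p 3) 0 t x (hpn 3) h0
    have h2 := evolution_update_lin hQ hk hK hA hjA f Complex.I (p 2) _ t x (hpn 2) h1
    have h3 := evolution_update_lin hQ hk hK hA hjA f (-1) (p 1) _ t x (hpn 1) h2
    have h4 := evolution_update_lin hQ hk hK hA hjA f 1 (p 0) _ t x (hpn 0) h3
    rwa [← huf, Function.update_eq_self] at h4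

/-- The evolution equation for the moments. -/
theorem psiMoment_evolution (hA' : A.Nonempty) (f : Fin l → B E) (t : ℝ≥0) (x : E) :
    psiMoment M Q t f A x = psi M Q t (fun y => ∏ i ∈ A, (f i : E → ℂ) y) x
      + ∫ s in Set.Ioc (0 : ℝ) t,
          psi M Q s.toNNReal (rateZeta M A (psiMoment M Q (t - s.toNNReal) f)) x := by
  -- Coordinates outside `A` play no role, and setting them to zero makes them nonnegative.
  have h := satisfiesEvolution_of_nonneg_off hQ hk hK hA hA' t x A subset_rfl (fun i => if i ∈ A then f i else 0) fun i hi =>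
    ⟨fun _ => 0, 0, measurable_const, fun _ => le_rfl, by funext y; simp [hi]⟩
  have hc : ∀ (u : ℝ≥0) (b : Finset (Fin l)), b ⊆ A → ∀ y,
      psiMoment M Q u (fun i => if i ∈ A then f i else 0) b y = psiMoment M Q u f b y :=
    fun u b hb y => psiMoment_congr (fun i hi => if_pos (hb hi)) u y
  unfold SatisfiesEvolution at h
  rw [hc t A subset_rfl] at h
  have h1 : (fun y => ∏ i ∈ A, ((if i ∈ A then f i else 0 : B E) : E → ℂ) y)
      = fun y => ∏ i ∈ A, (f i : E → ℂ) y :=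
    funext fun y => Finset.prod_congr rfl fun i hi => by rw [if_pos hi]
  have h2 : ∀ u, rateZeta M A (psiMoment M Q u (fun i => if i ∈ A then f i else 0))
      = rateZeta M A (psiMoment M Q u f) := fun u =>
    rateZeta_congr M A fun b hb => funext fun y => hc u b hb.1 y
  simp only [h1, h2] at h
  exact h

end Multilinear

end Evolution

/-! ### The nilpotent operator and the leading projection. -/

namespace SpectralData

variable {E : Type*} [MeasurableSpace E] {S : SpectralData E} {ψ : ℝ≥0 → (E → ℂ) → E → ℂ}

namespace H1

theorem N_phi (hS : S.H1 ψ) {i j k : ℕ} (h : S.IsIndex i j k) (hj : 2 ≤ j) :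
    ∃ k', S.IsIndex i (j - 1) k' ∧ S.N (S.phi i j k) = S.phi i (j - 1) k' := by
  obtain ⟨⟨hi1, him⟩, ⟨hj1, hjp⟩, hk⟩ := h
  obtain ⟨ks, -, hks⟩ := hS.N_chain i j hi1 him hj hjp
  obtain ⟨h1, h2⟩ := hks k hk
  exact ⟨ks k, ⟨⟨hi1, him⟩, ⟨by omega, by omega⟩, h1⟩, h2⟩

/-- Each application of 𝓝 goes one step down a chain, and `q < j` keeps the rank at least one. -/
theorem N_pow_phi (hS : S.H1 ψ) {i j k : ℕ} (h : S.IsIndex i j k) {q : ℕ} (hq : q < j) :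
    ∃ k', S.IsIndex i (j - q) k' ∧ (S.N ^ q) (S.phi i j k) = S.phi i (j - q) k' := by
  induction q with
  | zero => exact ⟨k, h, rfl⟩
  | succ q ih =>
    obtain ⟨k', h', e⟩ := ih (by omega)
    obtain ⟨k'', h'', e'⟩ := hS.N_phi h' (by omega)
    refine ⟨k'', h'', ?_⟩
    rw [pow_succ', Module.End.mul_apply, e, e']
    rfl

theorem N_pow_phi_eq_zero (hS : S.H1 ψ) {i j k : ℕ} (h : S.IsIndex i j k) {q : ℕ} (hq : j ≤ q) :
    (S.N ^ q) (S.phi i j k) = 0 := by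
  have hj : 1 ≤ j := h.2.1.1
  obtain ⟨k', h', e⟩ := hS.N_pow_phi h (q := j - 1) (by omega)
  obtain ⟨r, rfl⟩ := Nat.exists_eq_add_of_le hq
  rw [show j - (j - 1) = 1 by omega] at h' e
  rw [show j + r = r + 1 + (j - 1) by omega, pow_add, Module.End.mul_apply, e, pow_succ,
    Module.End.mul_apply, hS.N_rank_one _ _ h', map_zero]

theorem isIndex_of_mem {i j k : ℕ} (hi : i ∈ Finset.Icc 1 S.m) (hj : j ∈ Finset.Icc 1 (S.p i))
    (hk : k ∈ Finset.Icc 1 (S.mult i j)) : S.IsIndex i j k :=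
  ⟨Finset.mem_Icc.1 hi, Finset.mem_Icc.1 hj, Finset.mem_Icc.1 hk⟩

theorem phiDual_phi (hS : S.H1 ψ) {i j k i' j' k' : ℕ} (h : S.IsIndex i j k)
    (h' : S.IsIndex i' j' k') :
    S.phiDual i j k (S.phi i' j' k') = if (i, j, k) = (i', j', k') then 1 else 0 := by
  split_ifs with e
  · obtain ⟨rfl, rfl, rfl⟩ : i = i' ∧ j = j' ∧ k = k' := by simpa using e
    exact hS.phiDual_self _ _ _ h
  · exact hS.phiDual_other _ _ _ _ _ _ h h' e

theorem phiDual_proj (hS : S.H1 ψ) {i j k : ℕ} (h : S.IsIndex i j k) (g : B E) :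
    S.phiDual i j k (∑ i' ∈ Finset.Icc 1 S.m, S.proj i' g) = S.phiDual i j k g := by
  have hi : i ∈ Finset.Icc 1 S.m := Finset.mem_Icc.2 h.1
  have hj : j ∈ Finset.Icc 1 (S.p i) := Finset.mem_Icc.2 h.2.1
  have hk : k ∈ Finset.Icc 1 (S.mult i j) := Finset.mem_Icc.2 h.2.2
  have hval : ∀ i' ∈ Finset.Icc 1 S.m, ∀ j' ∈ Finset.Icc 1 (S.p i'),
      ∀ k' ∈ Finset.Icc 1 (S.mult i' j'),
      S.phiDual i' j' k' g * S.phiDual i j k (S.phi i' j' k')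
        = if (i, j, k) = (i', j', k') then S.phiDual i j k g else 0 := by
    intro i' hi' j' hj' k' hk'
    rw [hS.phiDual_phi h (isIndex_of_mem hi' hj' hk')]
    split_ifs with e
    · obtain ⟨rfl, rfl, rfl⟩ : i = i' ∧ j = j' ∧ k = k' := by simpa using e
      rw [mul_one]
    · rw [mul_zero]
  simp only [map_sum, proj, projRank, map_smul, smul_eq_mul]
  rw [Finset.sum_congr rfl fun i' hi' => Finset.sum_congr rfl fun j' hj' =>
    Finset.sum_congr rfl fun k' hk' => hval i' hi' j' hj' k' hk',
    Finset.sum_eq_single_of_mem i hi fun i' _ hne => ?_,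
    Finset.sum_eq_single_of_mem j hj fun j' _ hne => ?_,
    Finset.sum_eq_single_of_mem k hk fun k' _ hne => ?_, if_pos rfl]
  · rw [if_neg]; simpa using fun e => hne e.symm
  · refine Finset.sum_eq_zero fun _ _ => ?_
    rw [if_neg]; simpa using fun e => absurd e.symm hne
  · refine Finset.sum_eq_zero fun _ _ => Finset.sum_eq_zero fun _ _ => ?_
    rw [if_neg]; simpa using fun e => absurd e.symm hne

/-- By biorthogonality. As 𝓝 kills `ker(λ_m)`, its positive powers see only the span of the
generalised eigenfunctions. -/
theorem sub_proj_mem_ker (hS : S.H1 ψ) (g : B E) :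
    g - ∑ i ∈ Finset.Icc 1 S.m, S.proj i g ∈ S.ker S.m := fun i j k h _ => by
  rw [map_sub, hS.phiDual_proj h, sub_self]

theorem N_eq_sum (hS : S.H1 ψ) (g : B E) : S.N g = ∑ i ∈ Finset.Icc 1 S.m, S.N (S.proj i g) := by
  have h := hS.N_ker _ (hS.sub_proj_mem_ker g)
  rwa [map_sub, sub_eq_zero, map_sum] at h

theorem N_pow_eq_sum (hS : S.H1 ψ) (g : B E) {q : ℕ} (hq : 1 ≤ q) :
    (S.N ^ q) g = ∑ i ∈ Finset.Icc 1 S.m, (S.N ^ q) (S.proj i g) := by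
  obtain ⟨q, rfl⟩ := Nat.exists_eq_add_of_le' hq
  simp only [pow_succ, Module.End.mul_apply]
  rw [hS.N_eq_sum g, map_sum]

theorem N_pow_proj (i q : ℕ) (g : B E) :
    (S.N ^ q) (S.proj i g) = ∑ j ∈ Finset.Icc 1 (S.p i), ∑ k ∈ Finset.Icc 1 (S.mult i j),
      S.phiDual i j k g • (S.N ^ q) (S.phi i j k) := by
  simp only [proj, projRank, map_sum, map_smul]

theorem N_pow_proj_eq_zero (hS : S.H1 ψ) {i q : ℕ} (hi : i ∈ Finset.Icc 1 S.m) (hq : S.p i ≤ q)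
    (g : B E) : (S.N ^ q) (S.proj i g) = 0 := by
  rw [N_pow_proj]
  refine Finset.sum_eq_zero fun j hj => Finset.sum_eq_zero fun k hk => ?_
  rw [hS.N_pow_phi_eq_zero (isIndex_of_mem hi hj hk) ((Finset.mem_Icc.1 hj).2.trans hq), smul_zero]

variable (S) in
/-- A number larger than all of the ranks `p i`. -/
def _root_.BranchingMoments.SpectralData.rankBound : ℕ := 1 + ∑ i ∈ Finset.Icc 1 S.m, S.p i

theorem p_le_rankBound {i : ℕ} (hi : i ∈ Finset.Icc 1 S.m) : S.p i ≤ S.rankBound :=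
  (Finset.single_le_sum (f := S.p) (fun _ _ => Nat.zero_le _) hi).trans (Nat.le_add_left _ _)

/-- Needed to unfold `expN`, since `IsNilpotent.exp` is the exponential series for nilpotent
elements only. -/
theorem N_pow_rankBound (hS : S.H1 ψ) : S.N ^ S.rankBound = 0 := by
  ext1 g
  rw [hS.N_pow_eq_sum g (q := S.rankBound) (Nat.le_add_right _ _), LinearMap.zero_apply]
  exact Finset.sum_eq_zero fun i hi => hS.N_pow_proj_eq_zero hi (p_le_rankBound hi) g

theorem expN_proj (hS : S.H1 ψ) {i : ℕ} (hi : i ∈ Finset.Icc 1 S.m) (t : ℝ≥0) (g : B E) (x : E) :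
    (S.expN t (S.proj i g) : E → ℂ) x = ∑ q ∈ Finset.range (S.p i),
      (((t : ℝ) ^ q / q.factorial : ℝ) : ℂ) * ((S.N ^ q) (S.proj i g) : E → ℂ) x := by
  have hnil : (((t : ℝ) : ℂ) • S.N) ^ S.rankBound = 0 := by
    rw [smul_pow, hS.N_pow_rankBound, smul_zero]
  rw [expN, IsNilpotent.exp_eq_sum hnil, LinearMap.sum_apply]
  have hterm : ∀ q : ℕ, ((((q.factorial : ℚ)⁻¹ • (((t : ℝ) : ℂ) • S.N) ^ q) (S.proj i g) : B E)
      : E → ℂ) x = (((t : ℝ) ^ q / q.factorial : ℝ) : ℂ) * ((S.N ^ q) (S.proj i g) : E → ℂ) x := by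
    intro q
    rw [← Rat.cast_smul_eq_qsmul ℂ, smul_pow, smul_smul, LinearMap.smul_apply]
    simp only [SetLike.val_smul, Pi.smul_apply, smul_eq_mul]
    push_cast
    ring
  rw [AddSubmonoidClass.coe_finsetSum, Finset.sum_apply]
  simp only [hterm]
  symm
  refine Finset.sum_subset (Finset.range_mono (p_le_rankBound hi)) fun q _ hq => ?_
  rw [hS.N_pow_proj_eq_zero hi (not_lt.1 fun h => hq (Finset.mem_range.2 h))]
  simp

theorem one_mem_Icc (hS : S.H1 ψ) : 1 ∈ Finset.Icc 1 S.m := Finset.mem_Icc.2 ⟨le_rfl, hS.one_le_m⟩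

/-- The projection on the leading eigenfunctions of highest rank. -/
theorem projRank_N_pow (hS : S.H1 ψ) (g : B E) :
    S.projRank 1 1 ((S.N ^ (S.p 1 - 1)) g) = (S.N ^ (S.p 1 - 1)) (S.proj 1 g) := by
  have hp : 1 ≤ S.p 1 := hS.one_le_p 1 le_rfl hS.one_le_m
  have h1m := hS.one_mem_Icc
  -- For `p 1 = 1` the power is the identity and does not discard `ker(λ_m)`; there the claim holds
  -- because `Φ_1 = Φ_{1,1}`.
  rcases Nat.lt_or_ge 1 (S.p 1) with h | h
  · set d := S.p 1 - 1 with hd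
    have hd1 : 1 ≤ d := by omega
    rw [hS.N_pow_eq_sum g hd1]
    have hlin : ∀ (s : Finset ℕ) (F : ℕ → B E), S.projRank 1 1 (∑ i ∈ s, F i)
        = ∑ i ∈ s, S.projRank 1 1 (F i) := by
      intro s F
      simp only [projRank, map_sum, Finset.sum_smul]
      exact Finset.sum_comm
    have hsmul : ∀ (c : ℂ) (u : B E), S.projRank 1 1 (c • u) = c • S.projRank 1 1 u := by
      intro c u
      simp only [projRank, map_smul, Finset.smul_sum, smul_smul, smul_eq_mul]
    have hz : S.projRank 1 1 (0 : B E) = 0 := by simp [projRank]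
    have hphi : ∀ {i j k : ℕ}, S.IsIndex i j k → S.projRank 1 1 (S.phi i j k)
        = if i = 1 ∧ j = 1 then S.phi i j k else 0 := by
      intro i j k hijk
      have hterm : ∀ k' ∈ Finset.Icc 1 (S.mult 1 1), S.phiDual 1 1 k' (S.phi i j k) • S.phi 1 1 k'
          = if (1, 1, k') = (i, j, k) then S.phi i j k else 0 := by
        intro k' hk'
        rw [hS.phiDual_phi (isIndex_of_mem h1m (Finset.mem_Icc.2 ⟨le_rfl, hp⟩) hk') hijk]
        split_ifs with e
        · obtain ⟨rfl, rfl, rfl⟩ : 1 = i ∧ 1 = j ∧ k' = k := by simpa using e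
          rw [one_smul]
        · rw [zero_smul]
      rw [projRank, Finset.sum_congr rfl hterm]
      split_ifs with e
      · obtain ⟨rfl, rfl⟩ := e
        rw [Finset.sum_eq_single_of_mem k (Finset.mem_Icc.2 hijk.2.2) fun k' _ hne => ?_, if_pos rfl]
        rw [if_neg]; simpa using hne
      · refine Finset.sum_eq_zero fun k' _ => ?_
        rw [if_neg]
        intro e'
        simp only [Prod.mk.injEq] at e'
        exact e ⟨e'.1.symm, e'.2.1.symm⟩
    have hNphi : ∀ i ∈ Finset.Icc 1 S.m, S.projRank 1 1 ((S.N ^ d) (S.proj i g))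
        = if i = 1 then (S.N ^ d) (S.proj 1 g) else 0 := by
      intro i hi
      rw [N_pow_proj, hlin]
      simp only [hlin, hsmul]
      split_ifs with e
      · subst e
        rw [N_pow_proj]
        refine Finset.sum_congr rfl fun j hj => Finset.sum_congr rfl fun k hk => ?_
        have hidx := isIndex_of_mem hi hj hk
        -- As `j ≤ p 1 = d + 1`, only the top rank survives `d` applications of 𝓝; it is lowered to
        -- rank one, where `Φ_{1,1}` acts as the identity.
        rcases Nat.lt_or_ge d j with hdj | hdj
        · obtain ⟨k', h', e'⟩ := hS.N_pow_phi hidx hdj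
          have hj' := (Finset.mem_Icc.1 hj).2
          rw [e', hphi h', if_pos ⟨rfl, by omega⟩]
        · rw [hS.N_pow_phi_eq_zero hidx hdj, hz]
      · refine Finset.sum_eq_zero fun j hj => Finset.sum_eq_zero fun k hk => ?_
        have hidx := isIndex_of_mem hi hj hk
        rcases Nat.lt_or_ge d j with hdj | hdj
        · obtain ⟨k', h', e'⟩ := hS.N_pow_phi hidx hdj
          rw [e', hphi h', if_neg fun h => e h.1, smul_zero]
        · rw [hS.N_pow_phi_eq_zero hidx hdj, hz, smul_zero]
    rw [hlin, Finset.sum_congr rfl hNphi, Finset.sum_ite_eq' _ _ _, if_pos h1m]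
  · have h1 : S.p 1 = 1 := le_antisymm h hp
    rw [h1, Nat.sub_self, pow_zero, Module.End.one_apply, Module.End.one_apply, proj, h1,
      Finset.Icc_self, Finset.sum_singleton]

end H1

end SpectralData

/-! ### Asymptotics of the mean semigroup. -/

theorem exists_one_add_pow_le_exp (p : ℕ) {ε : ℝ} (hε : 0 < ε) :
    ∃ C : ℝ, 0 ≤ C ∧ ∀ t : ℝ≥0, (1 + (t : ℝ)) ^ p ≤ C * Real.exp (ε * t) := by
  -- One term of the exponential series of `ε (1 + t)` suffices; the factor `e^ε` pays for the shift
  -- by one.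
  refine ⟨p.factorial * Real.exp ε / ε ^ p, by positivity, fun t => ?_⟩
  have h := Real.pow_div_factorial_le_exp (ε * (1 + t)) (by positivity) p
  rw [mul_pow, mul_add, mul_one, Real.exp_add, div_le_iff₀ (by positivity)] at h
  rw [div_mul_eq_mul_div, le_div_iff₀ (by positivity)]
  linarith

theorem tendsto_exp_mul_one_add_pow (p : ℕ) {c : ℝ} (hc : c < 0) :
    Tendsto (fun t : ℝ≥0 => Real.exp (c * t) * (1 + (t : ℝ)) ^ p) atTop (𝓝 0) := by
  obtain ⟨C, hC0, hC⟩ := exists_one_add_pow_le_exp p (ε := -c / 2) (by linarith)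
  have h1 : Tendsto (fun t : ℝ≥0 => C * Real.exp (c / 2 * t)) atTop (𝓝 (C * 0)) := by
    refine Tendsto.const_mul C (Real.tendsto_exp_atBot.comp ?_)
    exact Tendsto.const_mul_atTop_of_neg (by linarith) (NNReal.tendsto_coe_atTop.2 tendsto_id)
  rw [mul_zero] at h1
  refine squeeze_zero (fun t => by positivity) (fun t => ?_) h1
  calc Real.exp (c * t) * (1 + (t : ℝ)) ^ p ≤ Real.exp (c * t) * (C * Real.exp (-c / 2 * t)) := by
        gcongr; exact hC t
    _ = C * Real.exp (c / 2 * t) := by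
        rw [mul_left_comm, ← Real.exp_add]; congr 2; ring

theorem tendsto_inv_one_add : Tendsto (fun t : ℝ≥0 => (1 + (t : ℝ))⁻¹) atTop (𝓝 0) :=
  tendsto_inv_atTop_zero.comp
    (tendsto_atTop_add_const_left _ 1 (NNReal.tendsto_coe_atTop.2 tendsto_id))

namespace SpectralData

variable {E : Type*} [MeasurableSpace E] {S : SpectralData E} {ψ : ℝ≥0 → (E → ℂ) → E → ℂ}

/-- The leading term: `e^{-λ_1 t} (1 + t)^{-(p_1 - 1)} ψ_t[f]` converges to `S.leading f`. -/
noncomputable def leading (S : SpectralData E) (f : B E) (x : E) : ℂ :=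
  ((S.p 1 - 1).factorial : ℂ)⁻¹ * (S.projRank 1 1 ((S.N ^ (S.p 1 - 1)) f) : E → ℂ) x

namespace H1

theorem exists_bound_N_pow_proj (hS : S.H1 ψ) {i : ℕ} (hi : i ∈ Finset.Icc 1 S.m) (q : ℕ) :
    ∃ C : ℝ, 0 ≤ C ∧ ∀ f ∈ (B₁ : Set (B E)), ∀ x, ‖((S.N ^ q) (S.proj i f) : E → ℂ) x‖ ≤ C := by
  have h1 : ∀ j k, ∃ C : ℝ, 0 ≤ C ∧ (S.IsIndex i j k → ∀ f ∈ (B₁ : Set (B E)), ∀ x,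
      ‖S.phiDual i j k f * ((S.N ^ q) (S.phi i j k) : E → ℂ) x‖ ≤ C) := by
    intro j k
    by_cases h : S.IsIndex i j k
    · obtain ⟨C, hC⟩ := hS.phiDual_bounded i j k h
      obtain ⟨D, hD⟩ := ((S.N ^ q) (S.phi i j k)).2.2
      refine ⟨|C| * |D|, by positivity, fun _ f hf x => ?_⟩
      rw [norm_mul]
      exact mul_le_mul ((hC f hf).trans (le_abs_self C)) ((hD x).trans (le_abs_self D))
        (norm_nonneg _) (abs_nonneg _)
    · exact ⟨0, le_rfl, fun h' => absurd h' h⟩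
  choose C hC0 hC using h1
  refine ⟨∑ j ∈ Finset.Icc 1 (S.p i), ∑ k ∈ Finset.Icc 1 (S.mult i j), C j k,
    Finset.sum_nonneg fun j _ => Finset.sum_nonneg fun k _ => hC0 j k, fun f hf x => ?_⟩
  rw [N_pow_proj]
  simp only [AddSubmonoidClass.coe_finsetSum, Finset.sum_apply, SetLike.val_smul, Pi.smul_apply,
    smul_eq_mul]
  refine (norm_sum_le _ _).trans (Finset.sum_le_sum fun j hj => ?_)
  refine (norm_sum_le _ _).trans (Finset.sum_le_sum fun k hk => ?_)
  exact hC j k (isIndex_of_mem hi hj hk) f hf x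

/-- On the `i`-th block `e^{𝓝t}` is a polynomial in `t` of degree less than `p i`, with coefficients
bounded uniformly on the unit ball. -/
theorem exists_bound_expN_proj (hS : S.H1 ψ) {i : ℕ} (hi : i ∈ Finset.Icc 1 S.m) :
    ∃ C : ℝ, 0 ≤ C ∧ ∀ t : ℝ≥0, ∀ f ∈ (B₁ : Set (B E)), ∀ x,
      ‖Complex.exp (S.eig i * (t : ℝ)) * (S.expN t (S.proj i f) : E → ℂ) x‖
        ≤ C * (Real.exp ((S.eig i).re * t) * (1 + (t : ℝ)) ^ S.p i) := by
  choose C hC0 hC using hS.exists_bound_N_pow_proj hi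
  refine ⟨∑ q ∈ Finset.range (S.p i), C q, Finset.sum_nonneg fun q _ => hC0 q,
    fun t f hf x => ?_⟩
  have ht : (0 : ℝ) ≤ t := t.coe_nonneg
  rw [norm_mul, Complex.norm_exp, hS.expN_proj hi]
  have hre : (S.eig i * ((t : ℝ) : ℂ)).re = (S.eig i).re * t := by simp
  rw [hre, mul_left_comm]
  refine mul_le_mul_of_nonneg_left ?_ (Real.exp_pos _).le
  refine (norm_sum_le _ _).trans ?_
  rw [Finset.sum_mul]
  refine Finset.sum_le_sum fun q hq => ?_
  rw [norm_mul, Complex.norm_real, Real.norm_eq_abs, abs_of_nonneg (by positivity), mul_comm]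
  refine mul_le_mul (hC q f hf x) ?_ (by positivity) (hC0 q)
  calc (t : ℝ) ^ q / q.factorial ≤ (t : ℝ) ^ q :=
        div_le_self (by positivity) (by exact_mod_cast q.factorial_pos)
    _ ≤ (1 + (t : ℝ)) ^ q := by gcongr; linarith
    _ ≤ _ := pow_le_pow_right₀ (by linarith) (Finset.mem_range.1 hq).le

theorem exists_error (hS : S.H1 ψ) : ∃ δ : ℝ≥0 → ℝ, Tendsto δ atTop (𝓝 0) ∧
    ∀ᶠ t : ℝ≥0 in atTop, ∀ f ∈ (B₁ : Set (B E)), ∀ x,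
      ‖ψ t (f : E → ℂ) x - ∑ i ∈ Finset.Icc 1 S.m,
        Complex.exp (S.eig i * (t : ℝ)) * (S.expN t (S.proj i f) : E → ℂ) x‖
        ≤ δ t * Real.exp ((S.eig S.m).re * t) := by
  have h := hS.asymptotics
  set G : ℝ≥0 → ℝ≥0∞ := fun t => ⨆ (x : E) (f : B E) (_ : f ∈ B₁),
      ‖(Real.exp (-(S.eig S.m).re * t) : ℂ) * (ψ t (f : E → ℂ) x
        - ∑ i ∈ Finset.Icc 1 S.m,
            Complex.exp (S.eig i * (t : ℝ)) * (S.expN t (S.proj i f) : E → ℂ) x)‖ₑ with hG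
  have hG0 : Tendsto (fun t => (G t).toReal) atTop (𝓝 (0 : ℝ≥0∞).toReal) :=
    (ENNReal.tendsto_toReal ENNReal.zero_ne_top).comp h
  refine ⟨fun t => (G t).toReal, hG0, ?_⟩
  filter_upwards [h.eventually (gt_mem_nhds ENNReal.zero_lt_top)] with t ht f hf x
  have h1 : ‖(Real.exp (-(S.eig S.m).re * t) : ℂ) * (ψ t (f : E → ℂ) x
        - ∑ i ∈ Finset.Icc 1 S.m,
            Complex.exp (S.eig i * (t : ℝ)) * (S.expN t (S.proj i f) : E → ℂ) x)‖ₑ ≤ G t :=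
    le_iSup_of_le x (le_iSup_of_le f (le_iSup_of_le hf le_rfl))
  rw [← ofReal_norm] at h1
  have h2 := (ENNReal.ofReal_le_iff_le_toReal ht.ne).1 h1
  rw [norm_mul, Complex.norm_real, Real.norm_eq_abs, abs_of_pos (Real.exp_pos _)] at h2
  rw [← div_le_iff₀ (Real.exp_pos _), div_eq_mul_inv, ← Real.exp_neg, mul_comm, ← neg_mul]
  exact h2

theorem eig_one_eq (hS : S.H1 ψ) : S.eig 1 = ((S.eig 1).re : ℂ) :=
  Complex.ext rfl (by rw [hS.eig_one_im, Complex.ofReal_im])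

theorem eig_m_le (hS : S.H1 ψ) : (S.eig S.m).re ≤ (S.eig 1).re := by
  rcases eq_or_lt_of_le hS.one_le_m with h | h
  · rw [← h]
  · exact (hS.eig_lt S.m h le_rfl).le

theorem leading_eq (hS : S.H1 ψ) (f : B E) (x : E) : S.leading f x
    = ((S.p 1 - 1).factorial : ℂ)⁻¹ * ((S.N ^ (S.p 1 - 1)) (S.proj 1 f) : E → ℂ) x := by
  rw [leading, hS.projRank_N_pow]

theorem exists_bound_leading (hS : S.H1 ψ) :
    ∃ C : ℝ, 0 ≤ C ∧ ∀ f ∈ (B₁ : Set (B E)), ∀ x, ‖S.leading f x‖ ≤ C := by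
  obtain ⟨C, hC0, hC⟩ := hS.exists_bound_N_pow_proj hS.one_mem_Icc (S.p 1 - 1)
  refine ⟨C, hC0, fun f hf x => ?_⟩
  rw [hS.leading_eq, norm_mul, norm_inv, Complex.norm_natCast]
  calc _ ≤ 1 * C := by
        refine mul_le_mul (inv_le_one_of_one_le₀ ?_) (hC f hf x) (norm_nonneg _) zero_le_one
        exact_mod_cast (S.p 1 - 1).factorial_pos
    _ = C := one_mul C

/-- The first block of the spectral expansion. -/
theorem exists_first_block (hS : S.H1 ψ) : ∃ C : ℝ, ∀ t : ℝ≥0, ∀ f ∈ (B₁ : Set (B E)), ∀ x,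
    ‖((Real.exp (-((S.eig 1).re * t)) * ((1 + (t : ℝ)) ^ (S.p 1 - 1))⁻¹ : ℝ) : ℂ) *
        (Complex.exp (S.eig 1 * (t : ℝ)) * (S.expN t (S.proj 1 f) : E → ℂ) x) - S.leading f x‖
      ≤ C * (1 + (t : ℝ))⁻¹ := by
  set d := S.p 1 - 1 with hd
  have hp : S.p 1 = d + 1 := (Nat.sub_add_cancel (hS.one_le_p 1 le_rfl hS.one_le_m)).symm
  choose C hC0 hC using hS.exists_bound_N_pow_proj hS.one_mem_Icc
  refine ⟨∑ q ∈ Finset.range d, C q + d * C d, fun t f hf x => ?_⟩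
  have ht : (0 : ℝ) ≤ t := t.coe_nonneg
  have ht1 : (1 : ℝ) ≤ 1 + t := by linarith
  set v : ℕ → ℂ := fun q => ((S.N ^ q) (S.proj 1 f) : E → ℂ) x with hv
  -- The exponentials cancel because `λ_1` is real. The powers `q < d` are of lower order and the
  -- power `d` carries the limit.
  have e1 : ((Real.exp (-((S.eig 1).re * t)) * ((1 + (t : ℝ)) ^ d)⁻¹ : ℝ) : ℂ) *
        (Complex.exp (S.eig 1 * (t : ℝ)) * (S.expN t (S.proj 1 f) : E → ℂ) x) - S.leading f x
      = ∑ q ∈ Finset.range d, (((t : ℝ) ^ q / q.factorial * ((1 + (t : ℝ)) ^ d)⁻¹ : ℝ) : ℂ) * v q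
        + ((((t : ℝ) / (1 + t)) ^ d - 1 : ℝ) : ℂ) * ((d.factorial : ℂ)⁻¹ * v d) := by
    have he : ((Real.exp (-((S.eig 1).re * t)) : ℝ) : ℂ) * Complex.exp (S.eig 1 * (t : ℝ)) = 1 := by
      rw [hS.eig_one_eq, Complex.ofReal_exp, ← Complex.exp_add]
      simp
    rw [hS.leading_eq, hS.expN_proj hS.one_mem_Icc, hp, Finset.sum_range_succ]
    rw [Complex.ofReal_mul]
    calc _ = ((Real.exp (-((S.eig 1).re * t)) : ℝ) : ℂ) * ((((1 + (t : ℝ)) ^ d)⁻¹ : ℝ) : ℂ)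
          * (Complex.exp (S.eig 1 * (t : ℝ)) * (∑ q ∈ Finset.range d,
            (((t : ℝ) ^ q / q.factorial : ℝ) : ℂ) * v q + (((t : ℝ) ^ d / d.factorial : ℝ) : ℂ) * v d))
          - (d.factorial : ℂ)⁻¹ * v d := rfl
      _ = (((Real.exp (-((S.eig 1).re * t)) : ℝ) : ℂ) * Complex.exp (S.eig 1 * (t : ℝ)))
          * ((((1 + (t : ℝ)) ^ d)⁻¹ : ℝ) : ℂ) * (∑ q ∈ Finset.range d,
            (((t : ℝ) ^ q / q.factorial : ℝ) : ℂ) * v q + (((t : ℝ) ^ d / d.factorial : ℝ) : ℂ) * v d)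
          - (d.factorial : ℂ)⁻¹ * v d := by ring
      _ = _ := by
          rw [he, one_mul, mul_add, Finset.mul_sum, add_sub_assoc]
          congr 1
          · refine Finset.sum_congr rfl fun q _ => ?_
            push_cast; ring
          · push_cast
            rw [div_pow]
            ring
  rw [e1, add_mul, Finset.sum_mul]
  refine (norm_add_le _ _).trans (add_le_add ?_ ?_)
  · refine (norm_sum_le _ _).trans (Finset.sum_le_sum fun q hq => ?_)
    rw [norm_mul, Complex.norm_real, Real.norm_eq_abs, abs_of_nonneg (by positivity), mul_comm]
    refine mul_le_mul (hC q f hf x) ?_ (by positivity) (hC0 q)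
    rw [← div_eq_mul_inv, div_le_iff₀ (by positivity)]
    have hqd := Finset.mem_range.1 hq
    calc (t : ℝ) ^ q / q.factorial ≤ (t : ℝ) ^ q :=
          div_le_self (by positivity) (by exact_mod_cast q.factorial_pos)
      _ ≤ (1 + (t : ℝ)) ^ q := by gcongr; linarith
      _ ≤ (1 + (t : ℝ)) ^ (d - 1) := pow_le_pow_right₀ ht1 (by omega)
      _ = (1 + (t : ℝ))⁻¹ * (1 + (t : ℝ)) ^ d := by
          obtain ⟨r, hr⟩ : ∃ r, d = r + 1 := ⟨d - 1, by omega⟩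
          rw [hr, Nat.add_sub_cancel, pow_succ]
          field_simp
  · have hb : 1 - d * (1 + (t : ℝ))⁻¹ ≤ ((t : ℝ) / (1 + t)) ^ d := by
      have h := one_add_mul_le_pow (a := -(1 + (t : ℝ))⁻¹) (by
        have := inv_le_one_of_one_le₀ ht1
        linarith) d
      have e : (t : ℝ) / (1 + t) = 1 + -(1 + (t : ℝ))⁻¹ := by field_simp; ring
      rw [e]
      linarith
    have hb' : ((t : ℝ) / (1 + t)) ^ d ≤ 1 :=
      pow_le_one₀ (by positivity) ((div_le_one (by positivity)).2 (by linarith))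
    have hvd : ‖(d.factorial : ℂ)⁻¹ * v d‖ ≤ C d := by
      rw [norm_mul, norm_inv, Complex.norm_natCast]
      calc _ ≤ 1 * C d := by
            refine mul_le_mul (inv_le_one_of_one_le₀ ?_) (hC d f hf x) (norm_nonneg _) zero_le_one
            exact_mod_cast d.factorial_pos
        _ = C d := one_mul _
    rw [norm_mul, Complex.norm_real, Real.norm_eq_abs, abs_of_nonpos (by linarith)]
    calc _ ≤ (d * (1 + (t : ℝ))⁻¹) * C d :=
          mul_le_mul (by linarith) hvd (norm_nonneg _) (by positivity)
      _ = _ := by ring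

/-- The leading asymptotics of the semigroup. -/
theorem exists_leading_error (hS : S.H1 ψ) : ∃ δ : ℝ≥0 → ℝ, Tendsto δ atTop (𝓝 0) ∧
    ∀ᶠ t : ℝ≥0 in atTop, ∀ f ∈ (B₁ : Set (B E)), ∀ x,
      ‖((Real.exp (-((S.eig 1).re * t)) * ((1 + (t : ℝ)) ^ (S.p 1 - 1))⁻¹ : ℝ) : ℂ) *
        ψ t (f : E → ℂ) x - S.leading f x‖ ≤ δ t := by
  obtain ⟨δ, hδ, hδ'⟩ := hS.exists_error
  obtain ⟨C₁, hC₁⟩ := hS.exists_first_block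
  have hC := fun i : (Finset.Icc 1 S.m) => hS.exists_bound_expN_proj i.2
  choose C hC0 hC using hC
  -- The blocks other than the first: their eigenvalues have strictly smaller real part, which beats
  -- the polynomial factors.
  set I := (Finset.univ : Finset (Finset.Icc 1 S.m)).erase ⟨1, hS.one_mem_Icc⟩ with hI
  have hIlt : ∀ i ∈ I, (S.eig i).re - (S.eig 1).re < 0 := by
    intro i hi
    have h1 : i.1 ≠ 1 := fun h => (Finset.ne_of_mem_erase hi) (Subtype.ext h)
    have h2 := Finset.mem_Icc.1 i.2
    have := hS.eig_lt i.1 (by omega) h2.2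
    linarith
  refine ⟨fun t => |δ t| + ∑ i ∈ I, C i *
    (Real.exp (((S.eig i).re - (S.eig 1).re) * t) * (1 + (t : ℝ)) ^ S.p i)
    + C₁ * (1 + (t : ℝ))⁻¹, ?_, ?_⟩
  · have h1 := hδ.abs
    have h2 : Tendsto (fun t : ℝ≥0 => ∑ i ∈ I, C i *
        (Real.exp (((S.eig i).re - (S.eig 1).re) * t) * (1 + (t : ℝ)) ^ S.p i)) atTop
        (𝓝 (∑ i ∈ I, C i * 0)) :=
      tendsto_finsetSum _ fun i hi => (tendsto_exp_mul_one_add_pow _ (hIlt i hi)).const_mul _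
    have h3 := tendsto_inv_one_add.const_mul C₁
    simpa using (h1.add h2).add h3
  filter_upwards [hδ'] with t ht f hf x
  have ht0 : (0 : ℝ) ≤ t := t.coe_nonneg
  set w : ℝ := Real.exp (-((S.eig 1).re * t)) * ((1 + (t : ℝ)) ^ (S.p 1 - 1))⁻¹ with hw
  set T : ℕ → ℂ := fun i => Complex.exp (S.eig i * (t : ℝ)) * (S.expN t (S.proj i f) : E → ℂ) x
    with hT
  have hw0 : 0 ≤ w := by positivity
  have hw1 : w ≤ Real.exp (-((S.eig 1).re * t)) := mul_le_of_le_one_right (Real.exp_pos _).le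
    (inv_le_one_of_one_le₀ (one_le_pow₀ (by linarith)))
  have hnw : ‖(w : ℂ)‖ = w := by rw [Complex.norm_real, Real.norm_eq_abs, abs_of_nonneg hw0]
  have hsum : ∑ i ∈ Finset.Icc 1 S.m, T i = T 1 + ∑ i ∈ I, T i := by
    rw [← Finset.sum_coe_sort, ← Finset.add_sum_erase _ _ (Finset.mem_univ ⟨1, hS.one_mem_Icc⟩)]
  have e : (w : ℂ) * ψ t (f : E → ℂ) x - S.leading f x
      = w * (ψ t (f : E → ℂ) x - ∑ i ∈ Finset.Icc 1 S.m, T i) + ∑ i ∈ I, w * T i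
        + (w * T 1 - S.leading f x) := by
    rw [hsum, ← Finset.mul_sum]; ring
  rw [e]
  refine (norm_add_le _ _).trans (add_le_add ((norm_add_le _ _).trans (add_le_add ?_ ?_)) ?_)
  · rw [norm_mul, hnw]
    calc w * _ ≤ Real.exp (-((S.eig 1).re * t)) * (|δ t| * Real.exp ((S.eig S.m).re * t)) := by
          refine mul_le_mul hw1 ((ht f hf x).trans ?_) (norm_nonneg _) (Real.exp_pos _).le
          gcongr
          exact le_abs_self _
      _ = |δ t| * Real.exp (((S.eig S.m).re - (S.eig 1).re) * t) := by
          rw [mul_left_comm, ← Real.exp_add]; congr 2; ring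
      _ ≤ |δ t| * 1 := by
          gcongr
          rw [Real.exp_le_one_iff]
          exact mul_nonpos_of_nonpos_of_nonneg (by linarith [hS.eig_m_le]) ht0
      _ = |δ t| := mul_one _
  · refine (norm_sum_le _ _).trans (Finset.sum_le_sum fun i _ => ?_)
    rw [norm_mul, hnw]
    calc w * ‖T i‖ ≤ Real.exp (-((S.eig 1).re * t))
          * (C i * (Real.exp ((S.eig i).re * t) * (1 + (t : ℝ)) ^ S.p i)) :=
          mul_le_mul hw1 (hC i t f hf x) (norm_nonneg _) (Real.exp_pos _).le
      _ = C i * ((Real.exp (-((S.eig 1).re * t)) * Real.exp ((S.eig i).re * t))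
          * (1 + (t : ℝ)) ^ S.p i) := by ring
      _ = _ := by rw [← Real.exp_add]; congr 4; ring
  · exact hC₁ t f hf x

theorem proj_eq_zero {n i : ℕ} (hi : i ∈ Finset.Icc 1 S.m) (hin : i ≤ n) {f : B E}
    (hf : f ∈ S.ker n) : S.proj i f = 0 := by
  refine Finset.sum_eq_zero fun j hj => Finset.sum_eq_zero fun k hk => ?_
  rw [hf i j k (isIndex_of_mem hi hj hk) hin, zero_smul]

/-- The real parts are nonincreasing from the second index on, so the threshold `λ_1 / 2` is crossed
only once. -/
theorem isFirstSmall_unique (hS : S.H1 ψ) {n n' : ℕ} (h : S.IsFirstSmall n)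
    (h' : S.IsFirstSmall n') : n = n' := by
  obtain ⟨h2, hm, h3, h4⟩ := h
  obtain ⟨h2', hm', h3', h4'⟩ := h'
  rcases lt_trichotomy n n' with hlt | heq | hlt
  · have := hS.eig_anti n (n' - 1) h2 (by omega) (by omega)
    linarith
  · exact heq
  · have := hS.eig_anti n' (n - 1) h2' (by omega) (by omega)
    linarith

/-- The semigroup grows at a rate less than half of the leading one on the small space. -/
theorem exists_small_growth (hS : S.H1 ψ) : ∃ β C : ℝ, 0 < β ∧ 2 * β < (S.eig 1).re ∧
    ∀ᶠ t : ℝ≥0 in atTop, ∀ f ∈ S.smallSpaceOne, ∀ x,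
      ‖ψ t (f : E → ℂ) x‖ ≤ C * Real.exp (β * t) := by
  have ha := hS.eig_one_pos
  by_cases hex : ∃ n, S.IsFirstSmall n
  swap
  -- Without a first small eigenvalue the small space is empty and any constants do.
  · refine ⟨(S.eig 1).re / 4, 0, by linarith, by linarith, Eventually.of_forall
      fun t f hf => absurd ?_ hex⟩
    obtain ⟨n, hn, -⟩ := hf.1
    exact ⟨n, hn⟩
  obtain ⟨n, hn⟩ := hex
  obtain ⟨h2, hnm, h3, h4⟩ := hn
  -- The maximum with `0` keeps `β` positive; it stays below `λ_1 / 2` because `λ_1 > 0`.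
  set r := max (S.eig n).re 0 with hr
  have hr2 : 2 * r < (S.eig 1).re := by
    rcases max_choice (S.eig n).re 0 with h | h <;> rw [hr, h] <;> linarith
  -- The midpoint of `r` and `λ_1 / 2`; the gap `β - r` absorbs the polynomial factors.
  set β := (r + (S.eig 1).re / 2) / 2 with hβ
  have hrβ : r < β := by rw [hβ]; linarith
  have hr0 : 0 ≤ r := le_max_right _ _
  obtain ⟨δ, hδ, hδ'⟩ := hS.exists_error
  have hC := fun i : (Finset.Icc 1 S.m) => hS.exists_bound_expN_proj i.2
  choose C hC0 hC using hC
  have hD := fun i : (Finset.Icc 1 S.m) =>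
    exists_one_add_pow_le_exp (S.p i) (ε := β - r) (by linarith)
  choose D hD0 hD using hD
  have hre : ∀ i, n ≤ i → i ≤ S.m → (S.eig i).re ≤ r := fun i hi him =>
    (hS.eig_anti n i h2 hi him).trans (le_max_left _ _)
  refine ⟨β, 1 + ∑ i, C i * D i, by linarith, by rw [hβ]; linarith, ?_⟩
  filter_upwards [hδ', hδ.eventually (gt_mem_nhds zero_lt_one)] with t ht hδt f hf x
  obtain ⟨⟨n', hn', hfk⟩, hf1⟩ := hf
  rw [hS.isFirstSmall_unique hn' ⟨h2, hnm, h3, h4⟩] at hfk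
  have ht0 : (0 : ℝ) ≤ t := t.coe_nonneg
  set T : ℕ → ℂ := fun i => Complex.exp (S.eig i * (t : ℝ)) * (S.expN t (S.proj i f) : E → ℂ) x
    with hT
  have e : ψ t (f : E → ℂ) x = (ψ t (f : E → ℂ) x - ∑ i ∈ Finset.Icc 1 S.m, T i)
      + ∑ i ∈ Finset.Icc 1 S.m, T i := by ring
  rw [e, add_mul, one_mul, Finset.sum_mul]
  refine (norm_add_le _ _).trans (add_le_add ?_ ?_)
  · refine (ht f hf1 x).trans ?_
    calc δ t * Real.exp ((S.eig S.m).re * t) ≤ 1 * Real.exp (β * t) := by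
          gcongr
          exact (hre S.m hnm le_rfl).trans hrβ.le
      _ = _ := one_mul _
  · rw [← Finset.sum_coe_sort]
    refine (norm_sum_le _ _).trans (Finset.sum_le_sum fun i _ => ?_)
    have hi := Finset.mem_Icc.1 i.2
    rcases Nat.lt_or_ge i.1 n with hin | hin
    -- Blocks before the threshold vanish by the definition of the small space.
    · have h0 : T i = 0 := by
        simp only [hT]
        rw [proj_eq_zero i.2 (by omega) hfk]
        simp
      rw [h0, norm_zero]
      have := hC0 i
      have := hD0 i
      positivity
    · calc ‖T i‖ ≤ C i * (Real.exp ((S.eig i).re * t) * (1 + (t : ℝ)) ^ S.p i) := hC i t f hf1 x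
        _ ≤ C i * (Real.exp (r * t) * (D i * Real.exp ((β - r) * t))) := by
            have := hC0 i
            gcongr
            · exact hre i hin hi.2
            · exact hD i t
        _ = C i * D i * (Real.exp (r * t) * Real.exp ((β - r) * t)) := by ring
        _ = C i * D i * Real.exp (β * t) := by rw [← Real.exp_add]; congr 2; ring

end H1

end SpectralData

/-- Dominated convergence for integrals over `(0, t]`, uniformly over a set of parameters. -/
theorem tendsto_setIntegral_Ioc_sub {ι : Type*} {P : Set ι} {Φ : ℝ≥0 → ι → ℝ → ℂ} {Λ : ι → ℝ → ℂ}
    {bd : ℝ → ℝ} (hbd : IntegrableOn bd (Set.Ioi 0))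
    (hΦm : ∀ t, ∀ p ∈ P, Measurable (Φ t p)) (hΛm : ∀ p ∈ P, Measurable (Λ p))
    (hΦ : ∀ (t : ℝ≥0), ∀ p ∈ P, ∀ u ∈ Set.Ioc (0 : ℝ) t, ‖Φ t p u‖ ≤ bd u)
    (hΛ : ∀ p ∈ P, ∀ u, 0 < u → ‖Λ p u‖ ≤ bd u)
    (hlim : ∀ u, 0 < u →
      Tendsto (fun q : ℝ≥0 × ι => Φ q.1 q.2 u - Λ q.2 u) (atTop ×ˢ 𝓟 P) (𝓝 0)) :
    (∀ (t : ℝ≥0), ∀ p ∈ P, ‖∫ u in Set.Ioc (0 : ℝ) t, Φ t p u‖ ≤ ∫ u in Set.Ioi (0 : ℝ), bd u) ∧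
    (∀ p ∈ P, IntegrableOn (Λ p) (Set.Ioi 0)) ∧
    Tendsto (fun q : ℝ≥0 × ι => (∫ u in Set.Ioc (0 : ℝ) q.1, Φ q.1 q.2 u)
      - ∫ u in Set.Ioi (0 : ℝ), Λ q.2 u) (atTop ×ˢ 𝓟 P) (𝓝 0) := by
  have hbd0 : ∀ p ∈ P, ∀ u, 0 < u → 0 ≤ bd u := fun p hp u hu =>
    (norm_nonneg _).trans (hΛ p hp u hu)
  have hind : ∀ (t : ℝ≥0), ∀ p ∈ P, ∀ u, 0 < u →
      ‖(Set.Ioc (0 : ℝ) t).indicator (Φ t p) u‖ ≤ bd u := by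
    intro t p hp u hu
    by_cases h : u ∈ Set.Ioc (0 : ℝ) t
    · rw [Set.indicator_of_mem h]; exact hΦ t p hp u h
    · rw [Set.indicator_of_notMem h, norm_zero]; exact hbd0 p hp u hu
  have hindm : ∀ (t : ℝ≥0), ∀ p ∈ P, Measurable ((Set.Ioc (0 : ℝ) t).indicator (Φ t p)) :=
    fun t p hp => (hΦm t p hp).indicator measurableSet_Ioc
  have hindi : ∀ (t : ℝ≥0), ∀ p ∈ P,
      IntegrableOn ((Set.Ioc (0 : ℝ) t).indicator (Φ t p)) (Set.Ioi 0) := fun t p hp =>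
    Integrable.mono' hbd (hindm t p hp).aestronglyMeasurable
      ((ae_restrict_iff' measurableSet_Ioi).2 (Eventually.of_forall fun u hu => hind t p hp u hu))
  have hinteq : ∀ (t : ℝ≥0) p, ∫ u in Set.Ioc (0 : ℝ) t, Φ t p u
      = ∫ u in Set.Ioi (0 : ℝ), (Set.Ioc (0 : ℝ) t).indicator (Φ t p) u := by
    intro t p
    rw [setIntegral_indicator measurableSet_Ioc, Set.inter_eq_right.2 Set.Ioc_subset_Ioi_self]
  have hΛi : ∀ p ∈ P, IntegrableOn (Λ p) (Set.Ioi 0) := fun p hp =>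
    Integrable.mono' hbd (hΛm p hp).aestronglyMeasurable
      ((ae_restrict_iff' measurableSet_Ioi).2 (Eventually.of_forall fun u hu => hΛ p hp u hu))
  refine ⟨fun t p hp => ?_, hΛi, ?_⟩
  · rw [hinteq]
    exact norm_integral_le_of_norm_le hbd
      ((ae_restrict_iff' measurableSet_Ioi).2 (Eventually.of_forall fun u hu => hind t p hp u hu))
  · have hmem : ∀ᶠ q : ℝ≥0 × ι in atTop ×ˢ 𝓟 P, q.2 ∈ P :=
      eventually_prod_principal_iff.2 (Eventually.of_forall fun _ p hp => hp)
    -- Dominated convergence along the countably generated filter `atTop ×ˢ 𝓟 P`: convergence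
    -- uniform in the parameter at each `u` passes to the integrals.
    have h1 : Tendsto (fun q : ℝ≥0 × ι => ∫ u in Set.Ioi (0 : ℝ),
        ((Set.Ioc (0 : ℝ) q.1).indicator (Φ q.1 q.2) u - Λ q.2 u)) (atTop ×ˢ 𝓟 P)
        (𝓝 (∫ _ in Set.Ioi (0 : ℝ), (0 : ℂ))) := by
      refine tendsto_integral_filter_of_dominated_convergence (fun u => bd u + bd u) ?_ ?_
        (hbd.add hbd) ?_
      · filter_upwards [hmem] with q hq
        exact ((hindm _ _ hq).sub (hΛm _ hq)).aestronglyMeasurable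
      · filter_upwards [hmem] with q hq
        refine (ae_restrict_iff' measurableSet_Ioi).2 (Eventually.of_forall fun u hu => ?_)
        exact (norm_sub_le _ _).trans (add_le_add (hind _ _ hq u hu) (hΛ _ hq u hu))
      · refine (ae_restrict_iff' measurableSet_Ioi).2 (Eventually.of_forall fun u hu => ?_)
        refine (hlim u hu).congr' ?_
        have hev : ∀ᶠ q : ℝ≥0 × ι in atTop ×ˢ 𝓟 P, u.toNNReal ≤ q.1 :=
          eventually_prod_principal_iff.2
            ((eventually_ge_atTop u.toNNReal).mono fun t ht _ _ => ht)
        filter_upwards [hev] with q hq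
        rw [Set.indicator_of_mem]
        exact ⟨hu, Real.toNNReal_le_iff_le_coe.1 hq⟩
    rw [integral_zero] at h1
    refine h1.congr' ?_
    filter_upwards [hmem] with q hq
    rw [hinteq, integral_sub (hindi _ _ hq) (hΛi _ hq)]

/-! ### The normalising weight. -/

namespace SpectralData

variable {E : Type*} [MeasurableSpace E] (S : SpectralData E)

/-- The normalisation of the first moments in the small regime. -/
noncomputable def weight (t : ℝ≥0) : ℝ :=
  Real.exp (-((S.eig 1).re * t / 2)) * (1 + (t : ℝ)) ^ (-(((S.p 1 - 1 : ℕ) : ℝ) / 2))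

theorem weight_pos (t : ℝ≥0) : 0 < S.weight t :=
  mul_pos (Real.exp_pos _) (Real.rpow_pos_of_pos (by positivity) _)

theorem weight_sq (t : ℝ≥0) : S.weight t ^ 2
    = Real.exp (-((S.eig 1).re * t)) * ((1 + (t : ℝ)) ^ (S.p 1 - 1))⁻¹ := by
  have h : (0 : ℝ) ≤ 1 + t := by positivity
  rw [weight, mul_pow, ← Real.exp_nat_mul, ← Real.rpow_mul_natCast h]
  congr 1
  · congr 1; push_cast; ring
  · rw [← Real.rpow_natCast, ← Real.rpow_neg h]; congr 1; push_cast; ring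

theorem weight_sq_mul (t : ℝ≥0) :
    S.weight t ^ 2 * (Real.exp ((S.eig 1).re * t) * (1 + (t : ℝ)) ^ (S.p 1 - 1)) = 1 := by
  rw [S.weight_sq, Real.exp_neg]
  have : (0 : ℝ) < 1 + t := by positivity
  field_simp

theorem weight_le_exp (t : ℝ≥0) : S.weight t ≤ Real.exp (-((S.eig 1).re * t / 2)) :=
  mul_le_of_le_one_right (Real.exp_pos _).le
    (Real.rpow_le_one_of_one_le_of_nonpos (by simp) (neg_nonpos.2 (by positivity)))

theorem weight_le_one {S : SpectralData E} (ha : 0 ≤ (S.eig 1).re) (t : ℝ≥0) : S.weight t ≤ 1 :=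
  (S.weight_le_exp t).trans (Real.exp_le_one_iff.2 (neg_nonpos.2 (by positivity)))

/-- The polynomial factor of the weight is nonincreasing. This supplies the domination; the limit of
the same ratio is `tendsto_weight_div`. -/
theorem weight_le_mul {s t : ℝ≥0} (h : s ≤ t) :
    S.weight t ≤ Real.exp (-((S.eig 1).re * s / 2)) * S.weight (t - s) := by
  rw [weight, weight, ← mul_assoc, ← Real.exp_add, NNReal.coe_sub h]
  have h1 : (1 + (t : ℝ)) ^ (-(((S.p 1 - 1 : ℕ) : ℝ) / 2))
      ≤ (1 + ((t : ℝ) - s)) ^ (-(((S.p 1 - 1 : ℕ) : ℝ) / 2)) := by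
    refine Real.rpow_le_rpow_of_nonpos ?_ ?_ (neg_nonpos.2 (by positivity))
    · have : (s : ℝ) ≤ t := h
      linarith
    · have : (0 : ℝ) ≤ s := s.coe_nonneg
      linarith
  calc _ ≤ Real.exp (-((S.eig 1).re * t / 2)) * (1 + ((t : ℝ) - s)) ^ (-(((S.p 1 - 1 : ℕ) : ℝ) / 2)) :=
        mul_le_mul_of_nonneg_left h1 (Real.exp_pos _).le
    _ = _ := by congr 2; ring

theorem tendsto_weight_div (s : ℝ≥0) : Tendsto (fun t : ℝ≥0 => S.weight t / S.weight (t - s)) atTop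
    (𝓝 (Real.exp (-((S.eig 1).re * s / 2)))) := by
  set c : ℝ := -(((S.p 1 - 1 : ℕ) : ℝ) / 2)
  have h1 : Tendsto (fun t : ℝ≥0 => ((1 + (t : ℝ) - s) / (1 + t))) atTop (𝓝 1) := by
    have h2 : Tendsto (fun t : ℝ≥0 => 1 - (s : ℝ) * (1 + (t : ℝ))⁻¹) atTop (𝓝 (1 - s * 0)) :=
      tendsto_const_nhds.sub (tendsto_inv_one_add.const_mul _)
    rw [mul_zero, sub_zero] at h2
    refine h2.congr fun t => ?_
    have : (0 : ℝ) < 1 + t := by positivity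
    field_simp
  have h3 : Tendsto (fun t : ℝ≥0 => Real.exp (-((S.eig 1).re * s / 2))
      * ((1 + (t : ℝ) - s) / (1 + t)) ^ (-c)) atTop
      (𝓝 (Real.exp (-((S.eig 1).re * s / 2)) * (1 : ℝ) ^ (-c))) :=
    (h1.rpow_const (Or.inl one_ne_zero)).const_mul _
  rw [Real.one_rpow, mul_one] at h3
  refine h3.congr' ?_
  filter_upwards [eventually_ge_atTop s] with t ht
  have hst : (s : ℝ) ≤ t := ht
  have p1 : (0 : ℝ) < 1 + t := by positivity
  have p2 : (0 : ℝ) < 1 + t - s := by linarith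
  rw [weight, weight, NNReal.coe_sub ht, mul_div_mul_comm, ← Real.exp_sub,
    Real.div_rpow p2.le p1.le, Real.rpow_neg p2.le, Real.rpow_neg p1.le, ← add_sub_assoc]
  congr 1
  · congr 1; ring
  · change _ = (1 + (t : ℝ)) ^ c / (1 + (t : ℝ) - s) ^ c
    field_simp

end SpectralData

/-! ### Semigroup bounds for all times and all bounded functions. -/

section Scaling

variable {E Ξ : Type*} [MeasurableSpace E] [MeasurableSpace Ξ] {M : BranchingModel E Ξ}
  {Q : Kernel E (Tree E Ξ)} {S : SpectralData E}

theorem SpectralData.leading_smul (c : ℂ) (f : B E) (x : E) :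
    S.leading (c • f) x = c * S.leading f x := by
  simp only [SpectralData.leading, SpectralData.projRank, map_smul, smul_eq_mul]
  simp only [AddSubmonoidClass.coe_finsetSum, Finset.sum_apply, SetLike.val_smul, Pi.smul_apply,
    smul_eq_mul, Finset.mul_sum]
  refine Finset.sum_congr rfl fun _ _ => ?_
  ring

theorem SpectralData.smul_mem_smallSpace (c : ℂ) {f : B E} (hf : f ∈ S.smallSpace) :
    c • f ∈ S.smallSpace := by
  obtain ⟨n, hn, h⟩ := hf
  exact ⟨n, hn, fun i j k hi hin => by rw [map_smul, h i j k hi hin, smul_zero]⟩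

theorem smul_inv_mem_B₁ {f : B E} {R : ℝ} (hR : 0 < R) (hf : ∀ y, ‖(f : E → ℂ) y‖ ≤ R) :
    ((R⁻¹ : ℝ) : ℂ) • f ∈ (B₁ : Set (B E)) := fun y => by
  simp only [SetLike.val_smul, Pi.smul_apply, smul_eq_mul]
  rw [norm_mul, Complex.norm_real, Real.norm_eq_abs, abs_of_pos (inv_pos.2 hR),
    inv_mul_le_iff₀ hR, mul_one]
  exact hf y

theorem smul_inv_smul' {R : ℝ} (hR : 0 < R) (f : B E) :
    f = ((R : ℝ) : ℂ) • (((R⁻¹ : ℝ) : ℂ) • f) := by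
  rw [smul_smul, ← Complex.ofReal_mul, mul_inv_cancel₀ hR.ne', Complex.ofReal_one, one_smul]

theorem psi_smul (c : ℂ) (f : B E) (t : ℝ≥0) (x : E) :
    psi M Q t ((c • f : B E) : E → ℂ) x = c * psi M Q t (f : E → ℂ) x :=
  psi_const_mul (f : E → ℂ) c t x

/-- The spectral estimates concern the unit ball; homogeneity brings in the factor `R`. -/
theorem exists_leading_bound (hS : S.H1 (psi M Q)) : ∃ C : ℝ, 0 ≤ C ∧ ∀ (f : B E) (R : ℝ), 0 < R →
    (∀ y, ‖(f : E → ℂ) y‖ ≤ R) → ∀ x, ‖S.leading f x‖ ≤ C * R := by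
  obtain ⟨C, hC0, hC⟩ := hS.exists_bound_leading
  refine ⟨C, hC0, fun f R hR hf x => ?_⟩
  rw [smul_inv_smul' hR f, SpectralData.leading_smul, norm_mul, Complex.norm_real,
    Real.norm_eq_abs, abs_of_pos hR, mul_comm]
  exact mul_le_mul_of_nonneg_right (hC _ (smul_inv_mem_B₁ hR hf) x) hR.le

theorem exists_weight_sq_psi_error (hS : S.H1 (psi M Q)) :
    ∃ δ : ℝ≥0 → ℝ, Tendsto δ atTop (𝓝 0) ∧
    ∀ᶠ t : ℝ≥0 in atTop, ∀ (f : B E) (R : ℝ), 0 < R → (∀ y, ‖(f : E → ℂ) y‖ ≤ R) → ∀ x,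
      ‖((S.weight t ^ 2 : ℝ) : ℂ) * psi M Q t (f : E → ℂ) x - S.leading f x‖ ≤ R * δ t := by
  obtain ⟨δ, hδ, h⟩ := hS.exists_leading_error
  refine ⟨δ, hδ, ?_⟩
  filter_upwards [h] with t ht f R hR hf x
  have := ht _ (smul_inv_mem_B₁ hR hf) x
  rw [← S.weight_sq] at this
  rw [smul_inv_smul' hR f, SpectralData.leading_smul, psi_smul (R : ℂ), mul_left_comm, ← mul_sub,
    norm_mul, Complex.norm_real, Real.norm_eq_abs, abs_of_pos hR]
  exact mul_le_mul_of_nonneg_left this hR.le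

variable [IsMarkovKernel Q] (hQ : M.IsTreeLaw Q) {k : ℕ} (hk : 1 ≤ k)
    {K : ℝ≥0} (hK : ∀ x, ∫⁻ o, (o.1 : ℝ≥0∞) ^ k ∂(M.offspring x) ≤ K) (hS : S.H1 (psi M Q))

include hQ hk hK hS

/-- Beyond some time `T` the asymptotics give the bound, and before `T` the crude moment growth
does. A bound at every time is needed under the time integral. -/
theorem exists_psi_bound : ∃ C : ℝ, 0 ≤ C ∧ ∀ (f : B E) (R : ℝ), 0 < R →
    (∀ y, ‖(f : E → ℂ) y‖ ≤ R) → ∀ (t : ℝ≥0) x,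
      ‖psi M Q t (f : E → ℂ) x‖ ≤ C * R * (Real.exp ((S.eig 1).re * t) * (1 + (t : ℝ)) ^ (S.p 1 - 1)) := by
  obtain ⟨C, hC0, hC⟩ := exists_leading_bound hS
  obtain ⟨δ, hδ, h⟩ := exists_weight_sq_psi_error hS
  -- After `T` the normalised error is less than one on the unit ball.
  obtain ⟨T, hT⟩ := eventually_atTop.1 (h.and (hδ.eventually (gt_mem_nhds zero_lt_one)))
  have hg := growth_pos (M := M) K T
  have ha := hS.eig_one_pos
  refine ⟨C + 1 + growth M K T, by positivity, fun f R hR hf t x => ?_⟩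
  have ht0 : (0 : ℝ) ≤ t := t.coe_nonneg
  have hw2 : S.weight t ^ 2 * (Real.exp ((S.eig 1).re * t) * (1 + (t : ℝ)) ^ (S.p 1 - 1)) = 1 :=
    S.weight_sq_mul t
  set W := Real.exp ((S.eig 1).re * t) * (1 + (t : ℝ)) ^ (S.p 1 - 1) with hW
  have hW1 : 1 ≤ W := one_le_mul_of_one_le_of_one_le (Real.one_le_exp (by positivity))
    (one_le_pow₀ (by linarith))
  rcases le_total T t with h | h
  · obtain ⟨h1, h2⟩ := hT t h
    have h3 : ‖((S.weight t ^ 2 : ℝ) : ℂ) * psi M Q t (f : E → ℂ) x‖ ≤ R * 1 + C * R := by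
      have h4 : ((S.weight t ^ 2 : ℝ) : ℂ) * psi M Q t (f : E → ℂ) x
          = (((S.weight t ^ 2 : ℝ) : ℂ) * psi M Q t (f : E → ℂ) x - S.leading f x)
            + S.leading f x := by ring
      rw [h4]
      refine (norm_add_le _ _).trans (add_le_add ((h1 f R hR hf x).trans ?_) (hC f R hR hf x))
      gcongr
    rw [norm_mul, Complex.norm_real, Real.norm_eq_abs, abs_of_nonneg (by positivity)] at h3
    calc ‖psi M Q t (f : E → ℂ) x‖ = S.weight t ^ 2 * ‖psi M Q t (f : E → ℂ) x‖ * W := by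
          rw [mul_right_comm, hw2, one_mul]
      _ ≤ (R * 1 + C * R) * W := by gcongr
      _ ≤ (C + 1 + growth M K T) * R * W := by
          gcongr
          nlinarith
  · calc ‖psi M Q t (f : E → ℂ) x‖ ≤ R * growth M K t :=
          norm_psi_le hQ hk hK f.2.1 hR.le hf t x
      _ ≤ R * growth M K T := by gcongr; exact growth_mono K h
      _ ≤ (C + 1 + growth M K T) * R * 1 := by nlinarith
      _ ≤ (C + 1 + growth M K T) * R * W := by gcongr

/-- The same gluing of large and small times, on the small space, where the growth rate is below
`λ_1 / 2`. -/
theorem exists_small_bound : ∃ β C : ℝ, 0 < β ∧ 2 * β < (S.eig 1).re ∧ 0 ≤ C ∧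
    ∀ f ∈ S.smallSpace, ∀ R : ℝ, 0 < R → (∀ y, ‖(f : E → ℂ) y‖ ≤ R) → ∀ (t : ℝ≥0) x,
      ‖psi M Q t (f : E → ℂ) x‖ ≤ C * R * Real.exp (β * t) := by
  obtain ⟨β, C, hβ, hβa, h⟩ := hS.exists_small_growth
  obtain ⟨T, hT⟩ := eventually_atTop.1 h
  have hg := growth_pos (M := M) K T
  refine ⟨β, |C| + growth M K T, hβ, hβa, by positivity, fun f hf R hR hfR t x => ?_⟩
  have ht0 : (0 : ℝ) ≤ t := t.coe_nonneg
  rcases le_total T t with h | h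
  · have h1 := hT t h _ ⟨SpectralData.smul_mem_smallSpace _ hf, smul_inv_mem_B₁ hR hfR⟩ x
    rw [smul_inv_smul' hR f, psi_smul (R : ℂ), norm_mul, Complex.norm_real,
      Real.norm_eq_abs, abs_of_pos hR]
    calc _ ≤ R * (C * Real.exp (β * t)) := mul_le_mul_of_nonneg_left h1 hR.le
      _ ≤ R * ((|C| + growth M K T) * Real.exp (β * t)) := by
          gcongr
          linarith [le_abs_self C]
      _ = _ := by ring
  · calc ‖psi M Q t (f : E → ℂ) x‖ ≤ R * growth M K t :=
          norm_psi_le hQ hk hK f.2.1 hR.le hfR t x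
      _ ≤ R * growth M K T := by gcongr; exact growth_mono K h
      _ ≤ (|C| + growth M K T) * R * 1 := by nlinarith [abs_nonneg C]
      _ ≤ (|C| + growth M K T) * R * Real.exp (β * t) := by
          gcongr
          exact Real.one_le_exp (by positivity)

end Scaling

/-! ### Uniform convergence and time integrals. -/

theorem tendsto_zero_prod_principal_iff {ι : Type*} {P : Set ι} {F : ℝ≥0 × ι → ℂ} :
    Tendsto F (atTop ×ˢ 𝓟 P) (𝓝 0) ↔ ∀ ε : ℝ, 0 < ε → ∀ᶠ t in atTop, ∀ p ∈ P, ‖F (t, p)‖ ≤ ε := by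
  constructor
  · intro h ε hε
    have h1 := (Metric.tendsto_nhds.1 h ε hε)
    rw [eventually_prod_principal_iff] at h1
    refine h1.mono fun t ht p hp => ?_
    have := ht p hp
    rw [dist_zero_right] at this
    exact this.le
  · intro h
    refine Metric.tendsto_nhds.2 fun ε hε => ?_
    rw [eventually_prod_principal_iff]
    refine (h (ε / 2) (half_pos hε)).mono fun t ht p hp => ?_
    rw [dist_zero_right]
    exact (ht p hp).trans_lt (half_lt_self hε)

theorem tendsto_zero_prod_principal_of_le {ι : Type*} {P : Set ι} {F : ℝ≥0 × ι → ℂ} {g : ℝ≥0 → ℝ}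
    (hg : Tendsto g atTop (𝓝 0)) (h : ∀ᶠ t in atTop, ∀ p ∈ P, ‖F (t, p)‖ ≤ g t) :
    Tendsto F (atTop ×ˢ 𝓟 P) (𝓝 0) :=
  tendsto_zero_prod_principal_iff.2 fun ε hε => by
    filter_upwards [h, hg.eventually (gt_mem_nhds hε)] with t ht ht' p hp
    exact (ht p hp).trans ht'.le

theorem tendsto_tsub_const_atTop (u : ℝ≥0) : Tendsto (fun t : ℝ≥0 => t - u) atTop atTop :=
  tendsto_atTop.2 fun b => (eventually_ge_atTop (b + u)).mono fun _ ht =>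
    le_tsub_of_add_le_right ht

/-- The change of variables `u = t - s`. For pairs, the time `u` remaining after the branching is
the variable in which the integrand converges. -/
theorem setIntegral_Ioc_reflect (F : ℝ≥0 → ℝ≥0 → ℂ) (t : ℝ≥0) :
    ∫ s in Set.Ioc (0 : ℝ) t, F s.toNNReal (t - s.toNNReal)
      = ∫ u in Set.Ioc (0 : ℝ) t, F (t - u.toNNReal) u.toNNReal := by
  rw [← intervalIntegral.integral_of_le t.coe_nonneg, ← intervalIntegral.integral_of_le t.coe_nonneg]
  have h := intervalIntegral.integral_comp_sub_left (a := 0) (b := (t : ℝ))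
    (fun s : ℝ => F s.toNNReal (t - s.toNNReal)) (t : ℝ)
  rw [sub_self, sub_zero] at h
  rw [← h]
  refine intervalIntegral.integral_congr fun u hu => ?_
  rw [Set.uIcc_of_le t.coe_nonneg] at hu
  have e1 : ((t : ℝ) - u).toNNReal = t - u.toNNReal := by
    rw [← NNReal.coe_inj, NNReal.coe_sub (Real.toNNReal_le_iff_le_coe.2 hu.2),
      Real.coe_toNNReal _ hu.1, Real.coe_toNNReal _ (sub_nonneg.2 hu.2)]
  have e2 : t - (t - u.toNNReal) = u.toNNReal :=
    tsub_tsub_cancel_of_le (Real.toNNReal_le_iff_le_coe.2 hu.2)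
  simp only [e1, e2]

theorem integrableOn_exp_mul_one_add_pow {c : ℝ} (hc : c < 0) (p : ℕ) :
    IntegrableOn (fun s : ℝ => Real.exp (c * s) * (1 + s) ^ p) (Set.Ioi 0) := by
  obtain ⟨C, hC0, hC⟩ := exists_one_add_pow_le_exp p (ε := -c / 2) (by linarith)
  refine Integrable.mono' ((integrableOn_exp_mul_Ioi (a := c / 2) (by linarith) 0).const_mul C)
    (by fun_prop : Continuous fun s : ℝ => Real.exp (c * s) * (1 + s) ^ p).aestronglyMeasurable
    ((ae_restrict_iff' measurableSet_Ioi).2 (Eventually.of_forall fun s hs => ?_))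
  have hs0 : (0 : ℝ) < s := hs
  have h := hC s.toNNReal
  rw [Real.coe_toNNReal _ hs0.le] at h
  rw [Real.norm_eq_abs, abs_of_nonneg (by positivity)]
  calc Real.exp (c * s) * (1 + s) ^ p ≤ Real.exp (c * s) * (C * Real.exp (-c / 2 * s)) := by gcongr
    _ = C * Real.exp (c / 2 * s) := by
        rw [mul_left_comm, ← Real.exp_add]; congr 2; ring

theorem toB_coe {E : Type*} [MeasurableSpace E] {g : E → ℂ} (hg : g ∈ B E) : toB g = ⟨g, hg⟩ :=
  dif_pos hg

/-! ### The induction statement and moments of order one. -/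

section Induction

variable {E Ξ : Type*} [MeasurableSpace E] [MeasurableSpace Ξ] (M : BranchingModel E Ξ)
  (Q : Kernel E (Tree E Ξ)) (S : SpectralData E)

/-- Families of functions in the small space that are bounded by `R`, and a point of `E`. -/
def smallParams (l : ℕ) (R : ℝ) : Set ((Fin l → B E) × E) :=
  {p | ∀ i, p.1 i ∈ S.smallSpace ∧ ∀ y, ‖(p.1 i : E → ℂ) y‖ ≤ R}

/-- The rescaled moments are bounded. -/
def MomentBound {l : ℕ} (R : ℝ) (A : Finset (Fin l)) (C : ℝ) : Prop :=
  ∀ p ∈ smallParams S l R, ∀ t,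
    ‖psiMoment M Q t p.1 A p.2‖ ≤ C * ((S.weight t)⁻¹) ^ A.card

/-- The rescaled moments converge uniformly. -/
def MomentLimit {l : ℕ} (R : ℝ) (A : Finset (Fin l)) : Prop :=
  Tendsto (fun q : ℝ≥0 × ((Fin l → B E) × E) =>
    ((S.weight q.1 ^ A.card : ℝ) : ℂ) * psiMoment M Q q.1 q.2.1 A q.2.2 - limitL M Q S q.2.1 A q.2.2)
    (atTop ×ˢ 𝓟 (smallParams S l R)) (𝓝 0)

variable {M Q S} {l : ℕ} {R : ℝ} {A : Finset (Fin l)}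

theorem MomentLimit.tendsto (h : MomentLimit M Q S R A) {p : (Fin l → B E) × E}
    (hp : p ∈ smallParams S l R) :
    Tendsto (fun t : ℝ≥0 => ((S.weight t ^ A.card : ℝ) : ℂ) * psiMoment M Q t p.1 A p.2) atTop
      (𝓝 (limitL M Q S p.1 A p.2)) := by
  have h1 : Tendsto (fun t : ℝ≥0 => (t, p)) atTop (atTop ×ˢ 𝓟 (smallParams S l R)) :=
    tendsto_id.prodMk (tendsto_principal.2 (Eventually.of_forall fun _ => hp))
  have h2 := Tendsto.comp h h1
  have h3 := h2.add_const (limitL M Q S p.1 A p.2)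
  simp only [Function.comp_def, sub_add_cancel, zero_add] at h3
  exact h3

/-- A pointwise limit along integer times. The branching operator can be applied to the limits only
after this is known. -/
theorem MomentLimit.measurable [IsMarkovKernel Q] (h : MomentLimit M Q S R A) {f : Fin l → B E}
    (hf : ∀ i, f i ∈ S.smallSpace ∧ ∀ y, ‖(f i : E → ℂ) y‖ ≤ R) :
    Measurable (limitL M Q S f A) := by
  refine measurable_of_tendsto_metrizable (f := fun (n : ℕ) x =>
    ((S.weight (n : ℝ≥0) ^ A.card : ℝ) : ℂ) * psiMoment M Q (n : ℝ≥0) f A x) (fun n => ?_)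
    (tendsto_pi_nhds.2 fun x => ?_)
  · exact (measurable_psiMoment f A (t := fun _ : E => (n : ℝ≥0)) (x := fun y => y) measurable_const
      measurable_id).const_mul _
  · exact (h.tendsto (p := (f, x)) hf).comp tendsto_natCast_atTop_atTop

theorem norm_weight_pow_mul_le {C : ℝ} (hb : MomentBound M Q S R A C) {p : (Fin l → B E) × E}
    (hp : p ∈ smallParams S l R) (t : ℝ≥0) :
    ‖((S.weight t ^ A.card : ℝ) : ℂ) * psiMoment M Q t p.1 A p.2‖ ≤ C := by
  have hw := S.weight_pos t
  rw [norm_mul, Complex.norm_real, Real.norm_eq_abs, abs_of_pos (by positivity)]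
  calc _ ≤ S.weight t ^ A.card * (C * ((S.weight t)⁻¹) ^ A.card) :=
        mul_le_mul_of_nonneg_left (hb p hp t) (by positivity)
    _ = C := by rw [inv_pow]; field_simp

theorem momentBound_of_norm_weight_pow_mul_le {C : ℝ} (h : ∀ p ∈ smallParams S l R, ∀ t,
    ‖((S.weight t ^ A.card : ℝ) : ℂ) * psiMoment M Q t p.1 A p.2‖ ≤ C) :
    MomentBound M Q S R A C := by
  intro p hp t
  have hw := S.weight_pos t
  have h1 := h p hp t
  rw [norm_mul, Complex.norm_real, Real.norm_eq_abs, abs_of_pos (by positivity)] at h1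
  rw [inv_pow, ← div_eq_mul_inv, le_div_iff₀ (by positivity), mul_comm]
  exact h1

theorem MomentLimit.norm_limitL_le (h : MomentLimit M Q S R A) {C : ℝ}
    (hb : MomentBound M Q S R A C) {p : (Fin l → B E) × E} (hp : p ∈ smallParams S l R) :
    ‖limitL M Q S p.1 A p.2‖ ≤ C :=
  le_of_tendsto (h.tendsto hp).norm (Eventually.of_forall fun t => norm_weight_pow_mul_le hb hp t)

theorem limitL_of_odd (hA : Odd A.card) (f : Fin l → B E) : limitL M Q S f A = 0 := by
  rw [limitL, if_neg, if_neg]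
  · exact fun h => (Nat.not_even_iff_odd.2 hA) h.1
  · exact fun h => by rw [h] at hA; exact absurd hA (by decide)

/-- Every partition of a set of odd size has a block of odd size, whose limit vanishes. -/
theorem rateZeta_limitL_of_odd (hA : Odd A.card) (f : Fin l → B E) :
    rateZeta M A (limitL M Q S f) = 0 := by
  funext x
  rw [rateZeta_eq]
  have h0 : ∀ o : Config E, zetaSum A (limitL M Q S f) o = 0 := by
    intro o
    refine Finset.sum_eq_zero fun σ _ => Finset.sum_eq_zero fun i _ => ?_
    obtain ⟨b, hb, hodd⟩ : ∃ b ∈ σ.parts, Odd b.card := by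
      by_contra hcon
      push Not at hcon
      refine (Nat.not_even_iff_odd.2 hA) ?_
      rw [← σ.sum_card_parts]
      exact Finset.even_sum _ fun b hb => by simpa using hcon b hb
    refine Finset.prod_eq_zero (Finset.mem_univ ⟨b, hb⟩) ?_
    rw [limitL_of_odd hodd]
    rfl
  simp only [h0]
  simp

variable [IsMarkovKernel Q] (hQ : M.IsTreeLaw Q) {k : ℕ} (hk : 1 ≤ k)
    {K : ℝ≥0} (hK : ∀ x, ∫⁻ o, (o.1 : ℝ≥0∞) ^ k ∂(M.offspring x) ≤ K) (hS : S.H1 (psi M Q))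
    (hR : 0 < R)

include hQ hk hK hS hR

/-- The first moment grows like `e^{βt}` with `β < λ_1 / 2`, so the weight wins and the limit is
zero. -/
theorem moment_singleton (hA : A.card = 1) :
    (∃ C, 1 ≤ C ∧ MomentBound M Q S R A C) ∧ MomentLimit M Q S R A := by
  obtain ⟨i, rfl⟩ := Finset.card_eq_one.1 hA
  obtain ⟨β, C, hβ, hβa, hC0, hC⟩ := exists_small_bound hQ hk hK hS
  have hb : ∀ p ∈ smallParams S l R, ∀ t,
      ‖((S.weight t ^ ({i} : Finset (Fin l)).card : ℝ) : ℂ) * psiMoment M Q t p.1 {i} p.2‖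
        ≤ C * R * Real.exp ((β - (S.eig 1).re / 2) * t) := by
    intro p hp t
    have hw := S.weight_pos t
    rw [psiMoment_singleton, Finset.card_singleton, pow_one, norm_mul, Complex.norm_real,
      Real.norm_eq_abs, abs_of_pos hw]
    calc _ ≤ Real.exp (-((S.eig 1).re * t / 2)) * (C * R * Real.exp (β * t)) :=
          mul_le_mul (S.weight_le_exp t) (hC _ (hp i).1 R hR (hp i).2 t p.2) (norm_nonneg _)
            (Real.exp_pos _).le
      _ = _ := by rw [mul_left_comm, ← Real.exp_add]; congr 2; ring
  refine ⟨⟨max 1 (C * R), le_max_left _ _, momentBound_of_norm_weight_pow_mul_le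
    fun p hp t => (hb p hp t).trans ?_⟩, ?_⟩
  · refine le_trans (mul_le_of_le_one_right (by positivity) ?_) (le_max_right _ _)
    exact Real.exp_le_one_iff.2 (mul_nonpos_of_nonpos_of_nonneg (by linarith) t.coe_nonneg)
  · have hg : Tendsto (fun t : ℝ≥0 => C * R * Real.exp ((β - (S.eig 1).re / 2) * t)) atTop
        (𝓝 0) := by
      have := (tendsto_exp_mul_one_add_pow 0 (c := β - (S.eig 1).re / 2)
        (by linarith)).const_mul (C * R)
      simpa using this
    refine tendsto_zero_prod_principal_of_le hg (Eventually.of_forall fun t p hp => ?_)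
    rw [limitL_of_odd (by rw [hA]; decide), Pi.zero_apply, sub_zero]
    exact hb p hp t

end Induction

/-! ### Moments of order two. -/

section Pair

variable {E Ξ : Type*} [MeasurableSpace E] [MeasurableSpace Ξ] {M : BranchingModel E Ξ}
  {Q : Kernel E (Tree E Ξ)} {S : SpectralData E} {l : ℕ} {R : ℝ} {A : Finset (Fin l)}
  [IsMarkovKernel Q] (hQ : M.IsTreeLaw Q) {k : ℕ} (hk : 1 ≤ k)
    {K : ℝ≥0} (hK : ∀ x, ∫⁻ o, (o.1 : ℝ≥0∞) ^ k ∂(M.offspring x) ≤ K) (hS : S.H1 (psi M Q))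
    (hR : 1 ≤ R) (hAk : A.card ≤ k)

include hQ hk hK hS hR hAk

/-- A nontrivial partition of a pair consists of two singletons, so the source is quadratic in first
moments and grows at rate `2β < λ_1`. -/
theorem exists_rateZeta_pair_bound (hA : A.card = 2) : ∃ c D : ℝ, 0 < D ∧ 0 < c ∧
    ∀ p ∈ smallParams S l R, ∀ (u : ℝ≥0) y, ‖rateZeta M A (psiMoment M Q u p.1) y‖
      ≤ D * Real.exp (((S.eig 1).re - c) * u) := by
  obtain ⟨β, C, hβ, hβa, hC0, hC⟩ := exists_small_bound hQ hk hK hS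
  have hR0 : 0 < R := zero_lt_one.trans_le hR
  -- The gap `c = λ_1 - 2β` will be the decay rate of the integrand; the `+ 1` makes the constant
  -- positive.
  refine ⟨(S.eig 1).re - 2 * β, (zetaConst M A K + 1) * max 1 (C * R) ^ 2, by positivity,
    by linarith, fun p hp u y => ?_⟩
  have h := norm_rateZeta_le hAk hK (g := psiMoment M Q u p.1) (D := max 1 (C * R))
    (v := Real.exp (β * u)) (le_max_left _ _) (Real.exp_pos _).le (fun b hb hn y => ?_) y
  · refine h.trans ?_
    rw [hA]
    calc _ ≤ ((zetaConst M A K : ℝ) + 1) * (max 1 (C * R) ^ 2 * Real.exp (β * u) ^ 2) := by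
          gcongr
          linarith
      _ = _ := by rw [← Real.exp_nat_mul, ← mul_assoc]; congr 2; push_cast; ring
  · have hb1 : b.card = 1 := by
      have h1 := Finset.card_lt_card hb
      have h2 := hn.card_pos
      omega
    obtain ⟨i, rfl⟩ := Finset.card_eq_one.1 hb1
    rw [psiMoment_singleton, Finset.card_singleton, pow_one]
    exact (hC _ (hp i).1 R hR0 (hp i).2 u y).trans
      (mul_le_mul_of_nonneg_right (le_max_right _ _) (Real.exp_pos _).le)

/-- In the variable `u = t - s` the semigroup runs for the long time `t - u`, so its leading
asymptotics apply to the source at time `u`, discounted by `e^{-λ_1 u}`. The product term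
contributes too, since the square of the weight is exactly the normalisation of the mean semigroup.
-/
theorem moment_pair (hA : A.card = 2) :
    (∃ C, 1 ≤ C ∧ MomentBound M Q S R A C) ∧ MomentLimit M Q S R A ∧
      ∀ p ∈ smallParams S l R, IntegrableOn (pairIntegrand M Q S p.1 A p.2) (Set.Ioi 0) := by
  obtain ⟨c, D, hD, hc, hh⟩ := exists_rateZeta_pair_bound hQ hk hK hS hR hAk hA
  obtain ⟨C₂, hC₂0, hC₂⟩ := exists_psi_bound hQ hk hK hS
  obtain ⟨C₃, hC₃0, hC₃⟩ := exists_leading_bound hS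
  obtain ⟨δ, hδ, hδ'⟩ := exists_weight_sq_psi_error hS
  have hR0 : 0 < R := zero_lt_one.trans_le hR
  have hne : A.Nonempty := Finset.card_pos.1 (by omega)
  set a := (S.eig 1).re with ha
  set P := smallParams S l R with hP
  have hmem : ∀ p ∈ P, ∀ u : ℝ≥0, rateZeta M A (psiMoment M Q u p.1) ∈ B E := fun p hp u =>
    rateZeta_psiMoment_mem_B hQ hk hK hAk hR (fun i => (hp i).2) u
  -- The source as an element of `B(E)`; for parameters in `P` the default value of `toB` never
  -- occurs.
  set H : ((Fin l → B E) × E) → ℝ≥0 → B E := fun p u => toB (rateZeta M A (psiMoment M Q u p.1))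
    with hH
  have hHcoe : ∀ p ∈ P, ∀ u, (H p u : E → ℂ) = rateZeta M A (psiMoment M Q u p.1) := fun p hp u => by
    rw [hH]; simp only [toB_coe (hmem p hp u)]
  have hHb : ∀ p ∈ P, ∀ u y, ‖(H p u : E → ℂ) y‖ ≤ D * Real.exp ((a - c) * u) := fun p hp u y => by
    rw [hHcoe p hp]; exact hh p hp u y
  have hDu : ∀ u : ℝ≥0, 0 < D * Real.exp ((a - c) * u) := fun u => by positivity
  set Φ : ℝ≥0 → ((Fin l → B E) × E) → ℝ → ℂ := fun t p u =>
    ((S.weight t ^ 2 : ℝ) : ℂ) * psi M Q (t - u.toNNReal)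
      (rateZeta M A (psiMoment M Q u.toNNReal p.1)) p.2 with hΦ
  set Λ : ((Fin l → B E) × E) → ℝ → ℂ := fun p u =>
    (Real.exp (-(a * u)) : ℂ) * S.leading (H p u.toNNReal) p.2 with hΛ
  have hΛpair : ∀ p u, Λ p u
      = ((S.p 1 - 1).factorial : ℂ)⁻¹ * pairIntegrand M Q S p.1 A p.2 u := by
    intro p u
    simp only [hΛ, hH, pairIntegrand, SpectralData.leading]
    ring
  have hΦm : ∀ t, ∀ p ∈ P, Measurable (Φ t p) := fun t p _ =>
    (measurable_psi_rateZeta A p.1 (measurable_const.sub measurable_real_toNNReal)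
      measurable_real_toNNReal p.2).const_mul _
  have hlead : ∀ p ∈ P, ∀ u : ℝ≥0, Tendsto (fun n : ℕ => ((S.weight (n : ℝ≥0) ^ 2 : ℝ) : ℂ)
      * psi M Q (n : ℝ≥0) (rateZeta M A (psiMoment M Q u p.1)) p.2) atTop
      (𝓝 (S.leading (H p u) p.2)) := by
    intro p hp u
    have h1 : Tendsto (fun t : ℝ≥0 => ((S.weight t ^ 2 : ℝ) : ℂ)
        * psi M Q t (rateZeta M A (psiMoment M Q u p.1)) p.2) atTop
        (𝓝 (S.leading (H p u) p.2)) := by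
      rw [tendsto_iff_norm_sub_tendsto_zero]
      have hz : Tendsto (fun t => D * Real.exp ((a - c) * u) * δ t) atTop (𝓝 0) := by
        simpa using hδ.const_mul (D * Real.exp ((a - c) * u))
      refine squeeze_zero' (Eventually.of_forall fun _ => norm_nonneg _) ?_ hz
      filter_upwards [hδ'] with t ht
      have := ht (H p u) _ (hDu u) (hHb p hp u) p.2
      rwa [hHcoe p hp] at this
    exact h1.comp tendsto_natCast_atTop_atTop
  have hΛm : ∀ p ∈ P, Measurable (Λ p) := by
    intro p hp
    -- The functionals are merely bounded and linear, so measurability in `u` comes from writing the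
    -- leading term as a limit of the semigroup at integer times.
    have h1 : Measurable fun u : ℝ => S.leading (H p u.toNNReal) p.2 := by
      refine measurable_of_tendsto_metrizable (f := fun (n : ℕ) (u : ℝ) =>
        ((S.weight (n : ℝ≥0) ^ 2 : ℝ) : ℂ)
          * psi M Q (n : ℝ≥0) (rateZeta M A (psiMoment M Q u.toNNReal p.1)) p.2) (fun n => ?_)
        (tendsto_pi_nhds.2 fun u => hlead p hp u.toNNReal)
      exact (measurable_psi_rateZeta A p.1 measurable_const measurable_real_toNNReal p.2).const_mul _
    have h2 : Measurable fun u : ℝ => (Real.exp (-(a * u)) : ℂ) :=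
      Complex.measurable_ofReal.comp (by fun_prop)
    exact h2.mul h1
  have hbd : IntegrableOn (fun u : ℝ => (C₂ + C₃) * D * Real.exp (-c * u)) (Set.Ioi 0) :=
    (integrableOn_exp_mul_Ioi (a := -c) (by linarith) 0).const_mul _
  -- By `weight_le_mul` the ratio of squared weights costs `e^{-au}`, and the squared weight at `t -
  -- u` cancels the growth of the semigroup; with the source bound this leaves `e^{-cu}`.
  have hΦb : ∀ (t : ℝ≥0), ∀ p ∈ P, ∀ u ∈ Set.Ioc (0 : ℝ) t,
      ‖Φ t p u‖ ≤ (C₂ + C₃) * D * Real.exp (-c * u) := by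
    intro t p hp u hu
    have hut : u.toNNReal ≤ t := Real.toNNReal_le_iff_le_coe.2 hu.2
    have hu' : ((u.toNNReal : ℝ≥0) : ℝ) = u := Real.coe_toNNReal _ hu.1.le
    have h1 := hC₂ (H p u.toNNReal) _ (hDu _) (hHb p hp _) (t - u.toNNReal) p.2
    rw [hHcoe p hp] at h1
    have h2 := S.weight_le_mul hut
    have hw := S.weight_pos t
    have hw' := S.weight_pos (t - u.toNNReal)
    set W := Real.exp (a * ((t - u.toNNReal : ℝ≥0) : ℝ))
      * (1 + ((t - u.toNNReal : ℝ≥0) : ℝ)) ^ (S.p 1 - 1) with hW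
    have hW0 : 0 ≤ W := by positivity
    simp only [hΦ]
    rw [norm_mul, Complex.norm_real, Real.norm_eq_abs, abs_of_pos (by positivity)]
    calc _ ≤ (Real.exp (-(a * (u.toNNReal : ℝ≥0) / 2)) * S.weight (t - u.toNNReal)) ^ 2
          * (C₂ * (D * Real.exp ((a - c) * (u.toNNReal : ℝ≥0))) * W) := by gcongr
      _ = C₂ * D * (Real.exp (-(a * (u.toNNReal : ℝ≥0) / 2)) ^ 2
          * Real.exp ((a - c) * (u.toNNReal : ℝ≥0))) * (S.weight (t - u.toNNReal) ^ 2 * W) := by ring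
      _ = C₂ * D * Real.exp (-c * u) := by
          rw [S.weight_sq_mul, mul_one, ← Real.exp_nat_mul, ← Real.exp_add, hu']
          congr 2; push_cast; ring
      _ ≤ _ := by gcongr; linarith
  have hΛb : ∀ p ∈ P, ∀ u, 0 < u → ‖Λ p u‖ ≤ (C₂ + C₃) * D * Real.exp (-c * u) := by
    intro p hp u hu
    have hu' : ((u.toNNReal : ℝ≥0) : ℝ) = u := Real.coe_toNNReal _ hu.le
    have h1 := hC₃ (H p u.toNNReal) _ (hDu _) (hHb p hp _) p.2
    rw [hu'] at h1
    simp only [hΛ]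
    rw [norm_mul, Complex.norm_real, Real.norm_eq_abs, abs_of_pos (Real.exp_pos _)]
    calc _ ≤ Real.exp (-(a * u)) * (C₃ * (D * Real.exp ((a - c) * u))) := by gcongr
      _ = C₃ * D * (Real.exp (-(a * u)) * Real.exp ((a - c) * u)) := by ring
      _ = C₃ * D * Real.exp (-c * u) := by rw [← Real.exp_add]; congr 2; ring
      _ ≤ _ := by gcongr; linarith
  have hlim : ∀ u, 0 < u → Tendsto (fun q : ℝ≥0 × ((Fin l → B E) × E) => Φ q.1 q.2 u - Λ q.2 u)
      (atTop ×ˢ 𝓟 P) (𝓝 0) := by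
    intro u hu
    set v := u.toNNReal with hv
    have hu' : (v : ℝ) = u := Real.coe_toNNReal _ hu.le
    set r : ℝ≥0 → ℝ := fun t => S.weight t / S.weight (t - v) with hr
    have hr2 : Tendsto (fun t => r t ^ 2) atTop (𝓝 (Real.exp (-(a * u)))) := by
      have := (S.tendsto_weight_div v).pow 2
      rw [← Real.exp_nat_mul, hu'] at this
      convert this using 3
      push_cast; ring
    set HR := D * Real.exp ((a - c) * v) with hHR
    have hg : Tendsto (fun t : ℝ≥0 => r t ^ 2 * (HR * δ (t - v))
        + |r t ^ 2 - Real.exp (-(a * u))| * (C₃ * HR)) atTop (𝓝 0) := by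
      have h1 := hr2.mul ((hδ.comp (tendsto_tsub_const_atTop v)).const_mul HR)
      have h2 := ((hr2.sub_const (Real.exp (-(a * u)))).abs).mul_const (C₃ * HR)
      simpa using h1.add h2
    refine tendsto_zero_prod_principal_of_le hg ?_
    filter_upwards [(tendsto_tsub_const_atTop v).eventually hδ'] with t ht p hp
    have h1 := ht (H p v) HR (hDu v) (hHb p hp v) p.2
    have h2 := hC₃ (H p v) HR (hDu v) (hHb p hp v) p.2
    have hw' := S.weight_pos (t - v)
    have hrw : S.weight t ^ 2 = r t ^ 2 * S.weight (t - v) ^ 2 := by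
      rw [hr]; field_simp
    -- Split into the error of the semigroup at time `t - v` and that of the ratio of weights.
    have e : Φ t p u - Λ p u = ((r t ^ 2 : ℝ) : ℂ) * (((S.weight (t - v) ^ 2 : ℝ) : ℂ)
          * psi M Q (t - v) (H p v : E → ℂ) p.2 - S.leading (H p v) p.2)
        + ((r t ^ 2 - Real.exp (-(a * u)) : ℝ) : ℂ) * S.leading (H p v) p.2 := by
      simp only [hΦ, hΛ]
      rw [hHcoe p hp, hrw, ← hv]
      push_cast
      ring
    change ‖Φ t p u - Λ p u‖ ≤ _
    rw [e]
    refine (norm_add_le _ _).trans (add_le_add ?_ ?_)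
    · rw [norm_mul, Complex.norm_real, Real.norm_eq_abs, abs_of_nonneg (sq_nonneg _)]
      exact mul_le_mul_of_nonneg_left h1 (sq_nonneg _)
    · rw [norm_mul, Complex.norm_real, Real.norm_eq_abs]
      exact mul_le_mul_of_nonneg_left h2 (abs_nonneg _)
  obtain ⟨hI1, hI2, hI3⟩ := tendsto_setIntegral_Ioc_sub hbd hΦm hΛm hΦb hΛb hlim
  have hprodcoe : ∀ f : Fin l → B E, ((∏ i ∈ A, f i : B E) : E → ℂ)
      = fun y => ∏ i ∈ A, (f i : E → ℂ) y := fun f => by funext y; simp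
  have hprodb : ∀ p ∈ P, ∀ y, ‖((∏ i ∈ A, p.1 i : B E) : E → ℂ) y‖ ≤ R ^ 2 := by
    intro p hp y
    rw [hprodcoe, norm_prod, ← hA, ← Finset.prod_const]
    exact Finset.prod_le_prod (fun _ _ => norm_nonneg _) fun i _ => (hp i).2 y
  have hev : ∀ (t : ℝ≥0) (p : (Fin l → B E) × E),
      ((S.weight t ^ A.card : ℝ) : ℂ) * psiMoment M Q t p.1 A p.2
        = ((S.weight t ^ 2 : ℝ) : ℂ) * psi M Q t ((∏ i ∈ A, p.1 i : B E) : E → ℂ) p.2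
          + ∫ u in Set.Ioc (0 : ℝ) t, Φ t p u := by
    intro t p
    rw [hA, psiMoment_evolution hQ hk hK hAk hne, mul_add, ← hprodcoe,
      setIntegral_Ioc_reflect (fun s u => psi M Q s (rateZeta M A (psiMoment M Q u p.1)) p.2) t,
      ← integral_const_mul]
  have hL : ∀ p : (Fin l → B E) × E, limitL M Q S p.1 A p.2
      = S.leading (∏ i ∈ A, p.1 i) p.2 + ∫ u in Set.Ioi (0 : ℝ), Λ p u := by
    intro p
    rw [limitL, if_pos hA]
    simp only [hΛpair]
    rw [integral_const_mul]
    rfl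
  refine ⟨⟨1 + C₂ * R ^ 2 + ∫ u in Set.Ioi (0 : ℝ), (C₂ + C₃) * D * Real.exp (-c * u), ?_,
    momentBound_of_norm_weight_pow_mul_le fun p hp t => ?_⟩, ?_, fun p hp => ?_⟩
  · have : 0 ≤ ∫ u in Set.Ioi (0 : ℝ), (C₂ + C₃) * D * Real.exp (-c * u) :=
      integral_nonneg fun u => by positivity
    have : 0 ≤ C₂ * R ^ 2 := by positivity
    linarith
  · rw [hev]
    refine (norm_add_le _ _).trans (add_le_add ?_ (hI1 t p hp))
    have h1 := hC₂ _ (R ^ 2) (by positivity) (hprodb p hp) t p.2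
    have hw := S.weight_pos t
    rw [norm_mul, Complex.norm_real, Real.norm_eq_abs, abs_of_pos (by positivity)]
    calc _ ≤ S.weight t ^ 2 * (C₂ * R ^ 2 * (Real.exp (a * t) * (1 + (t : ℝ)) ^ (S.p 1 - 1))) := by
          gcongr
      _ = C₂ * R ^ 2 * (S.weight t ^ 2 * (Real.exp (a * t) * (1 + (t : ℝ)) ^ (S.p 1 - 1))) := by ring
      _ = C₂ * R ^ 2 := by rw [S.weight_sq_mul, mul_one]
      _ ≤ 1 + C₂ * R ^ 2 := by linarith
  · have h1 : Tendsto (fun q : ℝ≥0 × ((Fin l → B E) × E) =>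
        ((S.weight q.1 ^ 2 : ℝ) : ℂ) * psi M Q q.1 ((∏ i ∈ A, q.2.1 i : B E) : E → ℂ) q.2.2
          - S.leading (∏ i ∈ A, q.2.1 i) q.2.2) (atTop ×ˢ 𝓟 P) (𝓝 0) := by
      have hg : Tendsto (fun t => R ^ 2 * δ t) atTop (𝓝 0) := by simpa using hδ.const_mul (R ^ 2)
      refine tendsto_zero_prod_principal_of_le hg ?_
      filter_upwards [hδ'] with t ht p hp
      exact ht _ _ (by positivity) (hprodb p hp) p.2
    have h2 := h1.add hI3
    rw [add_zero] at h2
    refine h2.congr fun q => ?_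
    rw [hev, hL]
    ring
  · have h1 := (hI2 p hp).const_mul ((S.p 1 - 1).factorial : ℂ)
    refine h1.congr (Eventually.of_forall fun u => ?_)
    simp only [hΛpair]
    rw [mul_inv_cancel_left₀]
    exact_mod_cast (S.p 1 - 1).factorial_ne_zero

end Pair

/-! ### Moments of order at least three. -/

section Recursion

variable {E Ξ : Type*} [MeasurableSpace E] [MeasurableSpace Ξ] {M : BranchingModel E Ξ}
  {Q : Kernel E (Tree E Ξ)} {S : SpectralData E} {l : ℕ} {R : ℝ} {A : Finset (Fin l)}

/-- Both sides vanish for odd sizes, so one recursion covers all sizes from three on. -/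
theorem limitL_eq_integral (hA : 3 ≤ A.card) (f : Fin l → B E) (x : E) :
    limitL M Q S f A x = ∫ s in Set.Ioi (0 : ℝ), recIntegrand M Q S (limitL M Q S f) A x s := by
  rcases Nat.even_or_odd A.card with he | ho
  · exact limitL_eq M Q S f A he (by obtain ⟨r, hr⟩ := he; omega) x
  · rw [limitL_of_odd ho]
    simp only [recIntegrand, rateZeta_limitL_of_odd ho]
    simp [psi]

variable [IsMarkovKernel Q] (hQ : M.IsTreeLaw Q) {k : ℕ} (hk : 1 ≤ k)
    {K : ℝ≥0} (hK : ∀ x, ∫⁻ o, (o.1 : ℝ≥0∞) ^ k ∂(M.offspring x) ≤ K) (hS : S.H1 (psi M Q))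
    (hR : 1 ≤ R) (hAk : A.card ≤ k)

include hQ hk hK hS hR hAk

/-- Here `s` stays bounded while the lower moments are taken at the long time `t - s`, where the
induction hypothesis applies. Their weights combine to the power `|A|` by homogeneity, and the ratio
of weights supplies the factor `e^{-λ_1|A|s/2}`. -/
theorem moment_of_ssubset (hA : 3 ≤ A.card)
    (ih : ∀ b ⊂ A, b.Nonempty → (∃ C, 1 ≤ C ∧ MomentBound M Q S R b C) ∧ MomentLimit M Q S R b) :
    (∃ C, 1 ≤ C ∧ MomentBound M Q S R A C) ∧ MomentLimit M Q S R A ∧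
      ∀ p ∈ smallParams S l R, rateZeta M A (limitL M Q S p.1) ∈ B E ∧
        IntegrableOn (recIntegrand M Q S (limitL M Q S p.1) A p.2) (Set.Ioi 0) := by
  obtain ⟨C₂, hC₂0, hC₂⟩ := exists_psi_bound hQ hk hK hS
  have hR0 : 0 < R := zero_lt_one.trans_le hR
  have hne : A.Nonempty := Finset.card_pos.1 (by omega)
  have hapos := hS.eig_one_pos
  set a := (S.eig 1).re with ha
  set n := A.card with hn
  set P := smallParams S l R with hP
  -- There are finitely many subsets, so one constant serves them all.
  obtain ⟨C, hC1, hC⟩ : ∃ C : ℝ, 1 ≤ C ∧ ∀ b ⊂ A, b.Nonempty → MomentBound M Q S R b C := by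
    have h1 : ∀ b : Finset (Fin l), ∃ C : ℝ, 1 ≤ C ∧
        (b ⊂ A → b.Nonempty → MomentBound M Q S R b C) := by
      intro b
      by_cases hb : b ⊂ A ∧ b.Nonempty
      · obtain ⟨C, hC, h⟩ := (ih b hb.1 hb.2).1
        exact ⟨C, hC, fun _ _ => h⟩
      · exact ⟨1, le_rfl, fun h h' => absurd ⟨h, h'⟩ hb⟩
    choose C hC1 hC using h1
    have hle : ∀ b, C b ≤ ∑ b, C b := fun b =>
      Finset.single_le_sum (f := C) (fun b _ => zero_le_one.trans (hC1 b)) (Finset.mem_univ b)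
    refine ⟨∑ b, C b, (hC1 A).trans (hle A), fun b hb hbn p hp t => ?_⟩
    have := S.weight_pos t
    exact (hC b hb hbn p hp t).trans (mul_le_mul_of_nonneg_right (hle b) (by positivity))
  set Z : ℝ := zetaConst M A K + 1 with hZ
  have hZ0 : 0 < Z := by positivity
  set D : ℝ := Z * C ^ n with hD
  have hC0 : 0 < C := zero_lt_one.trans_le hC1
  have hD0 : 0 < D := by positivity
  have hmem : ∀ p ∈ P, ∀ u : ℝ≥0, rateZeta M A (psiMoment M Q u p.1) ∈ B E := fun p hp u =>
    rateZeta_psiMoment_mem_B hQ hk hK hAk hR (fun i => (hp i).2) u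
  have hhb : ∀ p ∈ P, ∀ (u : ℝ≥0) y, ‖rateZeta M A (psiMoment M Q u p.1) y‖
      ≤ D * ((S.weight u)⁻¹) ^ n := by
    intro p hp u y
    have hw := S.weight_pos u
    refine (norm_rateZeta_le hAk hK (D := C) (v := (S.weight u)⁻¹) hC1 (by positivity)
      (fun b hb hbn y => hC b hb hbn (p.1, y) hp u) y).trans ?_
    rw [hD, mul_assoc]
    gcongr
    linarith
  have hgm : ∀ p ∈ P, ∀ u : ℝ≥0, ∀ b ⊂ A, b.Nonempty → Measurable fun y =>
      ((S.weight u : ℝ) : ℂ) ^ b.card * psiMoment M Q u p.1 b y := fun p _ u b _ _ =>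
    (measurable_psiMoment p.1 b (t := fun _ : E => u) (x := fun y => y) measurable_const
      measurable_id).const_mul _
  have hgb : ∀ p ∈ P, ∀ u : ℝ≥0, ∀ b ⊂ A, b.Nonempty → ∀ y,
      ‖((S.weight u : ℝ) : ℂ) ^ b.card * psiMoment M Q u p.1 b y‖ ≤ C := by
    intro p hp u b hb hbn y
    have := norm_weight_pow_mul_le (hC b hb hbn) (p := (p.1, y)) hp u
    rwa [Complex.ofReal_pow] at this
  have hLm : ∀ p ∈ P, ∀ b ⊂ A, b.Nonempty → Measurable (limitL M Q S p.1 b) :=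
    fun p hp b hb hbn => (ih b hb hbn).2.measurable hp
  have hLb : ∀ p ∈ P, ∀ b ⊂ A, b.Nonempty → ∀ y, ‖limitL M Q S p.1 b y‖ ≤ C :=
    fun p hp b hb hbn y => (ih b hb hbn).2.norm_limitL_le (hC b hb hbn) (p := (p.1, y)) hp
  have hLmem : ∀ p ∈ P, rateZeta M A (limitL M Q S p.1) ∈ B E := fun p hp =>
    rateZeta_mem_B hAk hK (hLm p hp) (hLb p hp)
  have hLz : ∀ p ∈ P, ∀ y, ‖rateZeta M A (limitL M Q S p.1) y‖ ≤ D := by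
    intro p hp y
    refine (norm_rateZeta_le hAk hK (D := C) (v := 1) hC1 zero_le_one
      (fun b hb hbn y => by rw [one_pow, mul_one]; exact hLb p hp b hb hbn y) y).trans ?_
    rw [one_pow, mul_one, hD]
    gcongr
    linarith
  set Φ : ℝ≥0 → ((Fin l → B E) × E) → ℝ → ℂ := fun t p s =>
    ((S.weight t ^ n : ℝ) : ℂ) * psi M Q s.toNNReal
      (rateZeta M A (psiMoment M Q (t - s.toNNReal) p.1)) p.2 with hΦ
  set Λ : ((Fin l → B E) × E) → ℝ → ℂ := fun p s =>
    recIntegrand M Q S (limitL M Q S p.1) A p.2 s with hΛ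
  have hΦm : ∀ t, ∀ p ∈ P, Measurable (Φ t p) := fun t p _ =>
    (measurable_psi_rateZeta A p.1 measurable_real_toNNReal
      (measurable_const.sub measurable_real_toNNReal) p.2).const_mul _
  have hΛm : ∀ p ∈ P, Measurable (Λ p) := by
    intro p hp
    have h1 : Measurable fun s : ℝ => psi M Q s.toNNReal (rateZeta M A (limitL M Q S p.1)) p.2 :=
      measurable_psi (G := fun q : ℝ × E => rateZeta M A (limitL M Q S p.1) q.2)
        ((hLmem p hp).1.comp measurable_snd) measurable_real_toNNReal measurable_const
    have h2 : Measurable fun s : ℝ => (Real.exp (-(a * n * s / 2)) : ℂ) :=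
      Complex.measurable_ofReal.comp (by fun_prop)
    exact h2.mul h1
  have hn3 : (3 : ℝ) ≤ n := by exact_mod_cast hA
  -- This is negative because `n ≥ 3`; for pairs it would be zero, which is why they are treated in
  -- the other time variable.
  set c : ℝ := a - a * n / 2 with hc
  have hc0 : c < 0 := by rw [hc]; nlinarith
  have hbd : IntegrableOn (fun s : ℝ => C₂ * D * (Real.exp (c * s) * (1 + s) ^ (S.p 1 - 1)))
      (Set.Ioi 0) := (integrableOn_exp_mul_one_add_pow hc0 _).const_mul _
  have hΦb : ∀ (t : ℝ≥0), ∀ p ∈ P, ∀ s ∈ Set.Ioc (0 : ℝ) t,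
      ‖Φ t p s‖ ≤ C₂ * D * (Real.exp (c * s) * (1 + s) ^ (S.p 1 - 1)) := by
    intro t p hp s hs
    have hst : s.toNNReal ≤ t := Real.toNNReal_le_iff_le_coe.2 hs.2
    have hs' : ((s.toNNReal : ℝ≥0) : ℝ) = s := Real.coe_toNNReal _ hs.1.le
    have hw := S.weight_pos t
    have hw' := S.weight_pos (t - s.toNNReal)
    have h1 := hC₂ ⟨_, hmem p hp (t - s.toNNReal)⟩ _ (by positivity) (hhb p hp _) s.toNNReal p.2
    have h2 := S.weight_le_mul hst
    have hs0 : 0 < s := hs.1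
    rw [hs'] at h1 h2
    simp only [hΦ]
    rw [norm_mul, Complex.norm_real, Real.norm_eq_abs, abs_of_pos (by positivity)]
    calc _ ≤ (Real.exp (-(a * s / 2)) * S.weight (t - s.toNNReal)) ^ n
          * (C₂ * (D * ((S.weight (t - s.toNNReal))⁻¹) ^ n)
            * (Real.exp (a * s) * (1 + s) ^ (S.p 1 - 1))) := by gcongr
      _ = C₂ * D * ((Real.exp (-(a * s / 2)) ^ n * Real.exp (a * s)) * (1 + s) ^ (S.p 1 - 1))
          * (S.weight (t - s.toNNReal) * (S.weight (t - s.toNNReal))⁻¹) ^ n := by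
          rw [mul_pow, mul_pow]; ring
      _ = C₂ * D * (Real.exp (c * s) * (1 + s) ^ (S.p 1 - 1)) := by
          rw [mul_inv_cancel₀ hw'.ne', one_pow, mul_one, ← Real.exp_nat_mul, ← Real.exp_add]
          congr 3; rw [hc]; ring
  have hΛb : ∀ p ∈ P, ∀ s, 0 < s →
      ‖Λ p s‖ ≤ C₂ * D * (Real.exp (c * s) * (1 + s) ^ (S.p 1 - 1)) := by
    intro p hp s hs
    have hs' : ((s.toNNReal : ℝ≥0) : ℝ) = s := Real.coe_toNNReal _ hs.le
    have h1 := hC₂ ⟨_, hLmem p hp⟩ D hD0 (hLz p hp) s.toNNReal p.2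
    rw [hs'] at h1
    simp only [hΛ, recIntegrand]
    rw [norm_mul, Complex.norm_real, Real.norm_eq_abs, abs_of_pos (Real.exp_pos _)]
    calc _ ≤ Real.exp (-(a * n * s / 2)) * (C₂ * D * (Real.exp (a * s) * (1 + s) ^ (S.p 1 - 1))) := by
          gcongr
      _ = C₂ * D * ((Real.exp (-(a * n * s / 2)) * Real.exp (a * s)) * (1 + s) ^ (S.p 1 - 1)) := by
          ring
      _ = _ := by rw [← Real.exp_add]; congr 3; rw [hc]; ring
  have hlim : ∀ s, 0 < s → Tendsto (fun q : ℝ≥0 × ((Fin l → B E) × E) => Φ q.1 q.2 s - Λ q.2 s)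
      (atTop ×ˢ 𝓟 P) (𝓝 0) := by
    intro s hs
    set v := s.toNNReal with hv
    have hs' : (v : ℝ) = s := Real.coe_toNNReal _ hs.le
    have hg0 := growth_pos (M := M) K v
    set r : ℝ≥0 → ℝ := fun t => S.weight t / S.weight (t - v) with hr
    have hrn : Tendsto (fun t => r t ^ n) atTop (𝓝 (Real.exp (-(a * n * s / 2)))) := by
      have := (S.tendsto_weight_div v).pow n
      rw [← Real.exp_nat_mul, hs'] at this
      convert this using 3
      ring
    -- The branching operator applied to the normalised lower moments at time `t - v`; by `hGeq` it
    -- absorbs the full power of the weight.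
    set G : ℝ≥0 → ((Fin l → B E) × E) → E → ℂ := fun t p => rateZeta M A
      (fun b y => ((S.weight (t - v) : ℝ) : ℂ) ^ b.card * psiMoment M Q (t - v) p.1 b y) with hG
    have hGmem : ∀ t, ∀ p ∈ P, G t p ∈ B E := fun t p hp =>
      rateZeta_mem_B hAk hK (hgm p hp (t - v)) (hgb p hp (t - v))
    have hF2 : Tendsto (fun q : ℝ≥0 × ((Fin l → B E) × E) => psi M Q v (G q.1 q.2) q.2.2
        - psi M Q v (rateZeta M A (limitL M Q S q.2.1)) q.2.2) (atTop ×ˢ 𝓟 P) (𝓝 0) := by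
      refine tendsto_zero_prod_principal_iff.2 fun ε hε => ?_
      have hn0 : (0 : ℝ) < n := by linarith
      -- The denominator is the Lipschitz constant of the branching operator times the bound for
      -- `ψ_v`.
      set ε' := ε / (Z * (n * C ^ n) * growth M K v) with hε'
      have hε'0 : 0 < ε' := by positivity
      have hev : ∀ᶠ t in atTop, ∀ b : Finset (Fin l), b ⊂ A → b.Nonempty → ∀ p ∈ P,
          ‖((S.weight (t - v) ^ b.card : ℝ) : ℂ) * psiMoment M Q (t - v) p.1 b p.2
            - limitL M Q S p.1 b p.2‖ ≤ ε' := by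
        rw [eventually_all]
        intro b
        by_cases hb : b ⊂ A ∧ b.Nonempty
        · have h1 := tendsto_zero_prod_principal_iff.1 (ih b hb.1 hb.2).2 ε' hε'0
          exact ((tendsto_tsub_const_atTop v).eventually h1).mono fun t ht _ _ => ht
        · exact Eventually.of_forall fun t h h' => absurd ⟨h, h'⟩ hb
      filter_upwards [hev] with t ht p hp
      have hdiff : ∀ y, ‖G t p y - rateZeta M A (limitL M Q S p.1) y‖ ≤ Z * (n * C ^ n) * ε' := by
        intro y
        refine (norm_rateZeta_sub_le hAk hK hC1 hε'0.le (hgm p hp (t - v)) (hLm p hp)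
          (hgb p hp (t - v)) (hLb p hp) (fun b hb hbn y => ?_) y).trans ?_
        · have := ht b hb hbn (p.1, y) hp
          rwa [Complex.ofReal_pow] at this
        · rw [← mul_assoc]
          gcongr
          linarith
      change ‖psi M Q v (G t p) p.2 - psi M Q v (rateZeta M A (limitL M Q S p.1)) p.2‖ ≤ ε
      rw [← psi_sub hQ hk hK (hGmem t p hp) (hLmem p hp)]
      refine (norm_psi_le hQ hk hK ((hGmem t p hp).1.sub (hLmem p hp).1) (by positivity) hdiff
        v p.2).trans_eq ?_
      rw [hε']
      field_simp
    have h1 : Tendsto (fun q : ℝ≥0 × ((Fin l → B E) × E) => ((r q.1 ^ n : ℝ) : ℂ)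
        * (psi M Q v (G q.1 q.2) q.2.2
          - psi M Q v (rateZeta M A (limitL M Q S q.2.1)) q.2.2)) (atTop ×ˢ 𝓟 P) (𝓝 0) := by
      have h2 : Tendsto (fun q : ℝ≥0 × ((Fin l → B E) × E) => ((r q.1 ^ n : ℝ) : ℂ))
          (atTop ×ˢ 𝓟 P) (𝓝 ((Real.exp (-(a * n * s / 2)) : ℝ) : ℂ)) :=
        (Complex.continuous_ofReal.tendsto _).comp (hrn.comp tendsto_fst)
      simpa using h2.mul hF2
    have h3 : Tendsto (fun q : ℝ≥0 × ((Fin l → B E) × E) =>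
        ((r q.1 ^ n - Real.exp (-(a * n * s / 2)) : ℝ) : ℂ)
          * psi M Q v (rateZeta M A (limitL M Q S q.2.1)) q.2.2) (atTop ×ˢ 𝓟 P) (𝓝 0) := by
      have hg : Tendsto (fun t => |r t ^ n - Real.exp (-(a * n * s / 2))| * (D * growth M K v)) atTop
          (𝓝 0) := by
        simpa using ((hrn.sub_const (Real.exp (-(a * n * s / 2)))).abs).mul_const (D * growth M K v)
      refine tendsto_zero_prod_principal_of_le hg (Eventually.of_forall fun t p hp => ?_)
      rw [norm_mul, Complex.norm_real, Real.norm_eq_abs]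
      exact mul_le_mul_of_nonneg_left
        (norm_psi_le hQ hk hK (hLmem p hp).1 hD0.le (hLz p hp) v p.2) (abs_nonneg _)
    have h4 := h1.add h3
    rw [add_zero] at h4
    refine h4.congr fun q => ?_
    obtain ⟨t, p⟩ := q
    have hw' := S.weight_pos (t - v)
    have hrw : S.weight t ^ n = r t ^ n * S.weight (t - v) ^ n := by
      rw [← mul_pow, hr]; field_simp
    have hGeq : psi M Q v (G t p) p.2 = ((S.weight (t - v) : ℝ) : ℂ) ^ n
        * psi M Q v (rateZeta M A (psiMoment M Q (t - v) p.1)) p.2 := by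
      rw [← psi_const_mul]
      congr 1
      funext y
      exact rateZeta_homogeneous _ _ y
    simp only [hΦ, hΛ, recIntegrand]
    rw [hGeq, ← hv, hrw]
    push_cast
    ring
  obtain ⟨hI1, hI2, hI3⟩ := tendsto_setIntegral_Ioc_sub hbd hΦm hΛm hΦb hΛb hlim
  have hprodcoe : ∀ f : Fin l → B E, ((∏ i ∈ A, f i : B E) : E → ℂ)
      = fun y => ∏ i ∈ A, (f i : E → ℂ) y := fun f => by funext y; simp
  have hprodb : ∀ p ∈ P, ∀ y, ‖((∏ i ∈ A, p.1 i : B E) : E → ℂ) y‖ ≤ R ^ n := by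
    intro p hp y
    rw [hprodcoe, norm_prod, ← Finset.prod_const]
    exact Finset.prod_le_prod (fun _ _ => norm_nonneg _) fun i _ => (hp i).2 y
  have hev : ∀ (t : ℝ≥0) (p : (Fin l → B E) × E),
      ((S.weight t ^ n : ℝ) : ℂ) * psiMoment M Q t p.1 A p.2
        = ((S.weight t ^ n : ℝ) : ℂ) * psi M Q t ((∏ i ∈ A, p.1 i : B E) : E → ℂ) p.2
          + ∫ s in Set.Ioc (0 : ℝ) t, Φ t p s := by
    intro t p
    rw [psiMoment_evolution hQ hk hK hAk hne, mul_add, ← hprodcoe, ← integral_const_mul]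
  -- Two weights cancel the growth of the semigroup, and a third one, available since `n ≥ 3`, makes
  -- the product term vanish.
  have hfirst : ∀ p ∈ P, ∀ t : ℝ≥0, ‖((S.weight t ^ n : ℝ) : ℂ)
      * psi M Q t ((∏ i ∈ A, p.1 i : B E) : E → ℂ) p.2‖ ≤ C₂ * R ^ n * Real.exp (-(a / 2) * t) := by
    intro p hp t
    have h1 := hC₂ _ (R ^ n) (by positivity) (hprodb p hp) t p.2
    have hw := S.weight_pos t
    rw [norm_mul, Complex.norm_real, Real.norm_eq_abs, abs_of_pos (by positivity)]
    have hwn : S.weight t ^ n ≤ S.weight t ^ 2 * Real.exp (-(a / 2) * t) := by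
      calc S.weight t ^ n ≤ S.weight t ^ 3 :=
            pow_le_pow_of_le_one hw.le (SpectralData.weight_le_one hapos.le t) hA
        _ = S.weight t ^ 2 * S.weight t := pow_succ _ 2
        _ ≤ _ := by
            gcongr
            exact (S.weight_le_exp t).trans_eq (by congr 1; ring)
    calc _ ≤ (S.weight t ^ 2 * Real.exp (-(a / 2) * t))
          * (C₂ * R ^ n * (Real.exp (a * t) * (1 + (t : ℝ)) ^ (S.p 1 - 1))) := by gcongr
      _ = C₂ * R ^ n * Real.exp (-(a / 2) * t)
          * (S.weight t ^ 2 * (Real.exp (a * t) * (1 + (t : ℝ)) ^ (S.p 1 - 1))) := by ring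
      _ = _ := by rw [S.weight_sq_mul, mul_one]
  refine ⟨⟨1 + C₂ * R ^ n + ∫ s in Set.Ioi (0 : ℝ),
    C₂ * D * (Real.exp (c * s) * (1 + s) ^ (S.p 1 - 1)), ?_,
    momentBound_of_norm_weight_pow_mul_le fun p hp t => ?_⟩, ?_, fun p hp => ⟨hLmem p hp, hI2 p hp⟩⟩
  · have : 0 ≤ ∫ s in Set.Ioi (0 : ℝ), C₂ * D * (Real.exp (c * s) * (1 + s) ^ (S.p 1 - 1)) :=
      setIntegral_nonneg measurableSet_Ioi fun s hs => by
        have : (0 : ℝ) < s := hs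
        positivity
    have : 0 ≤ C₂ * R ^ n := by positivity
    linarith
  · rw [← hn, hev]
    refine (norm_add_le _ _).trans (add_le_add ((hfirst p hp t).trans ?_) (hI1 t p hp))
    have h1 : Real.exp (-(a / 2) * t) ≤ 1 := Real.exp_le_one_iff.2
      (mul_nonpos_of_nonpos_of_nonneg (by linarith) t.coe_nonneg)
    have h2 : 0 ≤ C₂ * R ^ n := by positivity
    nlinarith
  · have hg : Tendsto (fun t : ℝ≥0 => C₂ * R ^ n * Real.exp (-(a / 2) * t)) atTop (𝓝 0) := by
      have := (tendsto_exp_mul_one_add_pow 0 (c := -(a / 2)) (by linarith)).const_mul (C₂ * R ^ n)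
      simpa using this
    have h1 : Tendsto (fun q : ℝ≥0 × ((Fin l → B E) × E) => ((S.weight q.1 ^ n : ℝ) : ℂ)
        * psi M Q q.1 ((∏ i ∈ A, q.2.1 i : B E) : E → ℂ) q.2.2) (atTop ×ˢ 𝓟 P) (𝓝 0) :=
      tendsto_zero_prod_principal_of_le hg (Eventually.of_forall fun t p hp => hfirst p hp t)
    have h2 := h1.add hI3
    rw [add_zero] at h2
    refine h2.congr fun q => ?_
    rw [← hn, hev, limitL_eq_integral hA]
    ring

end Recursion

/-- The weight uses natural subtraction in `S.p 1 - 1`, which agrees with the real one because `p 1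
≥ 1`. -/
theorem Delta_eq {E Ξ : Type*} [MeasurableSpace E] [MeasurableSpace Ξ] {M : BranchingModel E Ξ}
    {Q : Kernel E (Tree E Ξ)} {S : SpectralData E} {l : ℕ} (hp : 1 ≤ S.p 1) (t : ℝ≥0) : Delta M Q S l t
    = ⨆ (x : E) (f : Fin l → B E) (_ : ∀ i, f i ∈ S.smallSpaceOne),
      ‖((S.weight t ^ l : ℝ) : ℂ) * psiMoment M Q t f Finset.univ x
        - limitL M Q S f Finset.univ x‖ₑ := by
  have h : Real.exp (-(l * (S.eig 1).re * t / 2)) *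
        (1 + (t : ℝ)) ^ (-(l * ((S.p 1 : ℝ) - 1) / 2)) = S.weight t ^ l := by
    rw [SpectralData.weight, mul_pow, ← Real.exp_nat_mul, ← Real.rpow_mul_natCast (by positivity)]
    push_cast [hp]
    congr 2 <;> ring
  rw [← h]
  rfl

/-! ### Conclusion of the induction. -/

section Main

variable {E Ξ : Type*} [MeasurableSpace E] [MeasurableSpace Ξ] {M : BranchingModel E Ξ}
  {Q : Kernel E (Tree E Ξ)} {S : SpectralData E} {l : ℕ} {R : ℝ}
  [IsMarkovKernel Q] (hQ : M.IsTreeLaw Q) {k : ℕ} (hk : 1 ≤ k)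
    {K : ℝ≥0} (hK : ∀ x, ∫⁻ o, (o.1 : ℝ≥0∞) ^ k ∂(M.offspring x) ≤ K) (hS : S.H1 (psi M Q))

include hQ hk hK hS

/-- Boundedness and uniform convergence of all rescaled moments. -/
theorem moment_bound_and_limit (hR : 1 ≤ R) (A : Finset (Fin l)) (hA : A.Nonempty)
    (hAk : A.card ≤ k) :
    (∃ C, 1 ≤ C ∧ MomentBound M Q S R A C) ∧ MomentLimit M Q S R A := by
  induction A using Finset.strongInduction with
  | H A ih =>
    have hpos := hA.card_pos
    rcases Nat.lt_or_ge A.card 3 with h | h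
    · obtain h1 | h2 : A.card = 1 ∨ A.card = 2 := by omega
      · exact moment_singleton hQ hk hK hS (zero_lt_one.trans_le hR) h1
      · have := moment_pair hQ hk hK hS hR hAk h2
        exact ⟨this.1, this.2.1⟩
    · have := moment_of_ssubset hQ hk hK hS hR hAk h fun b hb hbn =>
        ih b hb hbn ((Finset.card_le_card hb.1).trans hAk)
      exact ⟨this.1, this.2.1⟩

theorem limitWellDefined (hlk : l ≤ k) {f : Fin l → B E} (hf : ∀ i, f i ∈ S.smallSpace) :
    LimitWellDefined M Q S f := by
  obtain ⟨R, hR, hfR⟩ := exists_bound f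
  have hmem : ∀ x, (f, x) ∈ smallParams S l R := fun x i => ⟨hf i, hfR i⟩
  unfold LimitWellDefined
  intro A
  have hAk : A.card ≤ k := (A.card_le_univ.trans_eq (Fintype.card_fin l)).trans hlk
  constructor
  · intro h2
    have h := (moment_pair hQ hk hK hS hR hAk h2).2.2
    exact ⟨fun s => rateZeta_psiMoment_mem_B hQ hk hK hAk hR hfR s, fun x => h (f, x) (hmem x)⟩
  · intro _ h4
    have h := (moment_of_ssubset hQ hk hK hS hR hAk (le_trans (by norm_num) h4) fun b hb hbn =>
      moment_bound_and_limit hQ hk hK hS hR b hbn ((Finset.card_le_card hb.1).trans hAk)).2.2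
    refine ⟨?_, fun x => (h (f, x) (hmem x)).2⟩
    -- The parameters include a point of `E`, so the empty space is treated apart.
    rcases isEmpty_or_nonempty E with hE | ⟨⟨x⟩⟩
    · exact ⟨measurable_of_empty _, 0, fun x => hE.elim x⟩
    · exact (h (f, x) (hmem x)).1

/-- The supremum runs over the parameter set with `R = 1`. There the normalised moment and its limit
share the bound `C`, and the convergence is uniform. -/
theorem Delta_bounded_and_tendsto (hl : 1 ≤ l) (hlk : l ≤ k) :
    (⨆ t : ℝ≥0, Delta M Q S l t) < ∞ ∧ Tendsto (Delta M Q S l) atTop (𝓝 0) := by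
  have hp : 1 ≤ S.p 1 := hS.one_le_p 1 le_rfl hS.one_le_m
  have hcard : (Finset.univ : Finset (Fin l)).card = l := by simp
  have hmem : ∀ {f : Fin l → B E} (x : E), (∀ i, f i ∈ S.smallSpaceOne) →
      (f, x) ∈ smallParams S l 1 := fun x hf i => ⟨(hf i).1, (hf i).2⟩
  obtain ⟨⟨C, hC1, hC⟩, hlim⟩ := moment_bound_and_limit hQ hk hK hS le_rfl
    (Finset.univ : Finset (Fin l)) (Finset.card_pos.1 (by rw [hcard]; exact hl))
    (by rw [hcard]; exact hlk)
  constructor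
  · refine lt_of_le_of_lt (iSup_le fun t => ?_) (ENNReal.ofReal_lt_top (r := C + C))
    rw [Delta_eq hp]
    refine iSup_le fun x => iSup_le fun f => iSup_le fun hf => ?_
    rw [← ofReal_norm]
    refine ENNReal.ofReal_le_ofReal ((norm_sub_le _ _).trans (add_le_add ?_
      (hlim.norm_limitL_le hC (hmem x hf))))
    have := norm_weight_pow_mul_le hC (hmem x hf) t
    rwa [hcard] at this
  · refine ENNReal.tendsto_nhds_zero.2 fun ε hε => ?_
    obtain ⟨ε', hε'0, hε'⟩ : ∃ ε' : ℝ, 0 < ε' ∧ ENNReal.ofReal ε' ≤ ε := by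
      rcases eq_or_ne ε ∞ with rfl | h
      · exact ⟨1, one_pos, le_top⟩
      · exact ⟨ε.toReal, ENNReal.toReal_pos hε.ne' h, (ENNReal.ofReal_toReal h).le⟩
    filter_upwards [tendsto_zero_prod_principal_iff.1 hlim ε' hε'0] with t ht
    rw [Delta_eq hp]
    refine iSup_le fun x => iSup_le fun f => iSup_le fun hf => ?_
    have := ht _ (hmem x hf)
    simp only [hcard] at this
    rw [← ofReal_norm]
    exact (ENNReal.ofReal_le_ofReal this).trans hε'

end Main

end BranchingMoments

theorem theorem2p2 {E Ξ : Type*} [TopologicalSpace E] [PolishSpace E] [MeasurableSpace E]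
    [BorelSpace E] [MeasurableSpace Ξ]
    (M : BranchingMoments.BranchingModel E Ξ)
    (Q : Kernel E (BranchingMoments.Tree E Ξ)) (hQ : M.IsTreeLaw Q)
    (S : BranchingMoments.SpectralData E) (hS : S.H1 (BranchingMoments.psi M Q))
    (k : ℕ) (hk : 2 ≤ k)
    (hN : (⨆ x : E, ∫⁻ o, (o.1 : ℝ≥0∞) ^ k ∂(M.offspring x)) < ∞)
    (l : ℕ) (hl : 1 ≤ l) (hlk : l ≤ k) :
    (∀ (t : ℝ≥0) (f : Fin l → BranchingMoments.B E) (x : E),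
      Integrable (fun τ => ∏ i, ∫ y, (f i : E → ℂ) y ∂(M.X t τ)) (Q x)) ∧
    (∀ f : Fin l → BranchingMoments.B E, (∀ i, f i ∈ S.smallSpace) →
      BranchingMoments.LimitWellDefined M Q S f) ∧
    (⨆ t : ℝ≥0, BranchingMoments.Delta M Q S l t) < ∞ ∧
    Tendsto (BranchingMoments.Delta M Q S l) atTop (𝓝 0) := by
  have : IsMarkovKernel Q := hQ.isMarkovKernel
  have hk1 : 1 ≤ k := one_le_two.trans hk
  have hK : ∀ x, ∫⁻ o, (o.1 : ℝ≥0∞) ^ k ∂(M.offspring x)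
      ≤ (⨆ x : E, ∫⁻ o, (o.1 : ℝ≥0∞) ^ k ∂(M.offspring x)).toNNReal := fun x => by
    rw [ENNReal.coe_toNNReal hN.ne]
    exact le_iSup (fun x : E => ∫⁻ o, (o.1 : ℝ≥0∞) ^ k ∂(M.offspring x)) x
  refine ⟨fun t f x => ?_, fun f hf => ?_, ?_⟩
  · exact BranchingMoments.integrable_prod_linearStat hQ hk1 hK (A := Finset.univ)
      (by rw [Finset.card_univ, Fintype.card_fin]; exact hlk) f t x
  · exact BranchingMoments.limitWellDefined hQ hk1 hK hS hlk hf
  · exact BranchingMoments.Delta_bounded_and_tendsto hQ hk1 hK hS hl hlk
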